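/- **Setting.** Let $d\ge 1$, write $z=(x,\xi)\in\mathbb R^{2d}$, $\langle z\rangle=(1+|z|^2)^{1/2}$, $\mathcal F\varphi(\zeta)=\int \varphi(w)e^{-2\pi i w\cdot\zeta}\,dw$, and $$W(f,g)(x,\xi)=\int_{\mathbb R^d} f\big(x+\tfrac t2\big)\overline{g\big(x-\tfrac t2\big)}\,e^{-2\pi i t\cdot\xi}\,dt,\qquad Wf=W(f,f).$$ *Propagator.* Let $a(z)=\frac12 z\cdot Qz$ with $Q\in\mathbb R^{2d\times 2d}$ symmetric, and let $\sigma\in S^0_{0,0}(\mathbb R^{2d})$, that is, $\sigma\in C^\infty(\mathbb R^{2d};\mathbb C)$ with all derivatives bounded. Let $H=Op_w(a)+Op_w(\sigma)$, where $\langle Op_w(s)f,g\rangle=\int_{\mathbb R^{2d}} s(z)\,\overline{W(g,f)(z)}\,dz$ for Schwartz functions $f,g$. Let $e^{itH}$, $t\in\mathbb R$, be the strongly continuous group on $L^2(\mathbb R^d)$ whose generator extends $iH|_{\mathcal S(\mathbb R^d)}$; thus $u=e^{itH}u_0$ solves $i\partial_tu+Hu=0$, $u(0)=u_0$. *Classical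 flow.* Let $\chi_t\in Sp(d,\mathbb R)$ be the linear flow of $$2\pi\dot x=-\nabla_\xi a,\qquad 2\pi\dot\xi=\nabla_x a$$ (so $e^{itOp_w(a)}=\mu(\chi_t)$ up to a phase factor, with $\mu$ as follows). *Metaplectic Wigner distributions.* For a symplectic matrix $M$, $\mu(M)$ is the unitary operator on $L^2$, unique up to a phase factor, with $\mu(M)\rho(z)=\rho(Mz)\mu(M)$ for all $z$, where $\rho(x,\xi)f(t)=e^{-\pi i x\cdot\xi}e^{2\pi i\xi\cdot t}f(t-x)$. For $\mathcal A\in Sp(2d,\mathbb R)$ (a $4d\times4d$ matrix) put $W_{\mathcal A}(f,g)=\mu(\mathcal A)(f\otimes\bar g)$ and $W_{\mathcal A}f=W_{\mathcal A}(f,f)$. The matrix $\mathcal A$ is *covariant* if, in $d\times d$ blocks, $$\mathcal A=\begin{pmatrix}A_{11}&I-A_{11}&A_{13}&A_{13}\\A_{21}&-A_{21}&I-A_{11}^T&-A_{11}^T\\0&0&I&I\\-I&I&0&0\end{pmatrix},\quad A_{13}=A_{13}^T,\ A_{21}=A_{21}^T .$$ In that case let $$B_{\mathcal A}=\begin{pmatrix}A_{13}&\frac12I-A_{11}\\\frac12I-A_{11}^T&-A_{21}\end{pmatrix},\qquad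 \Sigma_{\mathcal A}=\mathcal F^{-1}\big(e^{-\pi i\zeta\cdot B_{\mathcal A}\zeta}\big)\in\mathcal S'(\mathbb R^{2d}).$$ *Wave front sets.* For $f\in L^2(\mathbb R^d)$ and $\mathcal A$ covariant, a point $z_0\neq0$ of $\mathbb R^{2d}$ is *not* in $WF_{\mathcal A}(f)$ if and only if there is an open conic neighbourhood $\Gamma$ of $z_0$ such that $\int_\Gamma\langle z\rangle^{2N}|W_{\mathcal A}f(z)|^2\,dz<\infty$ for every integer $N\ge0$; $WF(f)\subset\mathbb R^{2d}\setminus\{0\}$ is defined in the same way with $Wf$ in place of $W_{\mathcal A}f$. **Theorem.** Let $t\in\mathbb R$. 1. For every covariant $\mathcal A\in Sp(2d,\mathbb R)$ there is exactly one covariant $\mathcal A_t\in Sp(2d,\mathbb R)$ such that, up to a phase factor, $W_{\mathcal A_t}(f,g)=W(f,g)*(\Sigma_{\mathcal A}\circ\chi_t)$ for all $f,g\in\mathcal S(\mathbb R^d)$, and $$WF_{\mathcal A}(e^{itH}u_0)=\chi_t\big(WF_{\mathcal A_t}(u_0)\big)\qquad\text{for all }u_0\in L^2(\mathbb R^d).$$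 2. For the standard Wigner distribution, $$WF(e^{itH}u_0)=\chi_t\big(WF(u_0)\big)\qquad\text{for all }u_0\in L^2(\mathbb R^d).$$ -/

import Mathlib

open MeasureTheory Set Matrix
open scoped ComplexConjugate FourierTransform SchwartzMap ContDiff ENNReal

noncomputable section

namespace WignerFlow

/-- Euclidean space with coordinates indexed by `ι`. -/
abbrev E (ι : Type) [Fintype ι] : Type := EuclideanSpace ℝ ι

/-- Phase space: the points `z = (x, ξ)`, with `x` in the `inl` and `ξ` in the `inr` coordinates. -/
abbrev Phase (ι : Type) [Fintype ι] : Type := EuclideanSpace ℝ (ι ⊕ ι)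

/-- The Hilbert space `L²` of complex functions for Lebesgue measure. -/
abbrev L2 (ι : Type) [Fintype ι] : Type := Lp ℂ 2 (volume : Measure (E ι))

section Basic

variable {ι : Type} [Fintype ι]

/-- First half of the coordinates: `x` for `z = (x, ξ)`. -/
def fstPart (z : Phase ι) : E ι := WithLp.toLp 2 fun i => z (Sum.inl i)

/-- Second half of the coordinates: `ξ` for `z = (x, ξ)`. -/
def sndPart (z : Phase ι) : E ι := WithLp.toLp 2 fun i => z (Sum.inr i)

/-- The quadratic form `z · B z`. -/
def quad (B : Matrix ι ι ℝ) (z : E ι) : ℝ := z.ofLp ⬝ᵥ (B *ᵥ z.ofLp)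

/-- The matrix `M` acting on a vector of Euclidean space. -/
def act (M : Matrix ι ι ℝ) (z : E ι) : E ι := WithLp.toLp 2 (M *ᵥ z.ofLp)

/-! ### Time-frequency shifts and metaplectic operators -/

/-- The symmetric time-frequency shift `ρ(x, ξ) f (t) = e^{-π i x·ξ} e^{2π i ξ·t} f(t - x)`. -/
def tfShiftFun (z : Phase ι) (f : E ι → ℂ) (t : E ι) : ℂ :=
  Complex.exp (-(Real.pi * inner ℝ (fstPart z) (sndPart z) : ℝ) * Complex.I) *
    (Complex.exp ((2 * Real.pi * inner ℝ (sndPart z) t : ℝ) * Complex.I) * f (t - fstPart z))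

theorem memLp_tfShiftFun (z : Phase ι) (f : L2 ι) :
    MemLp (tfShiftFun z f) 2 (volume : Measure (E ι)) := by
  have h1 : MemLp (fun t => (f : E ι → ℂ) (t - fstPart z)) 2 (volume : Measure (E ι)) :=
    (Lp.memLp f).comp_measurePreserving (measurePreserving_sub_right volume (fstPart z))
  have hc : Continuous fun t : E ι =>
      Complex.exp ((2 * Real.pi * inner ℝ (sndPart z) t : ℝ) * Complex.I) := by fun_prop
  refine MemLp.const_mul (MemLp.of_le h1 (hc.aestronglyMeasurable.mul h1.1) ?_) _
  refine Filter.Eventually.of_forall fun t => ?_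
  rw [Pi.mul_apply, Complex.norm_mul, Complex.norm_exp_ofReal_mul_I, one_mul]

/-- The symmetric time-frequency shift `ρ(z)` on `L²`. -/
def tfShift (z : Phase ι) (f : L2 ι) : L2 ι := (memLp_tfShiftFun z f).toLp _

/-- The unitary operator `T` on `L²` is a metaplectic operator with projection `M`:
`T ρ(z) = ρ(M z) T` for all `z`.  For symplectic `M` such a `T` exists and is unique up to a
constant of modulus one.  With this convention the Fourier transform belongs to
`(x, ξ) ↦ (ξ, -x)`, multiplication by `e^{π i C t·t}` to `(x, ξ) ↦ (x, ξ + C x)`, and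
`f ↦ |det L|^{1/2} f(L ·)` to `(x, ξ) ↦ (L⁻¹ x, Lᵀ ξ)`. -/
def IsMetaplectic (M : Matrix (ι ⊕ ι) (ι ⊕ ι) ℝ) (T : L2 ι ≃ₗᵢ[ℂ] L2 ι) : Prop :=
  ∀ (z : Phase ι) (f : L2 ι), T (tfShift z f) = tfShift (act M z) (T f)

open Classical in
/-- The metaplectic operator `μ(M)` of a symplectic matrix `M`, determined up to a phase factor. -/
def metaplectic (M : Matrix (ι ⊕ ι) (ι ⊕ ι) ℝ) : L2 ι ≃ₗᵢ[ℂ] L2 ι :=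
  if h : ∃ T : L2 ι ≃ₗᵢ[ℂ] L2 ι, IsMetaplectic M T then h.choose
  else LinearIsometryEquiv.refl ℂ (L2 ι)

/-! ### Wigner distributions -/

/-- The function `f ⊗ ḡ : (x, y) ↦ f(x) * conj (g(y))`. -/
def tensorConjFun (f g : E ι → ℂ) (w : Phase ι) : ℂ := f (fstPart w) * conj (g (sndPart w))

theorem memLp_tensorConjFun (f g : L2 ι) :
    MemLp (tensorConjFun f g) 2 (volume : Measure (Phase ι)) := by
  let e : Phase ι → E ι × E ι := fun w => (fstPart w, sndPart w)
  have he : MeasurePreserving e (volume : Measure (Phase ι))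
      ((volume : Measure (E ι)).prod (volume : Measure (E ι))) := by
    have h1 := PiLp.volume_preserving_ofLp (ι ⊕ ι)
    have h2 := volume_measurePreserving_sumPiEquivProdPi (fun _ : ι ⊕ ι => ℝ)
    have h3 := (PiLp.volume_preserving_toLp ι).prod (PiLp.volume_preserving_toLp ι)
    exact h3.comp (h2.comp h1)
  have hf := Lp.memLp f
  have hg := Lp.memLp g
  have hF : AEStronglyMeasurable (fun p : E ι × E ι => (f : E ι → ℂ) p.1 * conj ((g : E ι → ℂ) p.2))
      ((volume : Measure (E ι)).prod (volume : Measure (E ι))) :=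
    hf.1.comp_fst.mul (Complex.continuous_conj.comp_aestronglyMeasurable hg.1.comp_snd)
  have hP : MemLp (fun p : E ι × E ι => (f : E ι → ℂ) p.1 * conj ((g : E ι → ℂ) p.2)) 2
      ((volume : Measure (E ι)).prod (volume : Measure (E ι))) := by
    rw [memLp_two_iff_integrable_sq_norm hF]
    have := ((memLp_two_iff_integrable_sq_norm hf.1).1 hf).mul_prod
      ((memLp_two_iff_integrable_sq_norm hg.1).1 hg)
    refine this.congr (Filter.Eventually.of_forall fun p => ?_)
    simp [mul_pow]
  exact hP.comp_measurePreserving he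

/-- `f ⊗ ḡ` as an element of `L²`. -/
def tensorConj (f g : L2 ι) : L2 (ι ⊕ ι) := (memLp_tensorConjFun f g).toLp _

/-- The metaplectic Wigner distribution `W_𝒜(f, g) = μ(𝒜)(f ⊗ ḡ)`. -/
def metaWigner (𝒜 : Matrix ((ι ⊕ ι) ⊕ (ι ⊕ ι)) ((ι ⊕ ι) ⊕ (ι ⊕ ι)) ℝ) (f g : L2 ι) : L2 (ι ⊕ ι) :=
  metaplectic 𝒜 (tensorConj f g)

/-- The cross-Wigner distribution
`W(f, g)(x, ξ) = ∫ f(x + t/2) * conj (g(x - t/2)) * e^{-2π i t·ξ} dt`. -/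
def wigner (f g : E ι → ℂ) (z : Phase ι) : ℂ :=
  ∫ t : E ι, f (fstPart z + (1 / 2 : ℝ) • t) * conj (g (fstPart z - (1 / 2 : ℝ) • t)) *
    Complex.exp (-(2 * Real.pi * inner ℝ t (sndPart z) : ℝ) * Complex.I)

/-! ### Covariant matrices and the Cohen class -/

variable [DecidableEq ι]

/-- Covariant symplectic matrices, in `d × d` blocks. -/
def IsCovariant (𝒜 : Matrix ((ι ⊕ ι) ⊕ (ι ⊕ ι)) ((ι ⊕ ι) ⊕ (ι ⊕ ι)) ℝ) : Prop :=
  𝒜 ∈ Matrix.symplecticGroup (ι ⊕ ι) ℝ ∧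
  ∃ A₁₁ A₁₃ A₂₁ : Matrix ι ι ℝ, A₁₃.IsSymm ∧ A₂₁.IsSymm ∧
    𝒜 = fromBlocks
      (fromBlocks A₁₁ (1 - A₁₁) A₂₁ (-A₂₁)) (fromBlocks A₁₃ A₁₃ (1 - A₁₁ᵀ) (-A₁₁ᵀ))
      (fromBlocks 0 0 (-1) 1) (fromBlocks 1 1 0 0)

/-- The symmetric matrix `B_𝒜 = (A₁₃, 1/2 - A₁₁; 1/2 - A₁₁ᵀ, -A₂₁)` of a covariant matrix. -/
def cohenMatrix (𝒜 : Matrix ((ι ⊕ ι) ⊕ (ι ⊕ ι)) ((ι ⊕ ι) ⊕ (ι ⊕ ι)) ℝ) :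
    Matrix (ι ⊕ ι) (ι ⊕ ι) ℝ :=
  fromBlocks 𝒜.toBlocks₁₂.toBlocks₁₁
    ((1 / 2 : ℝ) • 1 - 𝒜.toBlocks₁₁.toBlocks₁₁)
    ((1 / 2 : ℝ) • 1 - 𝒜.toBlocks₁₁.toBlocks₁₁ᵀ)
    (-𝒜.toBlocks₁₁.toBlocks₂₁)

/-- The Cohen kernel `Σ_𝒜 = 𝓕⁻¹(e^{-π i ζ·B_𝒜 ζ})`, as a tempered distribution: its value at a
Schwartz function `φ` is `∫ e^{-π i ζ·B_𝒜 ζ} (𝓕⁻¹ φ)(ζ) dζ`. -/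
def cohenKernel (𝒜 : Matrix ((ι ⊕ ι) ⊕ (ι ⊕ ι)) ((ι ⊕ ι) ⊕ (ι ⊕ ι)) ℝ) (φ : Phase ι → ℂ) : ℂ :=
  ∫ ζ : Phase ι, Complex.exp (-(Real.pi * quad (cohenMatrix 𝒜) ζ : ℝ) * Complex.I) * 𝓕⁻ φ ζ

/-- The distribution `Λ ∘ χ` (that is, `z ↦ Λ(χ z)`) for an invertible matrix `χ`. -/
def distComp (Λ : (Phase ι → ℂ) → ℂ) (χ : Matrix (ι ⊕ ι) (ι ⊕ ι) ℝ) (φ : Phase ι → ℂ) : ℂ :=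
  (|χ.det|⁻¹ : ℝ) * Λ fun w => φ (act χ⁻¹ w)

/-- The Cohen class representation `Q_Λ(f, g) = W(f, g) * Λ` (convolution with a distribution). -/
def cohenClass (Λ : (Phase ι → ℂ) → ℂ) (f g : E ι → ℂ) (z : Phase ι) : ℂ :=
  Λ fun w => wigner f g (z - w)

/-- `𝒜'` is a covariant matrix with `W_{𝒜'} = Q_{Σ_𝒜 ∘ χ}`, metaplectic operators being
determined only up to a phase factor. -/
def IsTransported (𝒜 : Matrix ((ι ⊕ ι) ⊕ (ι ⊕ ι)) ((ι ⊕ ι) ⊕ (ι ⊕ ι)) ℝ)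
    (χ : Matrix (ι ⊕ ι) (ι ⊕ ι) ℝ)
    (𝒜' : Matrix ((ι ⊕ ι) ⊕ (ι ⊕ ι)) ((ι ⊕ ι) ⊕ (ι ⊕ ι)) ℝ) : Prop :=
  IsCovariant 𝒜' ∧ ∃ c : ℂ, ‖c‖ = 1 ∧ ∀ f g : 𝓢(E ι, ℂ),
    (metaWigner 𝒜' (f.toLp 2) (g.toLp 2) : Phase ι → ℂ) =ᵐ[volume]
      fun z => c * cohenClass (distComp (cohenKernel 𝒜) χ) f g z

end Basic

/-! ### Wave front sets -/

section WaveFront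

variable {ι : Type} [Fintype ι]

/-- The points `z₀ ≠ 0` without any open conic neighbourhood `Γ` such that
`∫_Γ ⟨z⟩^{2N} |F(z)|² dz < ∞` for all `N`, where `⟨z⟩² = 1 + |z|²`. -/
def nonDecaySet (F : Phase ι → ℂ) : Set (Phase ι) :=
  {z₀ | z₀ ≠ 0 ∧ ¬ ∃ Γ : Set (Phase ι), IsOpen Γ ∧ (∀ z ∈ Γ, ∀ r : ℝ, 0 < r → r • z ∈ Γ) ∧
    z₀ ∈ Γ ∧ ∀ N : ℕ, ∫⁻ z in Γ, ENNReal.ofReal ((1 + ‖z‖ ^ 2) ^ N * ‖F z‖ ^ 2) < ⊤}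

/-- The `𝒜`-Wigner wave front set. -/
def metaWaveFront (𝒜 : Matrix ((ι ⊕ ι) ⊕ (ι ⊕ ι)) ((ι ⊕ ι) ⊕ (ι ⊕ ι)) ℝ) (f : L2 ι) :
    Set (Phase ι) :=
  nonDecaySet (metaWigner 𝒜 f f)

/-- The Wigner wave front set. -/
def wignerWaveFront (f : L2 ι) : Set (Phase ι) := nonDecaySet (wigner f f)

end WaveFront

/-! ### Weyl operators, the propagator and the classical flow -/

section Evolution

variable {ι : Type} [Fintype ι]

/-- The symbol class `S⁰₀,₀`: smooth, with all derivatives bounded. -/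
def IsSymbol (σ : Phase ι → ℂ) : Prop :=
  ContDiff ℝ ∞ σ ∧ ∀ k : ℕ, ∃ C : ℝ, ∀ z, ‖iteratedFDeriv ℝ k σ z‖ ≤ C

/-- `h ∈ L²` equals `Op_w(s) f`, for a symbol `s` of polynomial growth and a Schwartz function `f`:
`⟨Op_w(s) f, g⟩ = ∫ s(z) * conj (W(g, f)(z)) dz` for all Schwartz functions `g`. -/
def IsWeylOp (s : Phase ι → ℂ) (f : 𝓢(E ι, ℂ)) (h : L2 ι) : Prop :=
  ∀ g : 𝓢(E ι, ℂ), inner ℂ (g.toLp 2 : L2 ι) h = ∫ z : Phase ι, s z * conj (wigner g f z)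

/-- `U(t) = e^{itH}` with `H = Op_w(s)`: a strongly continuous one-parameter group on `L²` whose
generator extends `i Op_w(s)` on the Schwartz space.  For `s` the sum of a real quadratic form and
a symbol in `S⁰₀,₀` there is exactly one such group, because a core of the generator is the
Schwartz space. -/
structure IsPropagator (s : Phase ι → ℂ) (U : ℝ → L2 ι →L[ℂ] L2 ι) : Prop where
  zero : U 0 = ContinuousLinearMap.id ℂ (L2 ι)
  add : ∀ t₁ t₂ : ℝ, U (t₁ + t₂) = (U t₁).comp (U t₂)
  continuous : ∀ f : L2 ι, Continuous fun t => U t f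
  generator : ∀ f : 𝓢(E ι, ℂ), ∃ h : L2 ι, IsWeylOp s f h ∧
    HasDerivAt (fun t => U t (f.toLp 2)) (Complex.I • h) 0

variable [DecidableEq ι]

/-- The classical flow of the quadratic Hamiltonian `a(z) = (1/2) z · Q z` that belongs to
`i ∂ₜ u + Op_w(a) u = 0`, that is, the solution of `2π ẋ = -∇_ξ a`, `2π ξ̇ = ∇ₓ a`.  So
`χ_t = e^{-(t / 2π) 𝔻}` where `𝔻 z = (∇_ξ a, -∇ₓ a)`. -/
def flow (Q : Matrix (ι ⊕ ι) (ι ⊕ ι) ℝ) (t : ℝ) : Matrix (ι ⊕ ι) (ι ⊕ ι) ℝ :=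
  NormedSpace.exp ((-(t / (2 * Real.pi))) • (fromBlocks 0 1 (-1) 0 * Q))

end Evolution

end WignerFlow

end

open WignerFlow

open MeasureTheory Set Matrix
open scoped ComplexConjugate FourierTransform SchwartzMap ContDiff ENNReal

noncomputable section

namespace WignerFlow

/-! ### The unit circle character -/

/-! Everything is read off inner products with the coherent states ρ(z)φ, φ(x) = e^{-π|x|²}. For
fixed x the ambiguity function z ↦ ⟨f, ρ(z)g⟩ (`ambig`) is a Fourier transform in ξ, so Plancherel
gives Moyal's identity (`lintegral_ambig_sq`, `inner_ambigLp`). It yields a resolution of the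
identity, totality of every orbit ρ(z)g with g ≠ 0, and the Schur lemma
`IsMetaplectic.exists_eq_smul`: a metaplectic operator is determined by its matrix up to a phase.

The transported matrix. The map f ⊗ ḡ ↦ W(f, g) extends to a unitary operator. Following it by the
Fourier multiplier e^{-πi ζ·Bζ} gives `cohenOp B`. When B = B_𝒜, the matrix by which this operator
intertwines the shifts is exactly 𝒜 (`IsCovariant.act_eq`), so it is μ(𝒜) up to a phase and W_𝒜 is W
convolved with Σ_𝒜. Convolving with Σ_𝒜 ∘ χ instead replaces B by χ⁻¹ B χ⁻ᵀ (`cohenClass_distComp`).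
Since every symmetric B is the Cohen matrix of a covariant matrix, this produces 𝒜_t. It is unique
because proportional operators intertwine shifts in the same way, and ρ is injective
(`eq_of_tfShift_eq`).

The propagator. Its Gabor matrix ⟨ρ(v)φ, e^{itH}ρ(z)φ⟩ decays faster than any power of |v - χ_t z|
(`IsPropagator.gaborDecay`). To see this, differentiate e^{-itH} along the moving state centred at
χ_t z. The motion of the centre cancels the affine Taylor part of the quadratic symbol at the
centre. What remains is a purely quadratic term in the distance to the centre plus the bounded
symbol σ, and the coherent-state matrix of this defect decays rapidly off the diagonal
(`exists_generator_decay`). Inserting the resolution of the identity gives a linear integral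
inequality with a rapidly decaying kernel, to which `offdiagonal_gronwall` applies. Unitarity is
never needed, only boundedness of the group on compact time intervals, so σ may be complex valued.

Wave fronts. The quadratic expression Q_B(u) = 𝓕⁻¹(e^{-πi ζ·Bζ}) * W(u, u) is made tractable by
taking its ambiguity function with window Q_B(φ): in suitable unimodular coordinates p = (p₁, p₂)
this is ⟨u, ρ(p₁)φ⟩ times the conjugate of ⟨u, ρ(p₂)φ⟩, located at `midpointMap B p`. Hence, for a
moderate weight m, finiteness of ∫ m²|Q_B(u)|² is a weighted condition on the tensor square of the
ambiguity function of u (`lintegral_cohenWigner_lt_top_iff`). Schur's test with the tensor square of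
the Gabor bound transports such conditions through e^{itH}, and symplecticity of χ_t turns the
midpoint map of B into that of χ_t⁻¹ B χ_t⁻ᵀ. The moderate weights (1 + dist(x, Γᶜ))^N encode decay
in a cone Γ, which gives one inclusion of wave front sets. Applying it to e^{-itH} gives the other.
The standard Wigner distribution is the case B = 0, which is fixed by the conjugation. -/

/-- `cis s = e^{i s}`. -/
def cis (s : ℝ) : ℂ := Complex.exp (s * Complex.I)

theorem cis_add (s t : ℝ) : cis (s + t) = cis s * cis t := by
  rw [cis, cis, cis, ← Complex.exp_add]; push_cast; ring_nf

@[simp] theorem cis_zero : cis 0 = 1 := by simp [cis]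

@[simp] theorem norm_cis (s : ℝ) : ‖cis s‖ = 1 := by
  rw [cis, Complex.norm_exp_ofReal_mul_I]

@[simp] theorem cis_ne_zero (s : ℝ) : cis s ≠ 0 := Complex.exp_ne_zero _

@[simp] theorem conj_cis (s : ℝ) : conj (cis s) = cis (-s) := by
  rw [cis, cis, ← Complex.exp_conj]; simp

theorem continuous_cis : Continuous cis := by unfold cis; fun_prop

@[fun_prop]
theorem Continuous.cis {X : Type*} [TopologicalSpace X] {f : X → ℝ} (hf : Continuous f) :
    Continuous fun x => WignerFlow.cis (f x) := continuous_cis.comp hf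

section Basic

variable {ι : Type} [Fintype ι]

/-! ### Coordinates of phase space -/

/-- The point `(x, ξ)` of phase space. -/
def mkPhase (x ξ : E ι) : Phase ι := WithLp.toLp 2 (Sum.elim x ξ)

@[simp] theorem fstPart_mkPhase (x ξ : E ι) : fstPart (mkPhase x ξ) = x := by
  ext i; simp [fstPart, mkPhase]

@[simp] theorem sndPart_mkPhase (x ξ : E ι) : sndPart (mkPhase x ξ) = ξ := by
  ext i; simp [sndPart, mkPhase]

@[simp] theorem mkPhase_parts (z : Phase ι) : mkPhase (fstPart z) (sndPart z) = z := by
  ext i; cases i <;> simp [fstPart, sndPart, mkPhase]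

theorem phase_ext {z w : Phase ι} (h1 : fstPart z = fstPart w) (h2 : sndPart z = sndPart w) :
    z = w := by rw [← mkPhase_parts z, ← mkPhase_parts w, h1, h2]

@[simp] theorem fstPart_add (z w : Phase ι) : fstPart (z + w) = fstPart z + fstPart w := rfl
@[simp] theorem sndPart_add (z w : Phase ι) : sndPart (z + w) = sndPart z + sndPart w := rfl
@[simp] theorem fstPart_sub (z w : Phase ι) : fstPart (z - w) = fstPart z - fstPart w := rfl
@[simp] theorem sndPart_sub (z w : Phase ι) : sndPart (z - w) = sndPart z - sndPart w := rfl
@[simp] theorem fstPart_neg (z : Phase ι) : fstPart (-z) = -fstPart z := rfl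
@[simp] theorem sndPart_neg (z : Phase ι) : sndPart (-z) = -sndPart z := rfl
@[simp] theorem fstPart_smul (r : ℝ) (z : Phase ι) : fstPart (r • z) = r • fstPart z := rfl
@[simp] theorem sndPart_smul (r : ℝ) (z : Phase ι) : sndPart (r • z) = r • sndPart z := rfl
@[simp] theorem fstPart_zero : fstPart (0 : Phase ι) = 0 := rfl
@[simp] theorem sndPart_zero : sndPart (0 : Phase ι) = 0 := rfl

/-- The position part as a continuous linear map. -/
def fstL : Phase ι →L[ℝ] E ι :=
  LinearMap.toContinuousLinearMap ⟨⟨fstPart, fstPart_add⟩, fstPart_smul⟩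

/-- The momentum part as a continuous linear map. -/
def sndL : Phase ι →L[ℝ] E ι :=
  LinearMap.toContinuousLinearMap ⟨⟨sndPart, sndPart_add⟩, sndPart_smul⟩

@[fun_prop] theorem continuous_fstPart : Continuous (fstPart : Phase ι → E ι) := fstL.continuous
@[fun_prop] theorem continuous_sndPart : Continuous (sndPart : Phase ι → E ι) := sndL.continuous

theorem inner_phase (z w : Phase ι) :
    inner ℝ z w = inner ℝ (fstPart z) (fstPart w) + inner ℝ (sndPart z) (sndPart w) := by
  simp [PiLp.inner_apply, Fintype.sum_sum_type, fstPart, sndPart]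

theorem norm_sq_phase (z : Phase ι) : ‖z‖ ^ 2 = ‖fstPart z‖ ^ 2 + ‖sndPart z‖ ^ 2 := by
  simp only [← real_inner_self_eq_norm_sq, inner_phase]

theorem norm_fstPart_le (z : Phase ι) : ‖fstPart z‖ ≤ ‖z‖ := by
  have := norm_sq_phase z
  exact le_of_sq_le_sq (by nlinarith [sq_nonneg ‖sndPart z‖]) (norm_nonneg _)

theorem norm_sndPart_le (z : Phase ι) : ‖sndPart z‖ ≤ ‖z‖ := by
  have := norm_sq_phase z
  exact le_of_sq_le_sq (by nlinarith [sq_nonneg ‖fstPart z‖]) (norm_nonneg _)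

/-- `(x, ξ) ↦ (ξ, -x)`. -/
def rotJ (z : Phase ι) : Phase ι := mkPhase (sndPart z) (-fstPart z)

@[simp] theorem fstPart_rotJ (z : Phase ι) : fstPart (rotJ z) = sndPart z := by simp [rotJ]
@[simp] theorem sndPart_rotJ (z : Phase ι) : sndPart (rotJ z) = -fstPart z := by simp [rotJ]

theorem norm_rotJ (z : Phase ι) : ‖rotJ z‖ = ‖z‖ := by
  have h1 := norm_sq_phase z
  have h2 := norm_sq_phase (rotJ z)
  simp only [fstPart_rotJ, sndPart_rotJ, norm_neg] at h2
  have : ‖rotJ z‖ ^ 2 = ‖z‖ ^ 2 := by linarith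
  exact (sq_eq_sq₀ (norm_nonneg _) (norm_nonneg _)).1 this

/-- The symplectic form `[(x, ξ), (y, η)] = ξ·y - x·η`. -/
def symp (z w : Phase ι) : ℝ :=
  inner ℝ (sndPart z) (fstPart w) - inner ℝ (fstPart z) (sndPart w)

theorem symp_eq_inner (z w : Phase ι) : symp z w = inner ℝ (rotJ z) w := by
  simp [inner_phase, symp, sub_eq_add_neg]

theorem symp_swap (z w : Phase ι) : symp z w = -symp w z := by
  simp only [symp, real_inner_comm]; ring

theorem symp_self (z : Phase ι) : symp z z = 0 := by linarith [symp_swap z z]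

theorem symp_add_right (a b w : Phase ι) : symp w (a + b) = symp w a + symp w b := by
  simp only [symp, fstPart_add, sndPart_add, inner_add_right]; ring
theorem symp_neg_left (a w : Phase ι) : symp (-a) w = -symp a w := by
  simp only [symp, fstPart_neg, sndPart_neg, inner_neg_left]; ring
theorem symp_neg_right (a w : Phase ι) : symp w (-a) = -symp w a := by
  simp only [symp, fstPart_neg, sndPart_neg, inner_neg_right]; ring
theorem symp_sub_left (a b w : Phase ι) : symp (a - b) w = symp a w - symp b w := by
  simp only [symp, fstPart_sub, sndPart_sub, inner_sub_left]; ring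
theorem symp_sub_right (a b w : Phase ι) : symp w (a - b) = symp w a - symp w b := by
  simp only [symp, fstPart_sub, sndPart_sub, inner_sub_right]; ring
theorem symp_smul_left (r : ℝ) (a w : Phase ι) : symp (r • a) w = r * symp a w := by
  simp only [symp, fstPart_smul, sndPart_smul, real_inner_smul_left]; ring
theorem symp_smul_right (r : ℝ) (a w : Phase ι) : symp w (r • a) = r * symp w a := by
  simp only [symp, fstPart_smul, sndPart_smul, real_inner_smul_right]; ring

/-! ### Phase space as a product measure space -/

theorem measurePreserving_parts : MeasurePreserving (fun w : Phase ι => (fstPart w, sndPart w))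
    volume ((volume : Measure (E ι)).prod volume) := by
  have h1 := PiLp.volume_preserving_ofLp (ι ⊕ ι)
  have h2 := volume_measurePreserving_sumPiEquivProdPi (fun _ : ι ⊕ ι => ℝ)
  have h3 := (PiLp.volume_preserving_toLp ι).prod (PiLp.volume_preserving_toLp ι)
  exact h3.comp (h2.comp h1)

/-- Phase space is homeomorphic to a product. -/
def phaseHomeo : Phase ι ≃ₜ E ι × E ι where
  toFun w := (fstPart w, sndPart w)
  invFun p := mkPhase p.1 p.2
  left_inv w := by simp
  right_inv p := by simp
  continuous_toFun := by fun_prop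
  continuous_invFun := by
    unfold mkPhase
    refine (PiLp.continuous_toLp 2 _).comp (continuous_pi fun i => ?_)
    cases i
    · exact (PiLp.continuous_apply 2 _ _).comp continuous_fst
    · exact (PiLp.continuous_apply 2 _ _).comp continuous_snd

theorem measurePreserving_mkPhase : MeasurePreserving (fun p : E ι × E ι => mkPhase p.1 p.2)
    ((volume : Measure (E ι)).prod volume) volume := by
  have := (measurePreserving_parts (ι := ι)).symm phaseHomeo.toMeasurableEquiv
  exact this

theorem measurableEmbedding_mkPhase :
    MeasurableEmbedding (fun p : E ι × E ι => mkPhase p.1 p.2) :=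
  (phaseHomeo (ι := ι)).symm.measurableEmbedding

theorem continuous_mkPhase : Continuous (fun p : E ι × E ι => mkPhase p.1 p.2) :=
  (phaseHomeo (ι := ι)).symm.continuous

@[fun_prop] theorem Continuous.mkPhase {X : Type*} [TopologicalSpace X] {f g : X → E ι}
    (hf : Continuous f) (hg : Continuous g) :
    Continuous fun x => WignerFlow.mkPhase (f x) (g x) :=
  continuous_mkPhase.comp (hf.prodMk hg)

theorem lintegral_phase (F : Phase ι → ℝ≥0∞) (hF : AEMeasurable F) :
    ∫⁻ z, F z = ∫⁻ x : E ι, ∫⁻ ξ : E ι, F (mkPhase x ξ) := by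
  have h := measurePreserving_mkPhase (ι := ι)
  rw [← h.map_eq] at hF
  rw [← h.lintegral_comp_emb measurableEmbedding_mkPhase, lintegral_prod]
  exact hF.comp_measurable h.measurable

theorem integral_phase {G : Type*} [NormedAddCommGroup G] [NormedSpace ℝ G]
    (F : Phase ι → G) (hF : Integrable F) :
    ∫ z, F z = ∫ x : E ι, ∫ ξ : E ι, F (mkPhase x ξ) := by
  have h := measurePreserving_mkPhase (ι := ι)
  rw [← h.integral_comp measurableEmbedding_mkPhase, integral_prod]
  exact (h.integrable_comp_emb measurableEmbedding_mkPhase).2 hF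

/-! ### Time-frequency shifts -/

theorem tfShiftFun_eq (z : Phase ι) (f : E ι → ℂ) (t : E ι) :
    tfShiftFun z f t = cis (2 * Real.pi * inner ℝ (sndPart z) t -
      Real.pi * inner ℝ (fstPart z) (sndPart z)) * f (t - fstPart z) := by
  rw [tfShiftFun, ← mul_assoc, sub_eq_neg_add (2 * Real.pi * _), cis_add]
  simp [cis]

theorem coe_tfShift (z : Phase ι) (f : L2 ι) :
    (tfShift z f : E ι → ℂ) =ᵐ[volume] tfShiftFun z f := MemLp.coeFn_toLp _

theorem tfShiftFun_congr (z : Phase ι) {f g : E ι → ℂ} (h : f =ᵐ[volume] g) :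
    tfShiftFun z f =ᵐ[volume] tfShiftFun z g := by
  have := (measurePreserving_sub_right (volume : Measure (E ι)) (fstPart z)).quasiMeasurePreserving.ae_eq_comp h
  filter_upwards [this] with t ht
  simp only [Function.comp_apply] at ht
  simp [tfShiftFun, ht]

theorem tfShift_add (z : Phase ι) (f g : L2 ι) : tfShift z (f + g) = tfShift z f + tfShift z g := by
  refine Lp.ext ?_
  filter_upwards [coe_tfShift z (f + g), coe_tfShift z f, coe_tfShift z g,
    Lp.coeFn_add (tfShift z f) (tfShift z g), tfShiftFun_congr z (Lp.coeFn_add f g)]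
    with t h1 h2 h3 h4 h5
  rw [h1, h4, h5, Pi.add_apply, h2, h3]
  simp only [tfShiftFun_eq, Pi.add_apply]; ring

theorem tfShift_smul (z : Phase ι) (c : ℂ) (f : L2 ι) : tfShift z (c • f) = c • tfShift z f := by
  refine Lp.ext ?_
  filter_upwards [coe_tfShift z (c • f), coe_tfShift z f,
    Lp.coeFn_smul c (tfShift z f), tfShiftFun_congr z (Lp.coeFn_smul c f)]
    with t h1 h2 h3 h4
  rw [h1, h3, h4, Pi.smul_apply, h2]
  simp only [tfShiftFun_eq, Pi.smul_apply, smul_eq_mul]; ring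

theorem tfShift_zero (f : L2 ι) : tfShift 0 f = f := by
  refine Lp.ext ?_
  filter_upwards [coe_tfShift 0 f] with t h1
  rw [h1, tfShiftFun_eq]; simp

/-- The Weyl relation. With the symmetric normalisation of ρ the cocycle is governed by the
symplectic form alone. -/
theorem tfShift_tfShift (z w : Phase ι) (f : L2 ι) :
    tfShift z (tfShift w f) = cis (Real.pi * symp z w) • tfShift (z + w) f := by
  refine Lp.ext ?_
  filter_upwards [coe_tfShift z (tfShift w f), coe_tfShift (z + w) f,
    Lp.coeFn_smul (cis (Real.pi * symp z w)) (tfShift (z + w) f),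
    tfShiftFun_congr z (coe_tfShift w f)] with t h1 h2 h3 h4
  rw [h1, h3, h4, Pi.smul_apply, h2]
  simp only [tfShiftFun_eq, smul_eq_mul, ← mul_assoc, ← cis_add]
  congr 2
  · simp only [symp, fstPart_add, sndPart_add, inner_add_left, inner_add_right, inner_sub_right,
      real_inner_comm]
    ring
  · simp [sub_sub]

theorem tfShift_neg_tfShift (z : Phase ι) (f : L2 ι) : tfShift (-z) (tfShift z f) = f := by
  rw [tfShift_tfShift, symp_neg_left, symp_self]; simp [tfShift_zero]

theorem tfShift_tfShift_neg (z : Phase ι) (f : L2 ι) : tfShift z (tfShift (-z) f) = f := by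
  have := tfShift_neg_tfShift (-z) f
  rwa [neg_neg] at this

theorem norm_tfShift (z : Phase ι) (f : L2 ι) : ‖tfShift z f‖ = ‖f‖ := by
  rw [tfShift, Lp.norm_toLp, Lp.norm_def]
  congr 1
  have h := measurePreserving_sub_right (volume : Measure (E ι)) (fstPart z)
  rw [← eLpNorm_comp_measurePreserving (Lp.memLp f).1 h]
  refine eLpNorm_congr_norm_ae (Filter.Eventually.of_forall fun t => ?_)
  rw [tfShiftFun_eq]; simp

/-- The time-frequency shift as a unitary operator. -/
def tfShiftₗᵢ (z : Phase ι) : L2 ι ≃ₗᵢ[ℂ] L2 ι where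
  toFun := tfShift z
  map_add' := tfShift_add z
  map_smul' := tfShift_smul z
  invFun := tfShift (-z)
  left_inv := tfShift_neg_tfShift z
  right_inv := tfShift_tfShift_neg z
  norm_map' := norm_tfShift z

@[simp] theorem tfShiftₗᵢ_apply (z : Phase ι) (f : L2 ι) : tfShiftₗᵢ z f = tfShift z f := rfl

theorem inner_tfShift_tfShift (z : Phase ι) (f g : L2 ι) :
    inner ℂ (tfShift z f) (tfShift z g) = inner ℂ f g := (tfShiftₗᵢ z).inner_map_map f g

/-- For a fixed translation the inner product is, up to a phase, a Fourier transform in the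
frequency variable. This is where Plancherel enters Moyal's identity. -/
theorem inner_tfShift_eq_integral (z : Phase ι) (f g : L2 ι) :
    inner ℂ (tfShift z g) f = cis (Real.pi * inner ℝ (fstPart z) (sndPart z)) *
      𝓕 (fun t => (f : E ι → ℂ) t * conj ((g : E ι → ℂ) (t - fstPart z))) (sndPart z) := by
  rw [L2.inner_def, Real.fourier_eq', ← integral_const_mul]
  refine integral_congr_ae ?_
  filter_upwards [coe_tfShift z g] with t ht
  rw [ht, tfShiftFun_eq]
  simp only [RCLike.inner_apply, map_mul, conj_cis, smul_eq_mul]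
  have : Complex.exp (↑(-2 * Real.pi * inner ℝ t (sndPart z)) * Complex.I) =
      cis (-(2 * Real.pi * inner ℝ t (sndPart z))) := by rw [cis]; push_cast; ring_nf
  rw [this, neg_sub, sub_eq_add_neg, cis_add, real_inner_comm t]; ring

/-- The tensor product `f ⊗ ḡ` pointwise. -/
theorem coe_tensorConj (f g : L2 ι) :
    (tensorConj f g : Phase ι → ℂ) =ᵐ[volume] tensorConjFun f g := MemLp.coeFn_toLp _

theorem tensorConjFun_congr {f f' g g' : E ι → ℂ} (hf : f =ᵐ[volume] f') (hg : g =ᵐ[volume] g') :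
    tensorConjFun f g =ᵐ[volume] tensorConjFun f' g' := by
  have h := measurePreserving_parts (ι := ι)
  have h1 := (Measure.quasiMeasurePreserving_fst.comp h.quasiMeasurePreserving).ae_eq_comp hf
  have h2 := (Measure.quasiMeasurePreserving_snd.comp h.quasiMeasurePreserving).ae_eq_comp hg
  filter_upwards [h1, h2] with w h1 h2
  simp only [Function.comp_apply] at h1 h2
  simp [tensorConjFun, h1, h2]

/-- First factor of a point of doubled phase space. -/
def factorFst (y : Phase (ι ⊕ ι)) : Phase ι := mkPhase (fstPart (fstPart y)) (fstPart (sndPart y))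

/-- Second factor of a point of doubled phase space, conjugated. -/
def factorSnd (y : Phase (ι ⊕ ι)) : Phase ι :=
  mkPhase (sndPart (fstPart y)) (-sndPart (sndPart y))

theorem tfShift_tensorConj (y : Phase (ι ⊕ ι)) (f g : L2 ι) :
    tfShift y (tensorConj f g) = tensorConj (tfShift (factorFst y) f) (tfShift (factorSnd y) g) := by
  refine Lp.ext ?_
  filter_upwards [coe_tfShift y (tensorConj f g), tfShiftFun_congr y (coe_tensorConj f g),
    coe_tensorConj (tfShift (factorFst y) f) (tfShift (factorSnd y) g),
    tensorConjFun_congr (coe_tfShift (factorFst y) f) (coe_tfShift (factorSnd y) g)]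
    with w h1 h2 h3 h4
  rw [h1, h2, h3, h4]
  simp only [tfShiftFun_eq, tensorConjFun, factorFst, factorSnd, map_mul, conj_cis,
    fstPart_mkPhase, sndPart_mkPhase, fstPart_sub, sndPart_sub]
  rw [mul_mul_mul_comm, ← cis_add]
  congr 2
  simp only [inner_phase, inner_neg_left, inner_neg_right]; ring

end Basic

/-! ### The Fourier transform on `L¹ ∩ L²` -/

section Fourier

variable {V : Type*} [NormedAddCommGroup V] [InnerProductSpace ℝ V] [FiniteDimensional ℝ V]
  [MeasurableSpace V] [BorelSpace V]

theorem integral_schwartz_mul_fourier (ψ : 𝓢(V, ℂ)) {h : V → ℂ} (hi : Integrable h) :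
    ∫ x, (𝓕 ψ) x • h x = ∫ x, ψ x • 𝓕 h x := by
  have := VectorFourier.integral_fourierIntegral_smul_eq_flip (L := innerₗ V) (μ := volume)
    (ν := volume) (e := Real.fourierChar) Real.continuous_fourierChar continuous_inner
    ψ.integrable hi
  rw [flip_innerₗ] at this
  exact this

/-- The `L²` Fourier transform of an integrable function is given by the Fourier integral. -/
theorem coe_fourier_toLp {h : V → ℂ} (hi : Integrable h) (h2 : MemLp h 2) :
    ((𝓕 (h2.toLp h : Lp ℂ 2 (volume : Measure V)) : Lp ℂ 2 (volume : Measure V)) : V → ℂ) =ᵐ[volume] 𝓕 h := by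
  refine ae_eq_of_integral_contDiff_smul_eq ((Lp.memLp _).locallyIntegrable (by norm_num))
    (Continuous.locallyIntegrable ?_) fun g hg hc => ?_
  · exact VectorFourier.fourierIntegral_continuous Real.continuous_fourierChar continuous_inner hi
  · have hg₁ : HasCompactSupport (Complex.ofRealCLM ∘ g) := hc.comp_left rfl
    have hg₂ : ContDiff ℝ ∞ (Complex.ofRealCLM ∘ g) := by fun_prop
    set ψ : 𝓢(V, ℂ) := hg₁.toSchwartzMap hg₂ with hψ
    have h1 := Lp.fourier_toTemperedDistribution_eq (h2.toLp h : Lp ℂ 2 (volume : Measure V))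
    have h3 := DFunLike.congr_fun h1 ψ
    rw [TemperedDistribution.fourier_apply, Lp.toTemperedDistribution_apply,
      Lp.toTemperedDistribution_apply] at h3
    have h4 : ∫ x, (𝓕 ψ) x • (h2.toLp h : V → ℂ) x = ∫ x, (𝓕 ψ) x • h x := by
      refine integral_congr_ae ?_
      filter_upwards [h2.coeFn_toLp] with x hx
      rw [hx]
    rw [h4, integral_schwartz_mul_fourier ψ hi] at h3
    have h5 : ∀ x, ψ x = (g x : ℂ) := fun x => rfl
    simp only [h5] at h3
    simpa using h3.symm

theorem fourierInv_eq_comp_neg' (h : V → ℂ) : 𝓕⁻ h = fun x => 𝓕 h (-x) := by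
  ext x; rw [Real.fourierInv_eq_fourier_neg]

/-- The inverse `L²` Fourier transform of an integrable function is given by the integral. -/
theorem coe_fourierInv_toLp {h : V → ℂ} (hi : Integrable h) (h2 : MemLp h 2) :
    ((𝓕⁻ (h2.toLp h : Lp ℂ 2 (volume : Measure V)) : Lp ℂ 2 (volume : Measure V)) : V → ℂ) =ᵐ[volume] 𝓕⁻ h := by
  refine ae_eq_of_integral_contDiff_smul_eq ((Lp.memLp _).locallyIntegrable (by norm_num))
    (Continuous.locallyIntegrable ?_) fun g hg hc => ?_
  · rw [fourierInv_eq_comp_neg']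
    exact (VectorFourier.fourierIntegral_continuous Real.continuous_fourierChar continuous_inner
      hi).comp continuous_neg
  · have hg₁ : HasCompactSupport (Complex.ofRealCLM ∘ g) := hc.comp_left rfl
    have hg₂ : ContDiff ℝ ∞ (Complex.ofRealCLM ∘ g) := by fun_prop
    set ψ : 𝓢(V, ℂ) := hg₁.toSchwartzMap hg₂ with hψ
    have h1 := Lp.fourierInv_toTemperedDistribution_eq (h2.toLp h : Lp ℂ 2 (volume : Measure V))
    have h3 := DFunLike.congr_fun h1 ψ
    rw [TemperedDistribution.fourierInv_apply, Lp.toTemperedDistribution_apply,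
      Lp.toTemperedDistribution_apply] at h3
    have h4 : ∫ x, (𝓕⁻ ψ) x • (h2.toLp h : V → ℂ) x = ∫ x, (𝓕⁻ ψ) x • h x := by
      refine integral_congr_ae ?_
      filter_upwards [h2.coeFn_toLp] with x hx
      rw [hx]
    have h6 : ∫ x, (𝓕⁻ ψ) x • h x = ∫ x, ψ x • 𝓕⁻ h x := by
      have e := integral_schwartz_mul_fourier ψ hi.comp_neg
      have e1 : 𝓕 (fun x => h (-x)) = 𝓕⁻ h := by
        ext x
        rw [Real.fourierInv_eq_fourier_comp_neg]
      rw [e1] at e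
      rw [← e, ← integral_neg_eq_self]
      refine integral_congr_ae (Filter.Eventually.of_forall fun x => ?_)
      simp only [SchwartzMap.fourierInv_coe, Real.fourierInv_eq_fourier_neg, neg_neg,
        SchwartzMap.fourier_coe]
    rw [h4, h6] at h3
    have h5 : ∀ x, ψ x = (g x : ℂ) := fun x => rfl
    simp only [h5] at h3
    simpa using h3.symm

theorem lintegral_enorm_sq_eq_norm (f : Lp ℂ 2 (volume : Measure V)) :
    ∫⁻ x, ‖f x‖ₑ ^ 2 = ENNReal.ofReal (‖f‖ ^ 2) := by
  have h1 : eLpNorm f 2 volume ^ 2 = ∫⁻ x, ‖f x‖ₑ ^ 2 := by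
    have := eLpNorm_nnreal_pow_eq_lintegral (f := (f : V → ℂ)) (μ := (volume : Measure V))
      (p := 2) (by norm_num)
    simpa using this
  rw [← h1, Lp.norm_def, ← ENNReal.toReal_pow, ENNReal.ofReal_toReal]
  exact ENNReal.pow_ne_top (Lp.memLp f).2.ne

theorem lintegral_fourier_sq {h : V → ℂ} (hi : Integrable h) (h2 : MemLp h 2) :
    ∫⁻ x, ‖𝓕 h x‖ₑ ^ 2 = ∫⁻ x, ‖h x‖ₑ ^ 2 := by
  have h3 : ∫⁻ x, ‖𝓕 h x‖ₑ ^ 2 =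
      ∫⁻ x, ‖((𝓕 (h2.toLp h : Lp ℂ 2 (volume : Measure V)) : Lp ℂ 2 (volume : Measure V)) : V → ℂ) x‖ₑ ^ 2 := by
    refine lintegral_congr_ae ?_
    filter_upwards [coe_fourier_toLp hi h2] with x hx
    rw [hx]
  have h4 : ∫⁻ x, ‖h x‖ₑ ^ 2 = ∫⁻ x, ‖(h2.toLp h : V → ℂ) x‖ₑ ^ 2 := by
    refine lintegral_congr_ae ?_
    filter_upwards [h2.coeFn_toLp] with x hx
    rw [hx]
  rw [h3, h4, lintegral_enorm_sq_eq_norm, lintegral_enorm_sq_eq_norm, Lp.norm_fourier_eq]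

end Fourier

theorem enorm_conj (a : ℂ) : ‖conj a‖ₑ = ‖a‖ₑ := by
  rw [← ofReal_norm, ← ofReal_norm, RCLike.norm_conj]

theorem enorm_cis (s : ℝ) : ‖cis s‖ₑ = 1 := by rw [← ofReal_norm]; simp

/-! ### The ambiguity function and Moyal's identity -/

section Moyal

variable {ι : Type} [Fintype ι]

/-- The ambiguity function `z ↦ ⟨f, ρ(z) g⟩`. -/
def ambig (f g : L2 ι) (z : Phase ι) : ℂ := inner ℂ (tfShift z g) f

theorem stronglyMeasurable_ambig (f g : L2 ι) : StronglyMeasurable (ambig f g) := by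
  have hf := Lp.stronglyMeasurable f
  have hg := Lp.stronglyMeasurable g
  have h : StronglyMeasurable fun p : Phase ι × E ι =>
      (f : E ι → ℂ) p.2 * conj (tfShiftFun p.1 g p.2) := by
    have h1 : Continuous fun p : Phase ι × E ι => p.2 - fstPart p.1 := by fun_prop
    have h2 := hg.comp_measurable h1.measurable
    have h3 : Continuous fun p : Phase ι × E ι => cis (2 * Real.pi * inner ℝ (sndPart p.1) p.2 -
      Real.pi * inner ℝ (fstPart p.1) (sndPart p.1)) := by fun_prop
    simp only [tfShiftFun_eq]
    exact (hf.comp_measurable measurable_snd).mul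
      (Complex.continuous_conj.comp_stronglyMeasurable (h3.stronglyMeasurable.mul h2))
  have h5 := h.integral_prod_right' (ν := volume)
  have : ambig f g = fun z => ∫ t, (f : E ι → ℂ) t * conj (tfShiftFun z g t) := by
    ext z
    rw [ambig, L2.inner_def]
    refine integral_congr_ae ?_
    filter_upwards [coe_tfShift z g] with t ht
    rw [ht]; simp
  rw [this]; exact h5

theorem measurable_enorm_ambig (f g : L2 ι) : Measurable fun z => ‖ambig f g z‖ₑ :=
  (stronglyMeasurable_ambig f g).measurable.enorm

theorem integrable_mul_conj_translate (f g : L2 ι) (x : E ι) :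
    Integrable fun t => (f : E ι → ℂ) t * conj ((g : E ι → ℂ) (t - x)) := by
  have h1 : MemLp (fun t => (g : E ι → ℂ) (t - x)) 2 (volume : Measure (E ι)) :=
    (Lp.memLp g).comp_measurePreserving (measurePreserving_sub_right volume x)
  exact (Lp.memLp f).integrable_mul h1.star

theorem measurable_sq_mul_translate (f g : L2 ι) :
    Measurable fun p : E ι × E ι =>
      ‖(f : E ι → ℂ) p.2‖ₑ ^ 2 * ‖(g : E ι → ℂ) (p.2 - p.1)‖ₑ ^ 2 := by
  have hf := (Lp.stronglyMeasurable f).measurable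
  have hg := (Lp.stronglyMeasurable g).measurable
  fun_prop

theorem lintegral_sq_mul_translate (f g : L2 ι) :
    ∫⁻ x : E ι, ∫⁻ t : E ι, ‖(f : E ι → ℂ) t‖ₑ ^ 2 * ‖(g : E ι → ℂ) (t - x)‖ₑ ^ 2 =
      ENNReal.ofReal (‖f‖ ^ 2) * ENNReal.ofReal (‖g‖ ^ 2) := by
  rw [lintegral_lintegral_swap (measurable_sq_mul_translate f g).aemeasurable]
  have hg := (Lp.stronglyMeasurable g).measurable
  have hf := (Lp.stronglyMeasurable f).measurable
  have : ∀ t : E ι, ∫⁻ x : E ι, ‖(f : E ι → ℂ) t‖ₑ ^ 2 * ‖(g : E ι → ℂ) (t - x)‖ₑ ^ 2 =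
      ‖(f : E ι → ℂ) t‖ₑ ^ 2 * ENNReal.ofReal (‖g‖ ^ 2) := fun t => by
    rw [lintegral_const_mul _ (by fun_prop), ← lintegral_enorm_sq_eq_norm,
      lintegral_sub_left_eq_self (fun x => ‖(g : E ι → ℂ) x‖ₑ ^ 2) t]
  simp_rw [this]
  rw [lintegral_mul_const _ (by fun_prop), lintegral_enorm_sq_eq_norm]

/-- The product lies in L¹ for every x, but square integrability holds only for almost every x, by
Tonelli. That suffices for applying Plancherel under the x-integral. -/
theorem memLp_mul_conj_translate (f g : L2 ι) :
    ∀ᵐ x : E ι, MemLp (fun t => (f : E ι → ℂ) t * conj ((g : E ι → ℂ) (t - x))) 2 := by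
  have h1 := lintegral_sq_mul_translate f g
  have h2 : ∀ᵐ x : E ι,
      ∫⁻ t : E ι, ‖(f : E ι → ℂ) t‖ₑ ^ 2 * ‖(g : E ι → ℂ) (t - x)‖ₑ ^ 2 < ⊤ := by
    refine ae_lt_top (measurable_sq_mul_translate f g).lintegral_prod_right' ?_
    rw [h1]; exact ENNReal.mul_ne_top ENNReal.ofReal_ne_top ENNReal.ofReal_ne_top
  filter_upwards [h2] with x hx
  refine ⟨(integrable_mul_conj_translate f g x).1, ?_⟩
  rw [eLpNorm_lt_top_iff_lintegral_rpow_enorm_lt_top (by norm_num) (by norm_num)]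
  simpa only [ENNReal.toReal_ofNat, ENNReal.rpow_ofNat, enorm_mul, mul_pow, enorm_conj] using hx

/-- A weight depending on position only is inert under Plancherel in the frequency. The constant
weight gives Moyal's identity; moderate weights are used later to compare weighted norms. -/
theorem lintegral_weight_ambig_sq (f g : L2 ι) {m : E ι → ℝ≥0∞} (hm : Measurable m) :
    ∫⁻ z, m (fstPart z) * ‖ambig f g z‖ₑ ^ 2 =
      ∫⁻ x, m x * ∫⁻ t, ‖(f : E ι → ℂ) t‖ₑ ^ 2 * ‖(g : E ι → ℂ) (t - x)‖ₑ ^ 2 := by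
  have hA := measurable_enorm_ambig f g
  rw [lintegral_phase]
  swap
  · exact ((hm.comp continuous_fstPart.measurable).mul (hA.pow_const 2)).aemeasurable
  refine lintegral_congr_ae ?_
  filter_upwards [memLp_mul_conj_translate f g] with x hx
  simp only [fstPart_mkPhase]
  have hm2 : Measurable fun ξ : E ι => ‖ambig f g (mkPhase x ξ)‖ₑ :=
    hA.comp (show Continuous fun ξ : E ι => mkPhase x ξ by fun_prop).measurable
  rw [lintegral_const_mul _ (hm2.pow_const 2)]
  congr 1
  have : ∀ ξ : E ι, ‖ambig f g (mkPhase x ξ)‖ₑ =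
      ‖𝓕 (fun t => (f : E ι → ℂ) t * conj ((g : E ι → ℂ) (t - x))) ξ‖ₑ := fun ξ => by
    rw [ambig, inner_tfShift_eq_integral, enorm_mul]
    simp [enorm_cis]
  simp_rw [this]
  rw [lintegral_fourier_sq (integrable_mul_conj_translate f g x) hx]
  simp [mul_pow]

/-- Moyal's identity. -/
theorem lintegral_ambig_sq (f g : L2 ι) :
    ∫⁻ z, ‖ambig f g z‖ₑ ^ 2 = ENNReal.ofReal (‖f‖ ^ 2) * ENNReal.ofReal (‖g‖ ^ 2) := by
  have := lintegral_weight_ambig_sq f g (m := fun _ => 1) measurable_const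
  simp only [one_mul] at this
  rw [this, lintegral_sq_mul_translate]

theorem memLp_ambig (f g : L2 ι) : MemLp (ambig f g) 2 := by
  refine ⟨(stronglyMeasurable_ambig f g).aestronglyMeasurable, ?_⟩
  rw [eLpNorm_lt_top_iff_lintegral_rpow_enorm_lt_top (by norm_num) (by norm_num)]
  have := lintegral_ambig_sq f g
  simp only [ENNReal.toReal_ofNat, ENNReal.rpow_ofNat]
  rw [this]; exact ENNReal.mul_lt_top ENNReal.ofReal_lt_top ENNReal.ofReal_lt_top

/-- The ambiguity function as an element of `L²`. -/
def ambigLp (f g : L2 ι) : L2 (ι ⊕ ι) := (memLp_ambig f g).toLp _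

theorem norm_ambigLp (f g : L2 ι) : ‖ambigLp f g‖ = ‖f‖ * ‖g‖ := by
  have h1 : ENNReal.ofReal (‖ambigLp f g‖ ^ 2) = ENNReal.ofReal ((‖f‖ * ‖g‖) ^ 2) := by
    rw [← lintegral_enorm_sq_eq_norm, mul_pow, ENNReal.ofReal_mul (by positivity),
      ← lintegral_ambig_sq]
    refine lintegral_congr_ae ?_
    filter_upwards [(memLp_ambig f g).coeFn_toLp] with z hz
    rw [ambigLp, hz]
  have h2 := (ENNReal.ofReal_eq_ofReal_iff (by positivity) (by positivity)).1 h1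
  exact (sq_eq_sq₀ (by positivity) (by positivity)).1 h2

theorem ambig_add_left (f f' g : L2 ι) : ambig (f + f') g = ambig f g + ambig f' g := by
  ext z; simp [ambig, inner_add_right]
theorem ambig_smul_left (c : ℂ) (f g : L2 ι) : ambig (c • f) g = c • ambig f g := by
  ext z; simp [ambig, inner_smul_right]
theorem ambig_add_right (f g g' : L2 ι) : ambig f (g + g') = ambig f g + ambig f g' := by
  ext z; simp [ambig, tfShift_add, inner_add_left]
theorem ambig_smul_right (c : ℂ) (f g : L2 ι) : ambig f (c • g) = conj c • ambig f g := by
  ext z; simp [ambig, tfShift_smul, inner_smul_left]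

theorem ambigLp_add_left (f f' g : L2 ι) : ambigLp (f + f') g = ambigLp f g + ambigLp f' g := by
  rw [ambigLp, ambigLp, ambigLp, ← MemLp.toLp_add]; congr 1; exact ambig_add_left f f' g
theorem ambigLp_smul_left (c : ℂ) (f g : L2 ι) : ambigLp (c • f) g = c • ambigLp f g := by
  rw [ambigLp, ambigLp, ← MemLp.toLp_const_smul]; congr 1; exact ambig_smul_left c f g
theorem ambigLp_add_right (f g g' : L2 ι) : ambigLp f (g + g') = ambigLp f g + ambigLp f g' := by
  rw [ambigLp, ambigLp, ambigLp, ← MemLp.toLp_add]; congr 1; exact ambig_add_right f g g'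
theorem ambigLp_smul_right (c : ℂ) (f g : L2 ι) : ambigLp f (c • g) = conj c • ambigLp f g := by
  rw [ambigLp, ambigLp, ← MemLp.toLp_const_smul]; congr 1; exact ambig_smul_right c f g

/-- A map linear in the first and antilinear in the second argument that multiplies norms
multiplies inner products. -/
theorem inner_of_norm_eq_mul {H K : Type*} [NormedAddCommGroup H] [InnerProductSpace ℂ H]
    [NormedAddCommGroup K] [InnerProductSpace ℂ K] (a : H → H → K)
    (hn : ∀ f g, ‖a f g‖ = ‖f‖ * ‖g‖)
    (h1 : ∀ f f' g, a (f + f') g = a f g + a f' g) (h2 : ∀ (c : ℂ) f g, a (c • f) g = c • a f g)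
    (h3 : ∀ f g g', a f (g + g') = a f g + a f g')
    (h4 : ∀ (c : ℂ) f g, a f (c • g) = conj c • a f g) (f g f' g' : H) :
    inner ℂ (a f g) (a f' g') = inner ℂ f f' * inner ℂ g' g := by
  have key : ∀ f f' g : H, inner ℂ (a f g) (a f' g) = inner ℂ f f' * inner ℂ g g := by
    intro f f' g
    rw [inner_eq_sum_norm_sq_div_four, inner_eq_sum_norm_sq_div_four f f',
      inner_self_eq_norm_sq_to_K]
    have e1 : a f g + a f' g = a (f + f') g := (h1 _ _ _).symm
    have eneg : ∀ x, a (-x) g = -a x g := fun x => by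
      have := h2 (-1) x g; simpa using this
    have e2 : a f g - a f' g = a (f - f') g := by
      rw [sub_eq_add_neg, sub_eq_add_neg, h1, eneg]
    rw [e1, e2, ← h2, ← h1, sub_eq_add_neg (a f g), ← eneg, ← h1, hn, hn, hn, hn]
    simp only [← sub_eq_add_neg]
    push_cast
    ring
  -- Polarisation in the second argument: g + g' gives the sum of the two mixed terms and g + i g'
  -- their difference.
  have p1 := key f f' (g + g')
  have p2 := key f f' (g + Complex.I • g')
  have q1 := key f f' g
  have q2 := key f f' g'
  simp only [h3, h4, inner_add_left, inner_add_right, inner_smul_left, inner_smul_right,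
    Complex.conj_I, mul_add, map_neg] at p1 p2
  have hI := Complex.I_mul_I
  rw [q1, q2] at p1 p2
  have r1 : inner ℂ (a f g) (a f' g') + inner ℂ (a f g') (a f' g) =
    inner ℂ f f' * inner ℂ g' g + inner ℂ f f' * inner ℂ g g' := by linear_combination p1
  have r2 : Complex.I * (inner ℂ (a f g) (a f' g') - inner ℂ (a f g') (a f' g)) =
    Complex.I * (inner ℂ f f' * inner ℂ g' g - inner ℂ f f' * inner ℂ g g') := by
    linear_combination -p2 
  have r3 := mul_left_cancel₀ Complex.I_ne_zero r2
  linear_combination (r1 + r3) / 2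

theorem inner_ambigLp (f g f' g' : L2 ι) :
    inner ℂ (ambigLp f g) (ambigLp f' g') = inner ℂ f f' * inner ℂ g' g :=
  inner_of_norm_eq_mul ambigLp norm_ambigLp ambigLp_add_left ambigLp_smul_left ambigLp_add_right
    ambigLp_smul_right f g f' g'

theorem inner_ambigLp_eq_integral (f g f' g' : L2 ι) :
    inner ℂ (ambigLp f g) (ambigLp f' g') = ∫ z, conj (ambig f g z) * ambig f' g' z := by
  rw [L2.inner_def]
  refine integral_congr_ae ?_
  filter_upwards [(memLp_ambig f g).coeFn_toLp, (memLp_ambig f' g').coeFn_toLp] with z h1 h2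
  rw [ambigLp, ambigLp, h1, h2]; simp [mul_comm]

/-- Resolution of the identity by coherent states. -/
theorem inner_eq_integral_ambig (f f' g : L2 ι) :
    (‖g‖ ^ 2 : ℝ) * inner ℂ f f' = ∫ z, conj (ambig f g z) * ambig f' g z := by
  rw [← inner_ambigLp_eq_integral, inner_ambigLp, inner_self_eq_norm_sq_to_K]
  push_cast; exact mul_comm _ _

theorem eq_zero_of_ambig_eq_zero {f g : L2 ι} (hg : g ≠ 0) (h : ∀ z, ambig f g z = 0) : f = 0 := by
  have h1 := inner_eq_integral_ambig f f g
  simp only [h, mul_zero, integral_zero] at h1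
  have h2 : (‖g‖ ^ 2 : ℝ) ≠ 0 := by positivity
  rcases mul_eq_zero.1 h1 with h3 | h3
  · exact absurd (by exact_mod_cast h3) h2
  · exact inner_self_eq_zero.1 h3

/-- A vector orthogonal to the whole orbit has vanishing ambiguity function, hence is zero by the
resolution of the identity. -/
theorem span_tfShift_topologicalClosure {g : L2 ι} (hg : g ≠ 0) :
    (Submodule.span ℂ (Set.range fun z => tfShift z g)).topologicalClosure = ⊤ := by
  rw [Submodule.topologicalClosure_eq_top_iff, Submodule.eq_bot_iff]
  intro f hf
  refine eq_zero_of_ambig_eq_zero hg fun z => ?_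
  exact (Submodule.mem_orthogonal _ _).1 hf _ (Submodule.subset_span ⟨z, rfl⟩)

/-- Operators that intertwine time-frequency shifts in the same way agree up to a constant. -/
theorem IsMetaplectic.exists_eq_smul {M : Matrix (ι ⊕ ι) (ι ⊕ ι) ℝ} {T₁ T₂ : L2 ι ≃ₗᵢ[ℂ] L2 ι}
    (h₁ : IsMetaplectic M T₁) (h₂ : IsMetaplectic M T₂) {g : L2 ι} (hg : g ≠ 0) :
    ∃ c : ℂ, ‖c‖ = 1 ∧ ∀ f, T₂ f = c • T₁ f := by
  set S : L2 ι ≃ₗᵢ[ℂ] L2 ι := T₂.trans T₁.symm with hS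
  have hcomm : ∀ z f, S (tfShift z f) = tfShift z (S f) := fun z f => by
    apply T₁.injective
    simp only [hS, LinearIsometryEquiv.trans_apply, LinearIsometryEquiv.apply_symm_apply]
    rw [h₁, h₂]; simp
  -- Since S commutes with all shifts it can be moved from one argument of the ambiguity function to
  -- the other. Moyal's identity then separates the variables and forces S to be a scalar.
  have hA : ∀ f, ambigLp (S f) g = ambigLp f (S.symm g) := fun f => by
    rw [ambigLp, ambigLp]; congr 1; ext z
    rw [ambig, ambig, ← S.inner_map_map (tfShift z (S.symm g)), hcomm]; simp
  set c : ℂ := inner ℂ (S.symm g) g / inner ℂ g g with hc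
  have hgg : inner ℂ g g ≠ 0 := inner_self_ne_zero.2 hg
  have hSc : ∀ f, S f = c • f := fun f => by
    refine ext_inner_left ℂ fun k => ?_
    have e1 := inner_ambigLp k g (S f) g
    rw [hA, inner_ambigLp] at e1
    rw [inner_smul_right, hc]
    field_simp
    linear_combination -e1
  refine ⟨c, ?_, fun f => ?_⟩
  · have := S.norm_map g
    rw [hSc, norm_smul] at this
    exact (mul_eq_right₀ (norm_ne_zero_iff.2 hg)).1 this
  · have := congrArg T₁ (hSc f)
    rw [map_smul] at this
    rw [← this]; simp [hS]

end Moyal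

/-! ### Unitary operators determined by their values on a total set -/

section Gram

variable {X H K : Type*} [NormedAddCommGroup H] [InnerProductSpace ℂ H]
  [NormedAddCommGroup K] [InnerProductSpace ℂ K]

/-- Two total families with the same inner products are related by a unitary operator. -/
theorem exists_linearIsometryEquiv_of_inner_eq [CompleteSpace H] [CompleteSpace K] (u : X → H) (v : X → K)
    (huv : ∀ x y, inner ℂ (v x) (v y) = inner ℂ (u x) (u y))
    (hu : (Submodule.span ℂ (Set.range u)).topologicalClosure = ⊤)
    (hv : (Submodule.span ℂ (Set.range v)).topologicalClosure = ⊤) :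
    ∃ T : H ≃ₗᵢ[ℂ] K, ∀ x, T (u x) = v x := by
  have hd : ∀ {L : Type _} [NormedAddCommGroup L] [InnerProductSpace ℂ L] (w : X → L),
      (Submodule.span ℂ (Set.range w)).topologicalClosure = ⊤ →
      DenseRange (Finsupp.linearCombination ℂ w) := fun w hw => by
    rw [DenseRange, ← LinearMap.coe_range, Finsupp.range_linearCombination]
    exact Submodule.dense_iff_topologicalClosure_eq_top.2 hw
  have hd' : ∀ {L : Type _} [NormedAddCommGroup L] [InnerProductSpace ℂ L] (w : X → L),
      (Submodule.span ℂ (Set.range w)).topologicalClosure = ⊤ →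
      DenseRange (Finsupp.linearCombination ℂ w) := fun w hw => by
    rw [DenseRange, ← LinearMap.coe_range, Finsupp.range_linearCombination]
    exact Submodule.dense_iff_topologicalClosure_eq_top.2 hw
  have hn : ∀ a : X →₀ ℂ, ‖Finsupp.linearCombination ℂ v a‖ = ‖Finsupp.linearCombination ℂ u a‖ := by
    intro a
    have : inner ℂ (Finsupp.linearCombination ℂ v a) (Finsupp.linearCombination ℂ v a) =
        inner ℂ (Finsupp.linearCombination ℂ u a) (Finsupp.linearCombination ℂ u a) := by
      simp only [Finsupp.linearCombination_apply, Finsupp.sum, sum_inner, inner_sum,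
        inner_smul_left, inner_smul_right, huv]
    rw [@norm_eq_sqrt_re_inner ℂ, @norm_eq_sqrt_re_inner ℂ, this]
  refine ⟨(LinearEquiv.refl ℂ (X →₀ ℂ)).extendOfIsometry (Finsupp.linearCombination ℂ u)
    (Finsupp.linearCombination ℂ v) (hd u hu) (hd' v hv) hn, fun x => ?_⟩
  have := (LinearEquiv.refl ℂ (X →₀ ℂ)).extendOfIsometry_eq (Finsupp.linearCombination ℂ u)
    (Finsupp.linearCombination ℂ v) (hd u hu) (hd' v hv) hn (Finsupp.single x 1)
  simpa using this

/-- Continuous linear maps that agree on a total set agree. -/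
theorem eq_of_eq_on_total {F : Type*} [NormedAddCommGroup F] [NormedSpace ℂ F] {u : X → H}
    (hu : (Submodule.span ℂ (Set.range u)).topologicalClosure = ⊤) (S T : H →L[ℂ] F)
    (h : ∀ x, S (u x) = T (u x)) : S = T := by
  refine ContinuousLinearMap.ext_on (s := Set.range u)
    (Submodule.dense_iff_topologicalClosure_eq_top.2 hu) ?_
  rintro _ ⟨x, rfl⟩; exact h x

end Gram

section Wigner

variable {ι : Type} [Fintype ι]

/-! ### Tensor products -/

theorem norm_tensorConj (f g : L2 ι) : ‖tensorConj f g‖ = ‖f‖ * ‖g‖ := by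
  have hf := (Lp.stronglyMeasurable f).measurable
  have hg := (Lp.stronglyMeasurable g).measurable
  have h1 : ENNReal.ofReal (‖tensorConj f g‖ ^ 2) = ENNReal.ofReal ((‖f‖ * ‖g‖) ^ 2) := by
    rw [← lintegral_enorm_sq_eq_norm, mul_pow, ENNReal.ofReal_mul (by positivity)]
    have : ∫⁻ w, ‖(tensorConj f g : Phase ι → ℂ) w‖ₑ ^ 2 =
        ∫⁻ w : Phase ι, ‖(f : E ι → ℂ) (fstPart w)‖ₑ ^ 2 * ‖(g : E ι → ℂ) (sndPart w)‖ₑ ^ 2 := by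
      refine lintegral_congr_ae ?_
      filter_upwards [coe_tensorConj f g] with w hw
      rw [hw, tensorConjFun, enorm_mul, enorm_conj, mul_pow]
    have m1 : Measurable fun w : Phase ι => ‖(f : E ι → ℂ) (fstPart w)‖ₑ ^ 2 :=
      ((hf.comp continuous_fstPart.measurable).enorm).pow_const 2
    have m2 : Measurable fun w : Phase ι => ‖(g : E ι → ℂ) (sndPart w)‖ₑ ^ 2 :=
      ((hg.comp continuous_sndPart.measurable).enorm).pow_const 2
    rw [this, lintegral_phase (fun w => _ * _) (m1.mul m2).aemeasurable]
    simp only [fstPart_mkPhase, sndPart_mkPhase]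
    simp_rw [lintegral_const_mul _ (hg.enorm.pow_const 2), lintegral_enorm_sq_eq_norm]
    rw [lintegral_mul_const _ (hf.enorm.pow_const 2), lintegral_enorm_sq_eq_norm]
  have h2 := (ENNReal.ofReal_eq_ofReal_iff (by positivity) (by positivity)).1 h1
  exact (sq_eq_sq₀ (by positivity) (by positivity)).1 h2

theorem tensorConj_eq_of_ae {f g : L2 ι} {h : L2 (ι ⊕ ι)}
    (hh : (h : Phase ι → ℂ) =ᵐ[volume] tensorConjFun f g) : tensorConj f g = h :=
  Lp.ext ((coe_tensorConj f g).trans hh.symm)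

theorem tensorConj_add_left (f f' g : L2 ι) :
    tensorConj (f + f') g = tensorConj f g + tensorConj f' g := by
  refine tensorConj_eq_of_ae ?_
  filter_upwards [Lp.coeFn_add (tensorConj f g) (tensorConj f' g), coe_tensorConj f g,
    coe_tensorConj f' g, tensorConjFun_congr (Lp.coeFn_add f f') (ae_eq_refl (g : E ι → ℂ))]
    with w h1 h2 h3 h4
  rw [h1, h4, Pi.add_apply, h2, h3]; simp [tensorConjFun, add_mul]

theorem tensorConj_smul_left (c : ℂ) (f g : L2 ι) :
    tensorConj (c • f) g = c • tensorConj f g := by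
  refine tensorConj_eq_of_ae ?_
  filter_upwards [Lp.coeFn_smul c (tensorConj f g), coe_tensorConj f g,
    tensorConjFun_congr (Lp.coeFn_smul c f) (ae_eq_refl (g : E ι → ℂ))] with w h1 h2 h4
  rw [h1, h4, Pi.smul_apply, h2]; simp [tensorConjFun, mul_assoc]

theorem tensorConj_add_right (f g g' : L2 ι) :
    tensorConj f (g + g') = tensorConj f g + tensorConj f g' := by
  refine tensorConj_eq_of_ae ?_
  filter_upwards [Lp.coeFn_add (tensorConj f g) (tensorConj f g'), coe_tensorConj f g,
    coe_tensorConj f g', tensorConjFun_congr (ae_eq_refl (f : E ι → ℂ)) (Lp.coeFn_add g g')]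
    with w h1 h2 h3 h4
  rw [h1, h4, Pi.add_apply, h2, h3]; simp [tensorConjFun, mul_add]

theorem tensorConj_smul_right (c : ℂ) (f g : L2 ι) :
    tensorConj f (c • g) = conj c • tensorConj f g := by
  refine tensorConj_eq_of_ae ?_
  filter_upwards [Lp.coeFn_smul (conj c) (tensorConj f g), coe_tensorConj f g,
    tensorConjFun_congr (ae_eq_refl (f : E ι → ℂ)) (Lp.coeFn_smul c g)] with w h1 h2 h4
  rw [h1, h4, Pi.smul_apply, h2]; simp [tensorConjFun]; ring

theorem inner_tensorConj (f g f' g' : L2 ι) :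
    inner ℂ (tensorConj f g) (tensorConj f' g') = inner ℂ f f' * inner ℂ g' g :=
  inner_of_norm_eq_mul tensorConj norm_tensorConj tensorConj_add_left tensorConj_smul_left
    tensorConj_add_right tensorConj_smul_right f g f' g'

theorem tensorConj_ne_zero {f g : L2 ι} (hf : f ≠ 0) (hg : g ≠ 0) : tensorConj f g ≠ 0 := by
  rw [← norm_ne_zero_iff, norm_tensorConj]
  exact mul_ne_zero (norm_ne_zero_iff.2 hf) (norm_ne_zero_iff.2 hg)

theorem span_tfShift_tensorConj {f g : L2 ι} (hf : f ≠ 0) (hg : g ≠ 0) :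
    (Submodule.span ℂ (Set.range fun y : Phase (ι ⊕ ι) =>
      tensorConj (tfShift (factorFst y) f) (tfShift (factorSnd y) g))).topologicalClosure = ⊤ := by
  simpa only [tfShift_tensorConj] using span_tfShift_topologicalClosure (tensorConj_ne_zero hf hg)

/-! ### The Wigner distribution through time-frequency shifts -/

theorem measurePreserving_neg' : MeasurePreserving (fun x : E ι => -x) volume volume :=
  Measure.measurePreserving_neg volume

/-- The reflection `f ↦ f(-·)`. -/
def reflect (f : L2 ι) : L2 ι := Lp.compMeasurePreserving (fun x => -x) measurePreserving_neg' f

theorem coe_reflect (f : L2 ι) : (reflect f : E ι → ℂ) =ᵐ[volume] fun x => (f : E ι → ℂ) (-x) :=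
  Lp.coeFn_compMeasurePreserving f measurePreserving_neg'

theorem norm_reflect (f : L2 ι) : ‖reflect f‖ = ‖f‖ :=
  Lp.norm_compMeasurePreserving f measurePreserving_neg'

theorem reflect_add (f g : L2 ι) : reflect (f + g) = reflect f + reflect g :=
  map_add (Lp.compMeasurePreserving _ measurePreserving_neg') f g

theorem comp_neg_congr {f g : E ι → ℂ} (h : f =ᵐ[volume] g) :
    (fun x => f (-x)) =ᵐ[volume] fun x => g (-x) :=
  measurePreserving_neg'.quasiMeasurePreserving.ae_eq_comp h

theorem reflect_smul (c : ℂ) (f : L2 ι) : reflect (c • f) = c • reflect f := by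
  refine Lp.ext ?_
  filter_upwards [coe_reflect (c • f), comp_neg_congr (Lp.coeFn_smul c f),
    Lp.coeFn_smul c (reflect f), coe_reflect f] with x h1 h2 h3 h4
  rw [h1, h2, h3]; simp [h4]

theorem reflect_tfShift (z : Phase ι) (f : L2 ι) :
    reflect (tfShift z f) = tfShift (-z) (reflect f) := by
  refine Lp.ext ?_
  filter_upwards [coe_reflect (tfShift z f), comp_neg_congr (coe_tfShift z f),
    coe_tfShift (-z) (reflect f), tfShiftFun_congr (-z) (coe_reflect f)] with x h1 h2 h3 h4
  rw [h1, h2, h3, h4, tfShiftFun_eq, tfShiftFun_eq]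
  congr 2
  · simp [inner_neg_left, inner_neg_right]
  · simp; abel

theorem wigner_congr {f f' g g' : E ι → ℂ} (hf : f =ᵐ[volume] f') (hg : g =ᵐ[volume] g') :
    wigner f g = wigner f' g' := by
  ext z
  refine integral_congr_ae ?_
  have q : ∀ r : ℝ, r ≠ 0 → Measure.QuasiMeasurePreserving (fun t : E ι => fstPart z + r • t)
      volume volume := fun r hr => by
    have h1 : Measure.QuasiMeasurePreserving (fun t : E ι => r • t) volume volume := by
      refine ⟨measurable_const_smul r, ?_⟩
      rw [Measure.map_addHaar_smul _ hr]
      exact Measure.smul_absolutelyContinuous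
    exact (measurePreserving_add_left volume (fstPart z)).quasiMeasurePreserving.comp h1
  have h1 := (q (1 / 2) (by norm_num)).ae_eq_comp hf
  have h2 := (q (-(1 / 2)) (by norm_num)).ae_eq_comp hg
  filter_upwards [h1, h2] with t h1 h2
  simp only [Function.comp_apply, neg_smul, ← sub_eq_add_neg] at h1 h2
  rw [h1, h2]

/-- The substitution u = x + t/2 turns the Wigner integral into an ambiguity integral against the
reflected second function. Measurability, Moyal's identity and covariance of W are thereby inherited
from `ambig`. -/
theorem wigner_eq_ambig (f g : L2 ι) (z : Phase ι) :
    wigner f g z = (2 : ℂ) ^ Fintype.card ι * ambig f (reflect g) ((2 : ℝ) • z) := by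
  set x := fstPart z with hx
  set ξ := sndPart z with hξ
  set G : E ι → ℂ := fun u => (f : E ι → ℂ) u * conj ((g : E ι → ℂ) ((2 : ℝ) • x - u)) *
    cis (-(4 * Real.pi * inner ℝ (u - x) ξ)) with hG
  have h1 : wigner f g z = ∫ t : E ι, G (x + (1 / 2 : ℝ) • t) := by
    refine integral_congr_ae (Filter.Eventually.of_forall fun t => ?_)
    simp only [hG, ← hx, ← hξ]
    congr 2
    · congr 2; module
    · rw [add_sub_cancel_left, real_inner_smul_left]
      push_cast; ring
  have h2 : ∫ t : E ι, G (x + (1 / 2 : ℝ) • t) = (2 : ℂ) ^ Fintype.card ι * ∫ u, G u := by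
    rw [Measure.integral_comp_smul volume (fun u => G (x + u)) (1 / 2 : ℝ),
      integral_add_left_eq_self G x]
    simp [abs_of_pos]
  rw [h1, h2]
  congr 1
  rw [ambig, L2.inner_def]
  refine integral_congr_ae ?_
  filter_upwards [coe_tfShift ((2 : ℝ) • z) (reflect g),
    tfShiftFun_congr ((2 : ℝ) • z) (coe_reflect g)] with u h1 h2
  rw [h1, h2, tfShiftFun_eq]
  simp only [hG, RCLike.inner_apply, map_mul, conj_cis, fstPart_smul, sndPart_smul, neg_sub,
    ← hx, ← hξ, real_inner_smul_left, real_inner_smul_right, inner_sub_left, real_inner_comm u ξ]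
  rw [mul_assoc, mul_comm (cis _)]
  congr 3; ring

theorem ambig_tfShift (v z : Phase ι) (f g : L2 ι) (w : Phase ι) :
    ambig (tfShift v f) (tfShift z g) w =
      cis (Real.pi * (symp v (w + z) - symp w z)) * ambig f g (w + z - v) := by
  rw [ambig, ambig, tfShift_tfShift, ← inner_tfShift_tfShift (-v), tfShift_neg_tfShift,
    tfShift_smul, tfShift_tfShift, smul_smul, ← cis_add, inner_smul_left, conj_cis,
    symp_neg_left]
  congr 2
  · ring
  · congr 2; abel

theorem wigner_tfShift (v z : Phase ι) (f g : L2 ι) (u : Phase ι) :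
    wigner (tfShift v f) (tfShift z g) u = cis (Real.pi * (2 * symp (v - z) u - symp v z)) *
      wigner f g (u - (1 / 2 : ℝ) • (v + z)) := by
  rw [wigner_eq_ambig, wigner_eq_ambig, reflect_tfShift, ambig_tfShift, mul_left_comm]
  have e : (2 : ℝ) • u + -z - v = (2 : ℝ) • (u - (1 / 2 : ℝ) • (v + z)) := by
    rw [smul_sub, smul_smul]; norm_num; abel
  rw [e]
  congr 2
  simp only [symp_add_right, symp_neg_right, symp_smul_left, symp_smul_right, symp_sub_left,
    symp_swap u z]
  ring

theorem stronglyMeasurable_wigner (f g : L2 ι) : StronglyMeasurable (wigner f g) := by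
  have : wigner f g = fun z => (2 : ℂ) ^ Fintype.card ι * ambig f (reflect g) ((2 : ℝ) • z) := by
    ext z; exact wigner_eq_ambig f g z
  rw [this]
  exact ((stronglyMeasurable_ambig f (reflect g)).comp_measurable (measurable_const_smul _)).const_mul _

theorem lintegral_wigner_sq (f g : L2 ι) :
    ∫⁻ z, ‖wigner f g z‖ₑ ^ 2 = ENNReal.ofReal (‖f‖ ^ 2) * ENNReal.ofReal (‖g‖ ^ 2) := by
  have hA := measurable_enorm_ambig f (reflect g)
  simp_rw [wigner_eq_ambig, enorm_mul, mul_pow]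
  have hA2 : Measurable fun z : Phase ι => ‖ambig f (reflect g) ((2 : ℝ) • z)‖ₑ :=
    hA.comp (measurable_const_smul (2 : ℝ))
  rw [lintegral_const_mul _ (hA2.pow_const 2)]
  have h1 : ∫⁻ z : Phase ι, ‖ambig f (reflect g) ((2 : ℝ) • z)‖ₑ ^ 2 =
      ∫⁻ z, ‖ambig f (reflect g) z‖ₑ ^ 2 ∂(Measure.map (fun z : Phase ι => (2 : ℝ) • z) volume) :=
    (lintegral_map (hA.pow_const 2) (measurable_const_smul (2 : ℝ))).symm
  rw [h1, Measure.map_addHaar_smul _ two_ne_zero, lintegral_smul_measure, lintegral_ambig_sq,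
    norm_reflect, smul_eq_mul, ← mul_assoc, ← ofReal_norm, ← ENNReal.ofReal_pow (norm_nonneg _),
    ← ENNReal.ofReal_mul (by positivity)]
  -- The squared prefactor (2^d)² cancels the Jacobian 2^{-2d} of the dilation by 2 on phase space.
  have : ‖(2 : ℂ) ^ Fintype.card ι‖ ^ 2 * |((2 : ℝ) ^ Module.finrank ℝ (Phase ι))⁻¹| = 1 := by
    rw [abs_of_pos (by positivity), norm_pow, finrank_euclideanSpace, Fintype.card_sum, pow_add]
    simp only [Complex.norm_ofNat]
    field_simp
  rw [this]; simp

theorem memLp_wigner (f g : L2 ι) : MemLp (wigner f g) 2 := by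
  refine ⟨(stronglyMeasurable_wigner f g).aestronglyMeasurable, ?_⟩
  rw [eLpNorm_lt_top_iff_lintegral_rpow_enorm_lt_top (by norm_num) (by norm_num)]
  simp only [ENNReal.toReal_ofNat, ENNReal.rpow_ofNat]
  rw [lintegral_wigner_sq]; exact ENNReal.mul_lt_top ENNReal.ofReal_lt_top ENNReal.ofReal_lt_top

/-- The Wigner distribution as an element of `L²`. -/
def wignerLp (f g : L2 ι) : L2 (ι ⊕ ι) := (memLp_wigner f g).toLp _

theorem coe_wignerLp (f g : L2 ι) : (wignerLp f g : Phase ι → ℂ) =ᵐ[volume] wigner f g :=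
  (memLp_wigner f g).coeFn_toLp

theorem norm_wignerLp (f g : L2 ι) : ‖wignerLp f g‖ = ‖f‖ * ‖g‖ := by
  have h1 : ENNReal.ofReal (‖wignerLp f g‖ ^ 2) = ENNReal.ofReal ((‖f‖ * ‖g‖) ^ 2) := by
    rw [← lintegral_enorm_sq_eq_norm, mul_pow, ENNReal.ofReal_mul (by positivity),
      ← lintegral_wigner_sq]
    refine lintegral_congr_ae ?_
    filter_upwards [coe_wignerLp f g] with z hz
    rw [hz]
  have h2 := (ENNReal.ofReal_eq_ofReal_iff (by positivity) (by positivity)).1 h1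
  exact (sq_eq_sq₀ (by positivity) (by positivity)).1 h2

theorem inner_wignerLp (f g f' g' : L2 ι) :
    inner ℂ (wignerLp f g) (wignerLp f' g') = inner ℂ f f' * inner ℂ g' g := by
  refine inner_of_norm_eq_mul wignerLp norm_wignerLp ?_ ?_ ?_ ?_ f g f' g'
  · intro f f' g
    rw [wignerLp, wignerLp, wignerLp, ← MemLp.toLp_add]; congr 1; ext z
    simp only [Pi.add_apply, wigner_eq_ambig, ambig_add_left]; ring
  · intro c f g
    rw [wignerLp, wignerLp, ← MemLp.toLp_const_smul]; congr 1; ext z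
    simp only [Pi.smul_apply, wigner_eq_ambig, ambig_smul_left, smul_eq_mul]; ring
  · intro f g g'
    rw [wignerLp, wignerLp, wignerLp, ← MemLp.toLp_add]; congr 1; ext z
    simp only [Pi.add_apply, wigner_eq_ambig, reflect_add, ambig_add_right]; ring
  · intro c f g
    rw [wignerLp, wignerLp, ← MemLp.toLp_const_smul]; congr 1; ext z
    simp only [Pi.smul_apply, wigner_eq_ambig, reflect_smul, ambig_smul_right, smul_eq_mul]; ring

/-- The phase space point by which the Wigner distribution of `ρ(y₁)f, ρ(y₂)g` is shifted. -/
def wignerShift (y : Phase (ι ⊕ ι)) : Phase (ι ⊕ ι) :=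
  mkPhase ((1 / 2 : ℝ) • (factorFst y + factorSnd y)) (rotJ (factorFst y - factorSnd y))

/-- Shifting both arguments moves W to the midpoint of the two shifts and modulates it by the
rotated difference. This covariance makes the Wigner transform metaplectic. -/
theorem wignerLp_tfShift (y : Phase (ι ⊕ ι)) (f g : L2 ι) :
    wignerLp (tfShift (factorFst y) f) (tfShift (factorSnd y) g) =
      tfShift (wignerShift y) (wignerLp f g) := by
  refine Lp.ext ?_
  filter_upwards [coe_wignerLp (tfShift (factorFst y) f) (tfShift (factorSnd y) g),
    coe_tfShift (wignerShift y) (wignerLp f g),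
    tfShiftFun_congr (wignerShift y) (coe_wignerLp f g)] with u h1 h2 h3
  rw [h1, h2, h3, wigner_tfShift, tfShiftFun_eq, wignerShift]
  simp only [fstPart_mkPhase, sndPart_mkPhase]
  congr 2
  rw [real_inner_comm (rotJ (factorFst y - factorSnd y)) (_ • _), ← symp_eq_inner, ← symp_eq_inner]
  rw [symp_smul_right]
  simp only [symp_sub_left, symp_add_right, symp_self, symp_swap (factorSnd y) (factorFst y)]
  ring

theorem wignerShift_surjective : Function.Surjective (wignerShift (ι := ι)) := by
  intro w
  set s := fstPart w
  set r := rotJ (sndPart w)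
  -- The two factors are recovered from midpoint and difference as s - r/2 and s + r/2. The last
  -- momentum carries a sign because `factorSnd` conjugates the second factor.
  refine ⟨mkPhase (mkPhase (fstPart s - (1 / 2 : ℝ) • fstPart r) (fstPart s + (1 / 2 : ℝ) • fstPart r))
    (mkPhase (sndPart s - (1 / 2 : ℝ) • sndPart r) (-(sndPart s + (1 / 2 : ℝ) • sndPart r))), ?_⟩
  refine phase_ext ?_ ?_
  · refine phase_ext ?_ ?_ <;>
    simp only [wignerShift, fstPart_mkPhase, sndPart_mkPhase, factorFst, factorSnd, fstPart_smul,
      sndPart_smul, fstPart_add, sndPart_add, neg_neg]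
    · rw [sub_add_add_cancel, ← two_smul ℝ, smul_smul]; norm_num; rfl
    · rw [sub_add_add_cancel, ← two_smul ℝ, smul_smul]; norm_num; rfl
  · have key : ∀ a b : E ι, a - (1 / 2 : ℝ) • b - (a + (1 / 2 : ℝ) • b) = -b := fun a b => by
      module
    refine phase_ext ?_ ?_ <;>
    simp only [wignerShift, fstPart_mkPhase, sndPart_mkPhase, factorFst, factorSnd, fstPart_rotJ,
      sndPart_rotJ, fstPart_sub, sndPart_sub, neg_neg, key]
    · simp [r]
    · simp [r]

theorem span_wignerLp {f g : L2 ι} (hf : f ≠ 0) (hg : g ≠ 0) :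
    (Submodule.span ℂ (Set.range fun y : Phase (ι ⊕ ι) =>
      wignerLp (tfShift (factorFst y) f) (tfShift (factorSnd y) g))).topologicalClosure = ⊤ := by
  simp only [wignerLp_tfShift]
  have h : wignerLp f g ≠ 0 := by
    rw [← norm_ne_zero_iff, norm_wignerLp]
    exact mul_ne_zero (norm_ne_zero_iff.2 hf) (norm_ne_zero_iff.2 hg)
  have := span_tfShift_topologicalClosure h
  rwa [← wignerShift_surjective.range_comp] at this

end Wigner

/-! ### Schwartz functions -/

section Schwartz

theorem cis_hasTemperateGrowth : cis.HasTemperateGrowth := by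
  have hd : ∀ (n : ℕ), iteratedDeriv n cis = fun s => Complex.I ^ n * cis s := by
    have h1 : ∀ s, HasDerivAt cis (Complex.I * cis s) s := fun s => by
      have := ((hasDerivAt_id s).ofReal_comp.mul_const Complex.I).cexp
      unfold cis; simpa [mul_comm] using this
    intro n
    induction n with
    | zero => ext s; simp
    | succ n ih =>
      rw [iteratedDeriv_succ, ih]; ext s
      rw [((h1 s).const_mul (Complex.I ^ n)).deriv]; ring
  refine ⟨?_, fun n => ⟨0, 1, fun s => ?_⟩⟩
  · unfold cis
    have : ContDiff ℝ ∞ fun s : ℝ => (s : ℂ) * Complex.I :=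
      (Complex.ofRealCLM.contDiff).mul contDiff_const
    exact this.cexp
  · rw [norm_iteratedFDeriv_eq_norm_iteratedDeriv, hd]; simp

variable {V : Type*} [NormedAddCommGroup V] [InnerProductSpace ℝ V]

theorem norm_iteratedFDeriv_exp_le (n : ℕ) (s : ℝ) :
    ‖iteratedFDeriv ℝ n (fun s : ℝ => ((Real.exp s : ℝ) : ℂ)) s‖ ≤ Real.exp s := by
  have : iteratedDeriv n (fun s : ℝ => ((Real.exp s : ℝ) : ℂ)) = fun s => ((Real.exp s : ℝ) : ℂ) := by
    induction n with
    | zero => ext s; simp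
    | succ n ih =>
      rw [iteratedDeriv_succ, ih]; ext s
      exact ((Real.hasDerivAt_exp s).ofReal_comp).deriv
  rw [norm_iteratedFDeriv_eq_norm_iteratedDeriv, this, Complex.norm_real, Real.norm_eq_abs,
    abs_of_pos (Real.exp_pos s)]

/-- Combines (1 + r)^k ≤ k! e^{1+r} with the maximum 1/(4b) of r - b r². -/
theorem pow_mul_exp_neg_le {b : ℝ} (hb : 0 < b) (k : ℕ) {r : ℝ} (hr : 0 ≤ r) :
    (1 + r) ^ k * Real.exp (-b * r ^ 2) ≤ k.factorial * Real.exp (1 + 1 / (4 * b)) := by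
  have h1 : (1 + r) ^ k ≤ k.factorial * Real.exp (1 + r) := by
    have := Real.pow_div_factorial_le_exp (1 + r) (by linarith) k
    rw [div_le_iff₀ (by positivity)] at this
    linarith
  have h2 : Real.exp (1 + r) * Real.exp (-b * r ^ 2) ≤ Real.exp (1 + 1 / (4 * b)) := by
    rw [← Real.exp_add, Real.exp_le_exp]
    have : r - b * r ^ 2 ≤ 1 / (4 * b) := by
      rw [le_div_iff₀ (by positivity)]; nlinarith [sq_nonneg (2 * b * r - 1)]
    linarith
  calc (1 + r) ^ k * Real.exp (-b * r ^ 2)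
      ≤ k.factorial * Real.exp (1 + r) * Real.exp (-b * r ^ 2) := by gcongr
    _ = k.factorial * (Real.exp (1 + r) * Real.exp (-b * r ^ 2)) := by ring
    _ ≤ _ := by gcongr

/-- The Gaussian `x ↦ e^{-b|x|²}` as a Schwartz function. -/
def gaussian (V : Type*) [NormedAddCommGroup V] [InnerProductSpace ℝ V] {b : ℝ} (hb : 0 < b) :
    𝓢(V, ℂ) where
  toFun x := ((Real.exp (-b * ‖x‖ ^ 2) : ℝ) : ℂ)
  smooth' := by
    have h : ContDiff ℝ ∞ fun x : V => -b * ‖x‖ ^ 2 := contDiff_const.mul (contDiff_norm_sq ℝ)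
    exact Complex.ofRealCLM.contDiff.comp h.exp
  decay' := by
    intro k n
    have hq : (fun x : V => -b * ‖x‖ ^ 2).HasTemperateGrowth :=
      (Function.HasTemperateGrowth.const (-b)).mul
        (Function.hasTemperateGrowth_norm_sq V)
    obtain ⟨m, C, hC, hm⟩ := hq.norm_iteratedFDeriv_le_uniform n
    refine ⟨n.factorial * (1 + C) ^ n * ((k + m * n).factorial * Real.exp (1 + 1 / (4 * b))),
      fun x => ?_⟩
    have hx := norm_nonneg x
    -- The choice of D makes it at least 1, so the bound C(1 + |x|)^m on each derivative of the
    -- exponent lies below D^i for every i ≥ 1.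
    have key := norm_iteratedFDeriv_comp_le (𝕜 := ℝ) (n := n) (N := ∞)
      (g := fun s : ℝ => ((Real.exp s : ℝ) : ℂ)) (f := fun x : V => -b * ‖x‖ ^ 2)
      (Complex.ofRealCLM.contDiff.comp Real.contDiff_exp) hq.1 (mod_cast le_top) x
      (C := Real.exp (-b * ‖x‖ ^ 2)) (D := (1 + C) * (1 + ‖x‖) ^ m)
      (fun i _ => norm_iteratedFDeriv_exp_le i _) (fun i hi hin => by
        calc _ ≤ C * (1 + ‖x‖) ^ m := hm i hin x
          _ ≤ (1 + C) * (1 + ‖x‖) ^ m := by gcongr; simp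
          _ ≤ _ := le_self_pow₀ (one_le_mul_of_one_le_of_one_le (by simp [hC])
            (one_le_pow₀ (by linarith))) (by omega))
    calc ‖x‖ ^ k * ‖iteratedFDeriv ℝ n (fun x : V => ((Real.exp (-b * ‖x‖ ^ 2) : ℝ) : ℂ)) x‖
        ≤ (1 + ‖x‖) ^ k * (n.factorial * Real.exp (-b * ‖x‖ ^ 2) * ((1 + C) * (1 + ‖x‖) ^ m) ^ n) := by
          gcongr
          · linarith
          · exact key
      _ = n.factorial * (1 + C) ^ n * ((1 + ‖x‖) ^ (k + m * n) * Real.exp (-b * ‖x‖ ^ 2)) := by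
          rw [mul_pow, ← pow_mul, pow_add]; ring
      _ ≤ _ := mul_le_mul_of_nonneg_left (pow_mul_exp_neg_le hb _ hx) (by positivity)

theorem gaussian_apply {b : ℝ} (hb : 0 < b) (x : V) :
    gaussian V hb x = ((Real.exp (-b * ‖x‖ ^ 2) : ℝ) : ℂ) := rfl

theorem cis_comp_hasTemperateGrowth {q : V → ℝ} (hq : q.HasTemperateGrowth) :
    (fun x => cis (q x)).HasTemperateGrowth := cis_hasTemperateGrowth.comp hq

end Schwartz

/-! ### Time-frequency shifts of Schwartz functions and the Fourier transform. -/

section Shift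

variable {ι : Type} [Fintype ι]

theorem tfShiftPhase_hasTemperateGrowth (z : Phase ι) :
    (fun t : E ι => cis (2 * Real.pi * inner ℝ (sndPart z) t -
      Real.pi * inner ℝ (fstPart z) (sndPart z))).HasTemperateGrowth := by
  refine cis_comp_hasTemperateGrowth (Function.HasTemperateGrowth.sub ?_ (.const _))
  exact (Function.HasTemperateGrowth.const _).mul (Function.hasTemperateGrowth_inner_right _)

/-- The time-frequency shift of a Schwartz function. -/
def shiftSchwartz (z : Phase ι) (f : 𝓢(E ι, ℂ)) : 𝓢(E ι, ℂ) :=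
  SchwartzMap.smulLeftCLM ℂ (fun t : E ι => cis (2 * Real.pi * inner ℝ (sndPart z) t -
    Real.pi * inner ℝ (fstPart z) (sndPart z))) (SchwartzMap.compSubConstCLM ℂ (fstPart z) f)

theorem shiftSchwartz_apply (z : Phase ι) (f : 𝓢(E ι, ℂ)) (t : E ι) :
    shiftSchwartz z f t = tfShiftFun z f t := by
  rw [shiftSchwartz, SchwartzMap.smulLeftCLM_apply_apply (tfShiftPhase_hasTemperateGrowth z),
    SchwartzMap.compSubConstCLM_apply, tfShiftFun_eq, smul_eq_mul]

theorem toLp_shiftSchwartz (z : Phase ι) (f : 𝓢(E ι, ℂ)) :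
    ((shiftSchwartz z f).toLp 2 : L2 ι) = tfShift z (f.toLp 2) := by
  refine Lp.ext ?_
  filter_upwards [(shiftSchwartz z f).coeFn_toLp 2, coe_tfShift z (f.toLp 2),
    tfShiftFun_congr z (f.coeFn_toLp 2)] with t h1 h2 h3
  rw [h1, h2, h3, shiftSchwartz_apply]

theorem fourier_shiftSchwartz (z : Phase ι) (f : 𝓢(E ι, ℂ)) :
    𝓕 (shiftSchwartz z f) = shiftSchwartz (rotJ z) (𝓕 f) := by
  ext w
  rw [shiftSchwartz_apply, tfShiftFun_eq, SchwartzMap.fourier_coe, SchwartzMap.fourier_coe,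
    Real.fourier_eq', Real.fourier_eq', ← integral_const_mul,
    ← integral_add_right_eq_self _ (fstPart z)]
  refine integral_congr_ae (Filter.Eventually.of_forall fun s => ?_)
  have h : ∀ r : ℝ, Complex.exp ((r : ℂ) * Complex.I) = cis r := fun r => rfl
  simp only [shiftSchwartz_apply, tfShiftFun_eq, h, smul_eq_mul, add_sub_cancel_right, ← mul_assoc,
    ← cis_add]
  congr 2
  simp only [fstPart_rotJ, sndPart_rotJ, inner_add_left, inner_add_right, inner_sub_right,
    inner_neg_left, inner_neg_right]
  rw [real_inner_comm s (sndPart z), real_inner_comm (fstPart z) (sndPart z)]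
  ring

theorem denseRange_schwartz_toLp : DenseRange fun f : 𝓢(E ι, ℂ) => (f.toLp 2 : L2 ι) :=
  SchwartzMap.denseRange_toLpCLM ENNReal.ofNat_ne_top

/-- The Fourier transform exchanges translation and modulation, and the symmetric phase absorbs the
resulting scalar. The identity passes from Schwartz functions to L² by density. -/
theorem fourier_tfShift (z : Phase ι) (f : L2 ι) :
    (𝓕 (tfShift z f) : L2 ι) = tfShift (rotJ z) (𝓕 f : L2 ι) := by
  refine denseRange_schwartz_toLp.induction_on
    (p := fun f => (𝓕 (tfShift z f) : L2 ι) = tfShift (rotJ z) (𝓕 f : L2 ι)) f ?_ fun f => ?_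
  · exact isClosed_eq ((Lp.fourierTransformₗᵢ (E ι) ℂ).continuous.comp (tfShiftₗᵢ z).continuous)
      ((tfShiftₗᵢ (rotJ z)).continuous.comp (Lp.fourierTransformₗᵢ (E ι) ℂ).continuous)
  · rw [← toLp_shiftSchwartz, SchwartzMap.toLp_fourier_eq, SchwartzMap.toLp_fourier_eq,
      fourier_shiftSchwartz, toLp_shiftSchwartz]

end Shift

/-! ### Multiplication by unimodular functions -/

section Chirp

variable {ι : Type} [Fintype ι]

theorem memLp_cis_mul {q : E ι → ℝ} (hq : Continuous q) (f : L2 ι) :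
    MemLp (fun x => cis (q x) * (f : E ι → ℂ) x) 2 (volume : Measure (E ι)) := by
  have hc : Continuous fun x => cis (q x) := continuous_cis.comp hq
  refine MemLp.of_le (Lp.memLp f) (hc.aestronglyMeasurable.mul (Lp.memLp f).1)
    (Filter.Eventually.of_forall fun t => ?_)
  rw [norm_mul, norm_cis, one_mul]

/-- Multiplication by `e^{i q}` on `L²`. -/
def chirpFun {q : E ι → ℝ} (hq : Continuous q) (f : L2 ι) : L2 ι := (memLp_cis_mul hq f).toLp _

theorem coe_chirpFun {q : E ι → ℝ} (hq : Continuous q) (f : L2 ι) :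
    (chirpFun hq f : E ι → ℂ) =ᵐ[volume] fun x => cis (q x) * (f : E ι → ℂ) x :=
  (memLp_cis_mul hq f).coeFn_toLp

theorem chirpFun_neg_chirpFun {q q' : E ι → ℝ} (hq : Continuous q) (hq' : Continuous q')
    (h : ∀ x, q x + q' x = 0) (f : L2 ι) : chirpFun hq (chirpFun hq' f) = f := by
  refine Lp.ext ?_
  filter_upwards [coe_chirpFun hq (chirpFun hq' f), coe_chirpFun hq' f] with x h1 h2
  rw [h1, h2, ← mul_assoc, ← cis_add, h]; simp

/-- Multiplication by `e^{i q}` as a unitary operator. -/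
def chirp {q : E ι → ℝ} (hq : Continuous q) : L2 ι ≃ₗᵢ[ℂ] L2 ι where
  toFun := chirpFun hq
  map_add' f g := by
    refine Lp.ext ?_
    filter_upwards [coe_chirpFun hq (f + g), coe_chirpFun hq f, coe_chirpFun hq g,
      Lp.coeFn_add (chirpFun hq f) (chirpFun hq g), Lp.coeFn_add f g] with x h1 h2 h3 h4 h5
    rw [h1, h4, Pi.add_apply, h2, h3, h5, Pi.add_apply, mul_add]
  map_smul' c f := by
    refine Lp.ext ?_
    filter_upwards [coe_chirpFun hq (c • f), coe_chirpFun hq f,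
      Lp.coeFn_smul c (chirpFun hq f), Lp.coeFn_smul c f] with x h1 h2 h3 h4
    simp only [RingHom.id_apply]
    rw [h1, h3, Pi.smul_apply, h2, h4, Pi.smul_apply, smul_eq_mul, smul_eq_mul]; ring
  invFun := chirpFun hq.neg
  left_inv := chirpFun_neg_chirpFun _ _ fun x => by simp
  right_inv := chirpFun_neg_chirpFun _ _ fun x => by simp
  norm_map' f := by
    change ‖chirpFun hq f‖ = ‖f‖
    rw [Lp.norm_def, Lp.norm_def]
    congr 1
    refine eLpNorm_congr_norm_ae ?_
    filter_upwards [coe_chirpFun hq f] with x hx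
    rw [hx]; simp

theorem coe_chirp {q : E ι → ℝ} (hq : Continuous q) (f : L2 ι) :
    (chirp hq f : E ι → ℂ) =ᵐ[volume] fun x => cis (q x) * (f : E ι → ℂ) x := coe_chirpFun hq f

/-! ### Matrices acting on Euclidean space -/

variable {κ : Type} [Fintype κ]

theorem act_add_right (M : Matrix ι ι ℝ) (z w : E ι) : act M (z + w) = act M z + act M w := by
  ext i; simp [act, mulVec_add]
theorem act_sub_right (M : Matrix ι ι ℝ) (z w : E ι) : act M (z - w) = act M z - act M w := by
  ext i; simp [act, mulVec_sub]
theorem act_neg_right (M : Matrix ι ι ℝ) (z : E ι) : act M (-z) = -act M z := by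
  ext i; simp [act, mulVec_neg]
theorem act_smul_right (M : Matrix ι ι ℝ) (r : ℝ) (z : E ι) : act M (r • z) = r • act M z := by
  ext i; simp [act, mulVec_smul]
theorem act_add_left (M N : Matrix ι ι ℝ) (z : E ι) : act (M + N) z = act M z + act N z := by
  ext i; simp [act, add_mulVec]
theorem act_sub_left (M N : Matrix ι ι ℝ) (z : E ι) : act (M - N) z = act M z - act N z := by
  ext i; simp [act, sub_mulVec]
theorem act_neg_left (M : Matrix ι ι ℝ) (z : E ι) : act (-M) z = -act M z := by
  ext i; simp [act, neg_mulVec]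
theorem act_smul_left (r : ℝ) (M : Matrix ι ι ℝ) (z : E ι) : act (r • M) z = r • act M z := by
  ext i; simp [act, smul_mulVec]
theorem act_zero_left (z : E ι) : act (0 : Matrix ι ι ℝ) z = 0 := by
  ext i; simp [act]
theorem act_one [DecidableEq ι] (z : E ι) : act (1 : Matrix ι ι ℝ) z = z := by
  ext i; simp [act]
theorem act_mul (M N : Matrix ι ι ℝ) (z : E ι) : act (M * N) z = act M (act N z) := by
  ext i; simp [act, mulVec_mulVec]

theorem inner_act (M : Matrix ι ι ℝ) (z w : E ι) : inner ℝ (act M z) w = inner ℝ z (act Mᵀ w) := by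
  simp only [EuclideanSpace.inner_eq_star_dotProduct, act, star_trivial]
  rw [dotProduct_mulVec, mulVec_transpose]

theorem quad_eq_inner (B : Matrix ι ι ℝ) (z : E ι) : quad B z = inner ℝ z (act B z) := by
  simp only [EuclideanSpace.inner_eq_star_dotProduct, act, star_trivial, quad]
  rw [dotProduct_comm]

theorem act_fromBlocks (A B C D : Matrix ι ι ℝ) (z : Phase ι) :
    act (fromBlocks A B C D) z = mkPhase (act A (fstPart z) + act B (sndPart z))
      (act C (fstPart z) + act D (sndPart z)) := by
  ext i
  simp only [act, fromBlocks_mulVec, mkPhase]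
  rcases i with i | i <;> rfl

theorem act_ext {M N : Matrix ι ι ℝ} (h : ∀ z, act M z = act N z) : M = N := by
  classical
  ext i j
  have := congrArg (fun v : E ι => v i) (h (WithLp.toLp 2 (Pi.single j 1)))
  simpa [act] using this

/-- A matrix as a continuous linear map of Euclidean space. -/
def actL (M : Matrix ι ι ℝ) : E ι →L[ℝ] E ι :=
  LinearMap.toContinuousLinearMap ⟨⟨act M, act_add_right M⟩, act_smul_right M⟩

@[simp] theorem actL_apply (M : Matrix ι ι ℝ) (z : E ι) : actL M z = act M z := rfl

@[fun_prop] theorem continuous_act (M : Matrix ι ι ℝ) : Continuous (act M) := (actL M).continuous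

theorem continuous_quad (B : Matrix ι ι ℝ) : Continuous (quad B) := by
  have : quad B = fun z => inner ℝ z (act B z) := funext (quad_eq_inner B)
  rw [this]; fun_prop

theorem quad_hasTemperateGrowth (B : Matrix ι ι ℝ) : (quad B).HasTemperateGrowth := by
  have : quad B = fun z => inner ℝ z (actL B z) := funext (quad_eq_inner B)
  rw [this]
  exact (innerSL ℝ).bilinear_hasTemperateGrowth .id (actL B).hasTemperateGrowth

/-- Multiplication by `e^{-π i B x·x}`. -/
def quadChirp (B : Matrix ι ι ℝ) : L2 ι ≃ₗᵢ[ℂ] L2 ι :=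
  chirp (q := fun x => -(Real.pi * quad B x)) (continuous_const.mul (continuous_quad B)).neg

theorem coe_quadChirp (B : Matrix ι ι ℝ) (f : L2 ι) :
    (quadChirp B f : E ι → ℂ) =ᵐ[volume] fun x => cis (-(Real.pi * quad B x)) * (f : E ι → ℂ) x :=
  coe_chirp _ f

/-- Expanding the quadratic form around the translate produces a linear term, that is, a change of
frequency. Symmetry of B merges the two cross terms. -/
theorem quadChirp_tfShift {B : Matrix ι ι ℝ} (hB : B.IsSymm) (z : Phase ι) (f : L2 ι) :
    quadChirp B (tfShift z f) =
      tfShift (mkPhase (fstPart z) (sndPart z - act B (fstPart z))) (quadChirp B f) := by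
  refine Lp.ext ?_
  filter_upwards [coe_quadChirp B (tfShift z f), coe_tfShift z f,
    coe_tfShift (mkPhase (fstPart z) (sndPart z - act B (fstPart z))) (quadChirp B f),
    tfShiftFun_congr (mkPhase (fstPart z) (sndPart z - act B (fstPart z))) (coe_quadChirp B f)]
    with t h1 h2 h3 h4
  rw [h1, h2, h3, h4, tfShiftFun_eq, tfShiftFun_eq]
  simp only [fstPart_mkPhase, sndPart_mkPhase, ← mul_assoc, ← cis_add]
  congr 2
  have hs : inner ℝ t (act B (fstPart z)) = inner ℝ (fstPart z) (act B t) := by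
    rw [real_inner_comm, inner_act, hB]
  simp only [quad_eq_inner, act_sub_right, inner_sub_left, inner_sub_right, hs,
    real_inner_comm (sndPart z), real_inner_comm t (act B (fstPart z))]
  ring

end Chirp

section Metaplectic

variable {ι : Type} [Fintype ι]

/-! ### The Gaussian window -/

/-- The Gaussian `e^{-π|x|²}`. -/
def window (ι : Type) [Fintype ι] : 𝓢(E ι, ℂ) := gaussian (E ι) Real.pi_pos

/-- The Gaussian as an element of `L²`. -/
def windowLp (ι : Type) [Fintype ι] : L2 ι := (window ι).toLp 2

theorem window_apply (x : E ι) : window ι x = ((Real.exp (-Real.pi * ‖x‖ ^ 2) : ℝ) : ℂ) := rfl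

theorem windowLp_ne_zero : windowLp ι ≠ 0 := by
  intro h
  have h0 : window ι = 0 := SchwartzMap.injective_toLp (F := ℂ) 2 (volume : Measure (E ι))
    (h.trans (by
      refine (Lp.ext ?_).symm
      filter_upwards [(0 : 𝓢(E ι, ℂ)).coeFn_toLp 2, Lp.coeFn_zero ℂ 2 (volume : Measure (E ι))]
        with x h1 h2
      rw [h1, h2]; rfl))
  have := DFunLike.congr_fun h0 0
  rw [window_apply] at this
  simp at this

/-! ### The Wigner transform as a unitary operator -/

/-- The families f ⊗ ḡ and W(f, g) have the same Gram matrix by Moyal's identity, and both are total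
because they contain the orbit of a nonzero vector under all shifts. -/
theorem exists_wignerOp : ∃ T : L2 (ι ⊕ ι) ≃ₗᵢ[ℂ] L2 (ι ⊕ ι),
    ∀ f g : L2 ι, T (tensorConj f g) = wignerLp f g := by
  have hs : ∀ {K : Type} [NormedAddCommGroup K] [NormedSpace ℂ K] (F : L2 ι → L2 ι → K),
      (Submodule.span ℂ (Set.range fun y : Phase (ι ⊕ ι) => F (tfShift (factorFst y) (windowLp ι))
        (tfShift (factorSnd y) (windowLp ι)))).topologicalClosure = ⊤ →
      (Submodule.span ℂ (Set.range fun p : L2 ι × L2 ι => F p.1 p.2)).topologicalClosure = ⊤ := by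
    intro K _ _ F h
    refine top_unique (h.symm.le.trans (Submodule.topologicalClosure_mono (Submodule.span_mono ?_)))
    rintro _ ⟨y, rfl⟩; exact ⟨(_, _), rfl⟩
  obtain ⟨T, hT⟩ := exists_linearIsometryEquiv_of_inner_eq
    (fun p : L2 ι × L2 ι => tensorConj p.1 p.2) (fun p : L2 ι × L2 ι => wignerLp p.1 p.2)
    (fun p q => by rw [inner_wignerLp, inner_tensorConj])
    (hs tensorConj (span_tfShift_tensorConj windowLp_ne_zero windowLp_ne_zero))
    (hs wignerLp (span_wignerLp windowLp_ne_zero windowLp_ne_zero))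
  exact ⟨T, fun f g => hT (f, g)⟩

/-- The unitary operator with `f ⊗ ḡ ↦ W(f, g)`. -/
def wignerOp (ι : Type) [Fintype ι] : L2 (ι ⊕ ι) ≃ₗᵢ[ℂ] L2 (ι ⊕ ι) := exists_wignerOp.choose

theorem wignerOp_tensorConj (f g : L2 ι) : wignerOp ι (tensorConj f g) = wignerLp f g :=
  exists_wignerOp.choose_spec f g

theorem wignerOp_tfShift (y : Phase (ι ⊕ ι)) (h : L2 (ι ⊕ ι)) :
    wignerOp ι (tfShift y h) = tfShift (wignerShift y) (wignerOp ι h) := by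
  have := eq_of_eq_on_total (span_tfShift_tensorConj (windowLp_ne_zero (ι := ι)) windowLp_ne_zero)
    (((tfShiftₗᵢ y).trans (wignerOp ι)).toContinuousLinearEquiv : L2 (ι ⊕ ι) →L[ℂ] L2 (ι ⊕ ι))
    (((wignerOp ι).trans (tfShiftₗᵢ (wignerShift y))).toContinuousLinearEquiv :
      L2 (ι ⊕ ι) →L[ℂ] L2 (ι ⊕ ι)) (fun w => by
        change wignerOp ι (tfShift y _) = tfShift (wignerShift y) (wignerOp ι _)
        rw [tfShift_tensorConj, wignerOp_tensorConj, wignerOp_tensorConj, wignerLp_tfShift])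
  exact DFunLike.congr_fun this h

/-- The operator `f ⊗ ḡ ↦ 𝓕⁻¹(e^{-π i Bζ·ζ} 𝓕 W(f, g))`. -/
def cohenOp (B : Matrix (ι ⊕ ι) (ι ⊕ ι) ℝ) : L2 (ι ⊕ ι) ≃ₗᵢ[ℂ] L2 (ι ⊕ ι) :=
  (((wignerOp ι).trans (Lp.fourierTransformₗᵢ (E (ι ⊕ ι)) ℂ)).trans (quadChirp B)).trans
    (Lp.fourierTransformₗᵢ (E (ι ⊕ ι)) ℂ).symm

theorem cohenOp_apply (B : Matrix (ι ⊕ ι) (ι ⊕ ι) ℝ) (h : L2 (ι ⊕ ι)) :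
    cohenOp B h = (𝓕⁻ (quadChirp B (𝓕 (wignerOp ι h) : L2 (ι ⊕ ι))) : L2 (ι ⊕ ι)) := rfl

theorem rotJ_rotJ (z : Phase ι) : rotJ (rotJ z) = -z := by
  refine phase_ext ?_ ?_ <;> simp

theorem rotJ_neg (z : Phase ι) : rotJ (-z) = -rotJ z := by
  refine phase_ext ?_ ?_ <;> simp

theorem fourierInv_tfShift (z : Phase ι) (f : L2 ι) :
    (𝓕⁻ (tfShift z f) : L2 ι) = tfShift (-rotJ z) (𝓕⁻ f : L2 ι) := by
  have h := fourier_tfShift (-rotJ z) (𝓕⁻ f : L2 ι)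
  rw [rotJ_neg, rotJ_rotJ, neg_neg, FourierTransform.fourier_fourierInv_eq] at h
  rw [← h, FourierTransform.fourierInv_fourier_eq]

/-- Conjugating a chirp by the Fourier transform gives a shear that adds B times the frequency to
the position. -/
theorem cohenOp_tfShift {B : Matrix (ι ⊕ ι) (ι ⊕ ι) ℝ} (hB : B.IsSymm) (y : Phase (ι ⊕ ι))
    (h : L2 (ι ⊕ ι)) :
    cohenOp B (tfShift y h) = tfShift (mkPhase
      (fstPart (wignerShift y) + act B (sndPart (wignerShift y))) (sndPart (wignerShift y)))
      (cohenOp B h) := by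
  rw [cohenOp_apply, wignerOp_tfShift, fourier_tfShift, quadChirp_tfShift hB, fourierInv_tfShift,
    ← cohenOp_apply]
  congr 1
  refine phase_ext ?_ ?_ <;> simp [add_comm]

theorem quadChirp_zero (f : L2 ι) : quadChirp 0 f = f := by
  refine Lp.ext ?_
  filter_upwards [coe_quadChirp 0 f] with x hx
  rw [hx, quad_eq_inner, act_zero_left]; simp

theorem cohenOp_zero (h : L2 (ι ⊕ ι)) : cohenOp 0 h = wignerOp ι h := by
  rw [cohenOp_apply, quadChirp_zero, FourierTransform.fourierInv_fourier_eq]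

/-! ### Covariant matrices -/

variable [DecidableEq ι]

theorem IsCovariant.isSymm {𝒜 : Matrix ((ι ⊕ ι) ⊕ (ι ⊕ ι)) ((ι ⊕ ι) ⊕ (ι ⊕ ι)) ℝ}
    (h : IsCovariant 𝒜) : (cohenMatrix 𝒜).IsSymm := by
  obtain ⟨-, A₁₁, A₁₃, A₂₁, h13, h21, rfl⟩ := h
  simp only [cohenMatrix, toBlocks_fromBlocks₁₁, toBlocks_fromBlocks₁₂, toBlocks_fromBlocks₂₁]
  rw [IsSymm, fromBlocks_transpose]
  simp only [transpose_sub, transpose_smul, transpose_one, transpose_transpose, transpose_neg]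
  rw [h13, h21]

/-- A covariant matrix factors as the matrix of the Wigner transform followed by the shear with B_𝒜.
Comparison with `cohenOp_tfShift` identifies μ(𝒜) and also proves that it exists. -/
theorem IsCovariant.act_eq {𝒜 : Matrix ((ι ⊕ ι) ⊕ (ι ⊕ ι)) ((ι ⊕ ι) ⊕ (ι ⊕ ι)) ℝ}
    (h : IsCovariant 𝒜) (y : Phase (ι ⊕ ι)) :
    act 𝒜 y = mkPhase (fstPart (wignerShift y) + act (cohenMatrix 𝒜) (sndPart (wignerShift y)))
      (sndPart (wignerShift y)) := by
  obtain ⟨-, A₁₁, A₁₃, A₂₁, h13, h21, rfl⟩ := h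
  simp only [cohenMatrix, toBlocks_fromBlocks₁₁, toBlocks_fromBlocks₁₂, toBlocks_fromBlocks₂₁,
    act_fromBlocks, wignerShift, fstPart_mkPhase, sndPart_mkPhase, factorFst, factorSnd]
  refine phase_ext (phase_ext ?_ ?_) (phase_ext ?_ ?_) <;>
  simp only [fstPart_mkPhase, sndPart_mkPhase, fstPart_add, sndPart_add, fstPart_smul,
    sndPart_smul, fstPart_rotJ, sndPart_rotJ, fstPart_sub, sndPart_sub, act_sub_left,
    act_neg_left, act_one, act_zero_left, act_smul_left, act_add_right, act_sub_right,
    act_neg_right, sub_neg_eq_add] <;> module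

theorem IsCovariant.isMetaplectic_cohenOp
    {𝒜 : Matrix ((ι ⊕ ι) ⊕ (ι ⊕ ι)) ((ι ⊕ ι) ⊕ (ι ⊕ ι)) ℝ} (h : IsCovariant 𝒜) :
    IsMetaplectic 𝒜 (cohenOp (cohenMatrix 𝒜)) := fun y f => by
  rw [cohenOp_tfShift h.isSymm, h.act_eq]

theorem IsCovariant.isMetaplectic {𝒜 : Matrix ((ι ⊕ ι) ⊕ (ι ⊕ ι)) ((ι ⊕ ι) ⊕ (ι ⊕ ι)) ℝ}
    (h : IsCovariant 𝒜) : IsMetaplectic 𝒜 (metaplectic 𝒜) := by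
  have he : ∃ T, IsMetaplectic 𝒜 T := ⟨_, h.isMetaplectic_cohenOp⟩
  rw [metaplectic, dif_pos he]
  exact he.choose_spec

theorem IsCovariant.exists_metaplectic_eq
    {𝒜 : Matrix ((ι ⊕ ι) ⊕ (ι ⊕ ι)) ((ι ⊕ ι) ⊕ (ι ⊕ ι)) ℝ} (h : IsCovariant 𝒜) :
    ∃ c : ℂ, ‖c‖ = 1 ∧ ∀ f, metaplectic 𝒜 f = c • cohenOp (cohenMatrix 𝒜) f :=
  h.isMetaplectic_cohenOp.exists_eq_smul h.isMetaplectic windowLp_ne_zero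

/-- The covariant matrix with given Cohen matrix. -/
def covariantOf (B : Matrix (ι ⊕ ι) (ι ⊕ ι) ℝ) :
    Matrix ((ι ⊕ ι) ⊕ (ι ⊕ ι)) ((ι ⊕ ι) ⊕ (ι ⊕ ι)) ℝ :=
  fromBlocks
    (fromBlocks ((1 / 2 : ℝ) • 1 - B.toBlocks₁₂) (1 - ((1 / 2 : ℝ) • 1 - B.toBlocks₁₂))
      (-B.toBlocks₂₂) (- -B.toBlocks₂₂))
    (fromBlocks B.toBlocks₁₁ B.toBlocks₁₁ (1 - ((1 / 2 : ℝ) • 1 - B.toBlocks₁₂)ᵀ)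
      (-((1 / 2 : ℝ) • 1 - B.toBlocks₁₂)ᵀ))
    (fromBlocks 0 0 (-1) 1) (fromBlocks 1 1 0 0)

/-- The block shape already forces symplecticity, so covariant matrices are parametrised freely by
symmetric Cohen matrices. -/
theorem fromBlocks_covariant_mem_symplecticGroup {A₁₁ A₁₃ A₂₁ : Matrix ι ι ℝ} (h13 : A₁₃.IsSymm)
    (h21 : A₂₁.IsSymm) : fromBlocks
      (fromBlocks A₁₁ (1 - A₁₁) A₂₁ (-A₂₁)) (fromBlocks A₁₃ A₁₃ (1 - A₁₁ᵀ) (-A₁₁ᵀ))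
      (fromBlocks 0 0 (-1) 1) (fromBlocks 1 1 0 0) ∈ Matrix.symplecticGroup (ι ⊕ ι) ℝ := by
  rw [SymplecticGroup.fromBlocks_mem_iff]
  have e13 : A₁₃ᵀ = A₁₃ := h13
  have e21 : A₂₁ᵀ = A₂₁ := h21
  simp only [fromBlocks_transpose, fromBlocks_multiply, transpose_add, transpose_one,
    transpose_neg, transpose_zero, transpose_transpose, e13, e21, sub_eq_add_neg, fromBlocks_neg,
    fromBlocks_add, ← fromBlocks_one, fromBlocks_inj]
  refine ⟨⟨?_, ?_, ?_, ?_⟩, ⟨?_, ?_, ?_, ?_⟩, ?_, ?_, ?_, ?_⟩ <;> noncomm_ring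

theorem covariantOf_isCovariant {B : Matrix (ι ⊕ ι) (ι ⊕ ι) ℝ} (hB : B.IsSymm) :
    IsCovariant (covariantOf B) := by
  have h := hB
  rw [← fromBlocks_toBlocks B, IsSymm, fromBlocks_transpose, fromBlocks_inj] at h
  exact ⟨fromBlocks_covariant_mem_symplecticGroup h.1 (by
    rw [IsSymm, transpose_neg, h.2.2.2]), _, _, _, h.1, by rw [IsSymm, transpose_neg, h.2.2.2], rfl⟩

theorem cohenMatrix_covariantOf {B : Matrix (ι ⊕ ι) (ι ⊕ ι) ℝ} (hB : B.IsSymm) :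
    cohenMatrix (covariantOf B) = B := by
  have h := hB
  rw [← fromBlocks_toBlocks B, IsSymm, fromBlocks_transpose, fromBlocks_inj] at h
  simp only [cohenMatrix, covariantOf, toBlocks_fromBlocks₁₁, toBlocks_fromBlocks₁₂,
    toBlocks_fromBlocks₂₁]
  nth_rw 5 [← fromBlocks_toBlocks B]
  rw [transpose_sub, transpose_smul, transpose_one, neg_neg, sub_sub_cancel, sub_sub_cancel, h.2.2.1]

end Metaplectic

section Decay

/-! ### Decay of ambiguity functions and Wigner distributions of Schwartz functions -/

theorem one_add_norm_le_mul {V : Type*} [NormedAddCommGroup V] (x y : V) :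
    1 + ‖x‖ ≤ (1 + ‖y‖) * (1 + ‖x - y‖) := by
  have := norm_le_norm_add_norm_sub' x y
  nlinarith [norm_nonneg y, norm_nonneg (x - y), mul_nonneg (norm_nonneg y) (norm_nonneg (x - y))]

theorem SchwartzMap.exists_one_add_norm_pow_mul_le {V : Type*} [NormedAddCommGroup V]
    [NormedSpace ℝ V] (f : 𝓢(V, ℂ)) (N : ℕ) : ∃ C, 0 ≤ C ∧ ∀ x, (1 + ‖x‖) ^ N * ‖f x‖ ≤ C := by
  have h := fun x => SchwartzMap.one_add_le_sup_seminorm_apply (𝕜 := ℝ) (m := (N, 0)) (k := N)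
    (n := 0) le_rfl le_rfl f x
  simp only [norm_iteratedFDeriv_zero] at h
  exact ⟨_, le_trans (by positivity) (h 0), h⟩

/-- Integrability of functions with polynomial decay. -/
theorem exists_integrable_one_add_norm_inv_pow (V : Type*) [NormedAddCommGroup V]
    [NormedSpace ℝ V] [FiniteDimensional ℝ V] [MeasurableSpace V] [BorelSpace V] (μ : Measure V)
    [μ.IsAddHaarMeasure] :
    ∃ M : ℕ, ∀ N, M ≤ N → Integrable (fun x : V => ((1 + ‖x‖) ^ N)⁻¹) μ := by
  refine ⟨Module.finrank ℝ V + 1, fun N hN => ?_⟩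
  have := integrable_one_add_norm (μ := μ) (E := V) (r := N) (by exact_mod_cast hN)
  refine this.congr (Filter.Eventually.of_forall fun x => ?_)
  simp only [Real.rpow_neg (show (0:ℝ) ≤ 1 + ‖x‖ by positivity), Real.rpow_natCast]

theorem integrable_of_decay {V : Type*} [NormedAddCommGroup V]
    [NormedSpace ℝ V] [FiniteDimensional ℝ V] [MeasurableSpace V] [BorelSpace V] {μ : Measure V}
    [μ.IsAddHaarMeasure] {F : V → ℂ} (hF : AEStronglyMeasurable F μ)
    (h : ∀ N : ℕ, ∃ C, ∀ x, (1 + ‖x‖) ^ N * ‖F x‖ ≤ C) : Integrable F μ := by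
  obtain ⟨M, hM⟩ := exists_integrable_one_add_norm_inv_pow V μ
  obtain ⟨C, hC⟩ := h M
  refine ((hM M le_rfl).const_mul C).mono' hF (Filter.Eventually.of_forall fun x => ?_)
  rw [← div_eq_mul_inv, le_div_iff₀ (by positivity), mul_comm]
  exact hC x

variable {ι : Type} [Fintype ι]

/-- A Schwartz function as an element of `L²`. -/
def toL2 (f : 𝓢(E ι, ℂ)) : L2 ι := f.toLp 2

theorem coe_toL2 (f : 𝓢(E ι, ℂ)) : (toL2 f : E ι → ℂ) =ᵐ[volume] f :=
  f.coeFn_toLp 2 volume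

theorem fourier_toL2 (f : 𝓢(E ι, ℂ)) : (𝓕 (toL2 f) : L2 ι) = toL2 (𝓕 f) :=
  SchwartzMap.toLp_fourier_eq f

theorem tfShift_toL2 (z : Phase ι) (f : 𝓢(E ι, ℂ)) :
    tfShift z (toL2 f) = toL2 (shiftSchwartz z f) := (toLp_shiftSchwartz z f).symm

theorem norm_ambig_toLp_le (f g : 𝓢(E ι, ℂ)) (z : Phase ι) :
    ‖ambig (toL2 f) (toL2 g) z‖ ≤ ∫ t : E ι, ‖f t‖ * ‖g (t - fstPart z)‖ := by
  have hf := coe_toL2 f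
  have hg := coe_toL2 g
  generalize (toL2 f) = f' at hf ⊢
  generalize (toL2 g) = g' at hg ⊢
  rw [ambig, L2.inner_def]
  refine (norm_integral_le_integral_norm _).trans (le_of_eq (integral_congr_ae ?_))
  filter_upwards [coe_tfShift z g', tfShiftFun_congr z hg, hf] with t h1 h2 h3
  rw [h1, h2, h3, tfShiftFun_eq]
  simp

/-- The weight (1 + |x|)^N is submultiplicative and can be distributed over the two factors. -/
theorem integral_mul_translate_decay (f g : 𝓢(E ι, ℂ)) (N : ℕ) :
    ∃ C, 0 ≤ C ∧ ∀ x, (1 + ‖x‖) ^ N * ∫ t : E ι, ‖f t‖ * ‖g (t - x)‖ ≤ C := by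
  obtain ⟨Cg, hCg, hg⟩ := SchwartzMap.exists_one_add_norm_pow_mul_le g N
  have hfi : Integrable fun t : E ι => (1 + ‖t‖) ^ N * ‖f t‖ := by
    have := integrable_of_decay (μ := (volume : Measure (E ι)))
      (F := fun t => ((((1 + ‖t‖) ^ N : ℝ)) : ℂ) * f t) (by
        have hc : Continuous fun t : E ι => ((((1 + ‖t‖) ^ N : ℝ)) : ℂ) * f t :=
          (Complex.continuous_ofReal.comp (by fun_prop)).mul f.continuous
        exact hc.aestronglyMeasurable) (fun K => by
        obtain ⟨C, -, hC⟩ := SchwartzMap.exists_one_add_norm_pow_mul_le f (K + N)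
        refine ⟨C, fun x => ?_⟩
        rw [norm_mul, Complex.norm_real, Real.norm_eq_abs, abs_of_nonneg (by positivity),
          ← mul_assoc, ← pow_add]
        exact hC x)
    refine this.norm.congr (Filter.Eventually.of_forall fun x => ?_)
    simp only [norm_mul, Complex.norm_real, Real.norm_eq_abs]
    rw [abs_of_nonneg (by positivity)]
  refine ⟨Cg * ∫ t : E ι, (1 + ‖t‖) ^ N * ‖f t‖, by positivity, fun x => ?_⟩
  rw [← integral_const_mul, ← integral_const_mul]
  refine integral_mono_of_nonneg (Filter.Eventually.of_forall fun t => by positivity)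
    (hfi.const_mul Cg) (Filter.Eventually.of_forall fun t => ?_)
  have e1 : (1 + ‖x‖) ^ N ≤ (1 + ‖t‖) ^ N * (1 + ‖t - x‖) ^ N := by
    rw [← mul_pow, norm_sub_rev]; gcongr; exact one_add_norm_le_mul x t
  calc (1 + ‖x‖) ^ N * (‖f t‖ * ‖g (t - x)‖)
      ≤ (1 + ‖t‖) ^ N * (1 + ‖t - x‖) ^ N * (‖f t‖ * ‖g (t - x)‖) := by gcongr
    _ = ((1 + ‖t - x‖) ^ N * ‖g (t - x)‖) * ((1 + ‖t‖) ^ N * ‖f t‖) := by ring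
    _ ≤ Cg * ((1 + ‖t‖) ^ N * ‖f t‖) := by gcongr; exact hg _

theorem ambig_toLp_decay_fst (f g : 𝓢(E ι, ℂ)) (N : ℕ) : ∃ C, 0 ≤ C ∧
    ∀ z, (1 + ‖fstPart z‖) ^ N * ‖ambig (toL2 f) (toL2 g) z‖ ≤ C := by
  obtain ⟨C, hC, h⟩ := integral_mul_translate_decay f g N
  exact ⟨C, hC, fun z => (mul_le_mul_of_nonneg_left (norm_ambig_toLp_le f g z)
    (by positivity)).trans (h (fstPart z))⟩

theorem ambig_fourier (f g : L2 ι) (z : Phase ι) :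
    ambig f g z = ambig (𝓕 f : L2 ι) (𝓕 g : L2 ι) (rotJ z) := by
  rw [ambig, ambig, ← fourier_tfShift, Lp.inner_fourier_eq]

theorem one_add_norm_pow_le (z : Phase ι) (N : ℕ) : (1 + ‖z‖) ^ N ≤
    2 ^ N * ((1 + ‖fstPart z‖) ^ N + (1 + ‖sndPart z‖) ^ N) := by
  have hz : ‖z‖ ≤ ‖fstPart z‖ + ‖sndPart z‖ := by
    have := norm_sq_phase z
    refine le_of_sq_le_sq ?_ (by positivity)
    nlinarith [norm_nonneg (fstPart z), norm_nonneg (sndPart z),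
      mul_nonneg (norm_nonneg (fstPart z)) (norm_nonneg (sndPart z))]
  rcases le_total ‖fstPart z‖ ‖sndPart z‖ with h | h
  · calc (1 + ‖z‖) ^ N ≤ (2 * (1 + ‖sndPart z‖)) ^ N := by gcongr; linarith
      _ ≤ _ := by rw [mul_pow]; gcongr; exact le_add_of_nonneg_left (by positivity)
  · calc (1 + ‖z‖) ^ N ≤ (2 * (1 + ‖fstPart z‖)) ^ N := by gcongr; linarith
      _ ≤ _ := by rw [mul_pow]; gcongr; exact le_add_of_nonneg_right (by positivity)

/-- Decay in position is decay of a convolution. Decay in frequency is the same statement for the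
Fourier transforms, because the Fourier transform rotates the ambiguity function by `rotJ`. -/
theorem ambig_toLp_decay (f g : 𝓢(E ι, ℂ)) (N : ℕ) :
    ∃ C, 0 ≤ C ∧ ∀ z, (1 + ‖z‖) ^ N * ‖ambig (toL2 f) (toL2 g) z‖ ≤ C := by
  obtain ⟨C₁, hC₁, h1⟩ := ambig_toLp_decay_fst f g N
  obtain ⟨C₂, hC₂, h2⟩ := ambig_toLp_decay_fst (𝓕 f) (𝓕 g) N
  refine ⟨2 ^ N * (C₁ + C₂), by positivity, fun z => ?_⟩
  have h2' := h2 (rotJ z)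
  have e := ambig_fourier (toL2 f) (toL2 g) z
  rw [fourier_toL2, fourier_toL2] at e
  rw [← e, fstPart_rotJ] at h2'
  have h1' := h1 z
  have ha := norm_nonneg (ambig (toL2 f) (toL2 g) z)
  clear e
  generalize ‖ambig (toL2 f) (toL2 g) z‖ = a at *
  calc _ ≤ 2 ^ N * ((1 + ‖fstPart z‖) ^ N + (1 + ‖sndPart z‖) ^ N) * a := by
        gcongr; exact one_add_norm_pow_le z N
    _ = 2 ^ N * ((1 + ‖fstPart z‖) ^ N * a + (1 + ‖sndPart z‖) ^ N * a) := by ring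
    _ ≤ _ := by gcongr

/-- Reflection of a Schwartz function. -/
def reflectSchwartz (f : 𝓢(E ι, ℂ)) : 𝓢(E ι, ℂ) :=
  SchwartzMap.compCLMOfContinuousLinearEquiv ℂ (ContinuousLinearEquiv.neg ℝ) f

theorem reflectSchwartz_apply (f : 𝓢(E ι, ℂ)) (x : E ι) : reflectSchwartz f x = f (-x) := by
  simp [reflectSchwartz]

theorem toLp_reflectSchwartz (f : 𝓢(E ι, ℂ)) :
    (toL2 ((reflectSchwartz f))) = reflect (toL2 f) := by
  refine Lp.ext ?_
  filter_upwards [coe_toL2 (reflectSchwartz f), coe_reflect (toL2 f),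
    comp_neg_congr (coe_toL2 f)] with x h1 h2 h3
  rw [h1, h2, h3, reflectSchwartz_apply]

theorem wigner_toLp (f g : 𝓢(E ι, ℂ)) :
    wigner (toL2 f) (toL2 g) = wigner f g :=
  wigner_congr (coe_toL2 f) (coe_toL2 g)

theorem wigner_decay (f g : 𝓢(E ι, ℂ)) (N : ℕ) :
    ∃ C, 0 ≤ C ∧ ∀ z, (1 + ‖z‖) ^ N * ‖wigner f g z‖ ≤ C := by
  obtain ⟨C, hC, h⟩ := ambig_toLp_decay f (reflectSchwartz g) N
  refine ⟨2 ^ Fintype.card ι * C, by positivity, fun z => ?_⟩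
  rw [← wigner_toLp, wigner_eq_ambig, ← toLp_reflectSchwartz, norm_mul, norm_pow,
    Complex.norm_ofNat, mul_left_comm]
  gcongr
  refine le_trans ?_ (h ((2 : ℝ) • z))
  gcongr
  rw [norm_smul]; norm_num; linarith [norm_nonneg z]

theorem integrable_wigner (f g : 𝓢(E ι, ℂ)) : Integrable (wigner f g) := by
  refine integrable_of_decay ?_ fun N => ?_
  · rw [← wigner_toLp]; exact (stronglyMeasurable_wigner _ _).aestronglyMeasurable
  · obtain ⟨C, -, h⟩ := wigner_decay f g N; exact ⟨C, h⟩

theorem cexp_ofReal_mul_I (r : ℝ) : Complex.exp ((r : ℂ) * Complex.I) = cis r := rfl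

theorem ambig_toLp_eq_integral (f g : 𝓢(E ι, ℂ)) (z : Phase ι) :
    ambig (toL2 f) (toL2 g) z = ∫ t : E ι, f t * conj (tfShiftFun z g t) := by
  rw [ambig, L2.inner_def]
  refine integral_congr_ae ?_
  filter_upwards [coe_tfShift z (toL2 g), tfShiftFun_congr z (coe_toL2 g), coe_toL2 f]
    with t h1 h2 h3
  rw [h1, h2, h3]; simp

/-- The Fourier transform of the Wigner distribution is the ambiguity function. -/
theorem fourier_wigner (f g : 𝓢(E ι, ℂ)) (ζ : Phase ι) :
    𝓕 (wigner f g) ζ = ambig (toL2 f) (toL2 g) (-rotJ ζ) := by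
  set p := fstPart ζ with hp
  set q := sndPart ζ with hq
  have hcont := f.continuous
  have hcont' := g.continuous
  have hint : Integrable fun z : Phase ι => cis (-2 * Real.pi * inner ℝ z ζ) • wigner f g z := by
    have hc : Continuous fun z : Phase ι => cis (-2 * Real.pi * inner ℝ z ζ) := by fun_prop
    refine (integrable_wigner f g).norm.mono' (hc.aestronglyMeasurable.smul
      (integrable_wigner f g).1) (Filter.Eventually.of_forall fun z => ?_)
    rw [norm_smul]; simp
  -- As a function of ξ, W is the Fourier transform of t ↦ f(x + t/2) conj g(x - t/2). Fourier
  -- inversion at t = -q evaluates the inner integral.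
  have hk : ∀ x : E ι, ∫ ξ : E ι, cis (-2 * Real.pi * inner ℝ ξ q) • wigner f g (mkPhase x ξ) =
      f (x - (1 / 2 : ℝ) • q) * conj (g (x + (1 / 2 : ℝ) • q)) := by
    intro x
    set k : E ι → ℂ := fun t => f (x + (1 / 2 : ℝ) • t) * conj (g (x - (1 / 2 : ℝ) • t)) with hk
    have hkc : Continuous k := by
      have := Complex.continuous_conj
      fun_prop
    have hFk : ∀ ξ, 𝓕 k ξ = wigner f g (mkPhase x ξ) := fun ξ => by
      rw [Real.fourier_eq', wigner]
      refine integral_congr_ae (Filter.Eventually.of_forall fun t => ?_)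
      simp only [fstPart_mkPhase, sndPart_mkPhase, smul_eq_mul, hk]
      rw [mul_comm]; congr 2; push_cast; ring
    have hki : Integrable k := by
      obtain ⟨Cg, hCg, hg⟩ := SchwartzMap.exists_one_add_norm_pow_mul_le g 0
      have hf : Integrable fun t : E ι => f (x + (1 / 2 : ℝ) • t) := by
        have := (f.integrable (μ := volume)).comp_add_left x
        exact this.comp_smul (R := (1 / 2 : ℝ)) (by norm_num)
      refine (hf.norm.const_mul Cg).mono' hkc.aestronglyMeasurable
        (Filter.Eventually.of_forall fun t => ?_)
      have := hg (x - (1 / 2 : ℝ) • t)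
      simp only [pow_zero, one_mul] at this
      rw [hk, norm_mul, RCLike.norm_conj, mul_comm]
      gcongr
    have hFi : Integrable (𝓕 k) := by
      refine integrable_of_decay ?_ fun N => ?_
      · exact (VectorFourier.fourierIntegral_continuous Real.continuous_fourierChar
          continuous_inner hki).aestronglyMeasurable
      · obtain ⟨C, -, h⟩ := wigner_decay f g N
        refine ⟨C, fun ξ => le_trans ?_ (h (mkPhase x ξ))⟩
        rw [hFk]
        gcongr
        simpa using norm_sndPart_le (mkPhase x ξ)
    have hinv := congrFun (hkc.fourierInv_fourier_eq hki hFi) (-q)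
    rw [Real.fourierInv_eq'] at hinv
    have e : k (-q) = f (x - (1 / 2 : ℝ) • q) * conj (g (x + (1 / 2 : ℝ) • q)) := by
      simp only [hk, smul_neg, sub_neg_eq_add, ← sub_eq_add_neg]
    rw [← e, ← hinv]
    refine integral_congr_ae (Filter.Eventually.of_forall fun ξ => ?_)
    simp only [hFk, cexp_ofReal_mul_I, inner_neg_right]
    congr 2; ring
  rw [Real.fourier_eq']
  simp only [cexp_ofReal_mul_I]
  rw [integral_phase _ hint]
  have h1 : ∀ x : E ι, ∫ ξ : E ι, cis (-2 * Real.pi * inner ℝ (mkPhase x ξ) ζ) •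
      wigner f g (mkPhase x ξ) = cis (-2 * Real.pi * inner ℝ x p) *
        (f (x - (1 / 2 : ℝ) • q) * conj (g (x + (1 / 2 : ℝ) • q))) := fun x => by
    rw [← hk, ← integral_const_mul]
    refine integral_congr_ae (Filter.Eventually.of_forall fun ξ => ?_)
    simp only [inner_phase, fstPart_mkPhase, sndPart_mkPhase, smul_eq_mul, ← mul_assoc, ← cis_add]
    congr 2; ring
  simp_rw [h1]
  rw [ambig_toLp_eq_integral, ← integral_sub_right_eq_self
    (fun t => f t * conj (tfShiftFun (-rotJ ζ) g t)) ((1 / 2 : ℝ) • q)]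
  refine integral_congr_ae (Filter.Eventually.of_forall fun x => ?_)
  simp only [tfShiftFun_eq, fstPart_neg, sndPart_neg, fstPart_rotJ, sndPart_rotJ, ← hp, ← hq,
    map_mul, conj_cis, neg_neg, sub_neg_eq_add]
  have e : x - (1 / 2 : ℝ) • q + q = x + (1 / 2 : ℝ) • q := by module
  rw [e, mul_left_comm]
  congr 2
  simp only [inner_sub_right, inner_neg_left, real_inner_smul_right, real_inner_comm x p,
    real_inner_comm q p]
  ring_nf

theorem integrable_fourier_wigner (f g : 𝓢(E ι, ℂ)) : Integrable (𝓕 (wigner f g)) := by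
  have : 𝓕 (wigner f g) = fun ζ => ambig (toL2 f) (toL2 g) (-rotJ ζ) :=
    funext (fourier_wigner f g)
  refine integrable_of_decay ?_ fun N => ?_
  · exact (VectorFourier.fourierIntegral_continuous Real.continuous_fourierChar
      continuous_inner (integrable_wigner f g)).aestronglyMeasurable
  · obtain ⟨C, -, h⟩ := ambig_toLp_decay f g N
    refine ⟨C, fun ζ => ?_⟩
    have := h (-rotJ ζ)
    rwa [norm_neg, norm_rotJ, ← fourier_wigner] at this

end Decay

section LinearFlow

/-! ### Volume preserving matrices and the classical flow -/

variable {ι : Type} [Fintype ι] [DecidableEq ι]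

theorem det_actL (M : Matrix ι ι ℝ) :
    LinearMap.det ((actL M : E ι →L[ℝ] E ι) : E ι →ₗ[ℝ] E ι) = M.det := by
  have : ((actL M : E ι →L[ℝ] E ι) : E ι →ₗ[ℝ] E ι) =
      Matrix.toLin (PiLp.basisFun 2 ℝ ι) (PiLp.basisFun 2 ℝ ι) M := by
    rw [← Matrix.toLpLin_eq_toLin]
    ext x i
    simp [act, Matrix.toLpLin_apply]
  rw [this, LinearMap.det_toLin]

theorem measurePreserving_act {M : Matrix ι ι ℝ} (hM : |M.det| = 1) :
    MeasurePreserving (act M) (volume : Measure (E ι)) volume := by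
  refine ⟨(continuous_act M).measurable, ?_⟩
  have h0 : M.det ≠ 0 := by rintro h; simp [h] at hM
  have := Measure.map_linearMap_addHaar_eq_smul_addHaar (volume : Measure (E ι))
    (f := ((actL M : E ι →L[ℝ] E ι) : E ι →ₗ[ℝ] E ι)) (by rwa [det_actL])
  rw [det_actL, abs_inv, hM, inv_one, ENNReal.ofReal_one, one_smul] at this
  exact this

/-- An invertible matrix as a homeomorphism. -/
def actHomeo {M N : Matrix ι ι ℝ} (h : M * N = 1) : E ι ≃ₜ E ι where
  toFun := act M
  invFun := act N
  left_inv z := by rw [← act_mul, mul_eq_one_comm.1 h, act_one]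
  right_inv z := by rw [← act_mul, h, act_one]
  continuous_toFun := continuous_act M
  continuous_invFun := continuous_act N

theorem integral_act {G : Type*} [NormedAddCommGroup G] [NormedSpace ℝ G] {M : Matrix ι ι ℝ}
    (hM : |M.det| = 1) (F : E ι → G) : ∫ z, F (act M z) = ∫ z, F z := by
  have h : M * M⁻¹ = 1 := Matrix.mul_nonsing_inv _ (by
    rw [isUnit_iff_ne_zero]; rintro h; simp [h] at hM)
  exact (measurePreserving_act hM).integral_comp (actHomeo h).measurableEmbedding F

/-- The matrix of `rotJ`. -/
def matJ (ι : Type) [DecidableEq ι] : Matrix (ι ⊕ ι) (ι ⊕ ι) ℝ := fromBlocks 0 1 (-1) 0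

theorem act_matJ (z : Phase ι) : act (matJ ι) z = rotJ z := by
  rw [matJ, act_fromBlocks]; refine phase_ext ?_ ?_ <;> simp [act_zero_left, act_neg_left, act_one]

theorem matJ_transpose : (matJ ι)ᵀ = -matJ ι := by
  simp [matJ, fromBlocks_transpose, fromBlocks_neg]

theorem matJ_mul_matJ : matJ ι * matJ ι = -1 := by
  simp [matJ, fromBlocks_multiply, ← fromBlocks_one, fromBlocks_neg]

theorem flow_zero (Q : Matrix (ι ⊕ ι) (ι ⊕ ι) ℝ) : flow Q 0 = 1 := by
  simp [flow, NormedSpace.exp_zero]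

theorem flow_add (Q : Matrix (ι ⊕ ι) (ι ⊕ ι) ℝ) (s t : ℝ) :
    flow Q (s + t) = flow Q s * flow Q t := by
  rw [flow, flow, flow, ← Matrix.exp_add_of_commute _ _
    ((Commute.refl _).smul_left _ |>.smul_right _), ← add_smul]
  congr 2; ring

theorem flow_neg_mul_flow (Q : Matrix (ι ⊕ ι) (ι ⊕ ι) ℝ) (t : ℝ) :
    flow Q (-t) * flow Q t = 1 := by rw [← flow_add, neg_add_cancel, flow_zero]

theorem flow_mul_flow_neg (Q : Matrix (ι ⊕ ι) (ι ⊕ ι) ℝ) (t : ℝ) :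
    flow Q t * flow Q (-t) = 1 := by rw [← flow_add, add_neg_cancel, flow_zero]

theorem flow_neg_matrix (Q : Matrix (ι ⊕ ι) (ι ⊕ ι) ℝ) (t : ℝ) :
    flow (-Q) t = flow Q (-t) := by
  rw [flow, flow, mul_neg, smul_neg, neg_div, neg_neg, neg_smul, neg_neg]

/-- Symplecticity of the flow. For symmetric Q, the transpose of JQ is conjugate under J to -JQ, so
χ_tᵀ = J χ_{-t} J⁻¹ after exponentiating. -/
theorem transpose_flow_mul {Q : Matrix (ι ⊕ ι) (ι ⊕ ι) ℝ} (hQ : Q.IsSymm) (t : ℝ) :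
    (flow Q t)ᵀ * matJ ι * flow Q t = matJ ι := by
  have hJ : IsUnit (matJ ι) := by
    refine IsUnit.of_mul_eq_one (-matJ ι) ?_
    rw [mul_neg, matJ_mul_matJ, neg_neg]
  have hinv : (matJ ι)⁻¹ = -matJ ι := Matrix.inv_eq_right_inv (by
    rw [mul_neg, matJ_mul_matJ, neg_neg])
  have e : ((-(t / (2 * Real.pi))) • (matJ ι * Q))ᵀ =
      matJ ι * ((-(-t / (2 * Real.pi))) • (matJ ι * Q)) * (matJ ι)⁻¹ := by
    rw [transpose_smul, transpose_mul, hQ, matJ_transpose, hinv, Matrix.mul_smul, Matrix.smul_mul,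
      ← mul_assoc, matJ_mul_matJ, neg_div, neg_neg, neg_mul, one_mul, neg_mul_neg, mul_neg,
      neg_smul, smul_neg, neg_neg]
  have h1 : (flow Q t)ᵀ = matJ ι * flow Q (-t) * (matJ ι)⁻¹ := by
    rw [flow, flow, ← Matrix.exp_transpose]
    change NormedSpace.exp ((-(t / (2 * Real.pi))) • (matJ ι * Q))ᵀ = _
    rw [e, Matrix.exp_conj _ _ hJ]; rfl
  rw [h1, mul_assoc _ _ (matJ ι), hinv, neg_mul, matJ_mul_matJ, neg_neg, mul_one, mul_assoc,
    flow_neg_mul_flow, mul_one]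

theorem abs_det_flow {Q : Matrix (ι ⊕ ι) (ι ⊕ ι) ℝ} (hQ : Q.IsSymm) (t : ℝ) :
    |(flow Q t).det| = 1 := by
  have h := congrArg Matrix.det (transpose_flow_mul hQ t)
  rw [det_mul, det_mul, det_transpose] at h
  have hJ : (matJ ι).det ≠ 0 := by
    intro h0
    have := congrArg Matrix.det (matJ_mul_matJ (ι := ι))
    rw [det_mul, h0, det_neg] at this; simp at this
  rw [abs_eq (by norm_num), ← sq_eq_one_iff]
  apply mul_right_cancel₀ hJ; linarith

end LinearFlow

section Transport

/-! ### Transported covariant matrices -/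

variable {ι : Type} [Fintype ι]

/-- `𝓕⁻¹(e^{-π i Bζ·ζ} 𝓕 W(f, g))` for Schwartz functions. -/
theorem coe_cohenOp_tensorConj (B : Matrix (ι ⊕ ι) (ι ⊕ ι) ℝ) (f g : 𝓢(E ι, ℂ)) :
    (cohenOp B (tensorConj (toL2 f) (toL2 g)) : Phase ι → ℂ) =ᵐ[volume]
      𝓕⁻ fun ζ => cis (-(Real.pi * quad B ζ)) * 𝓕 (wigner f g) ζ := by
  have hw : Integrable (wigner (toL2 f) (toL2 g)) := by
    rw [wigner_toLp]; exact integrable_wigner f g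
  have h1 := coe_fourier_toLp hw (memLp_wigner (toL2 f) (toL2 g))
  have h2 := coe_quadChirp B (𝓕 (wignerLp (toL2 f) (toL2 g)) : L2 (ι ⊕ ι))
  have hc : Continuous fun ζ : Phase ι => cis (-(Real.pi * quad B ζ)) :=
    continuous_cis.comp (continuous_const.mul (continuous_quad B)).neg
  have hk : Integrable fun ζ => cis (-(Real.pi * quad B ζ)) * 𝓕 (wigner f g) ζ := by
    refine (integrable_fourier_wigner f g).norm.mono' (hc.aestronglyMeasurable.mul
      (integrable_fourier_wigner f g).1) (Filter.Eventually.of_forall fun z => ?_)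
    rw [norm_mul, norm_cis, one_mul]
  have h3 : (quadChirp B (𝓕 (wignerLp (toL2 f) (toL2 g)) : L2 (ι ⊕ ι)) : Phase ι → ℂ) =ᵐ[volume]
      fun ζ => cis (-(Real.pi * quad B ζ)) * 𝓕 (wigner f g) ζ := by
    filter_upwards [h1, h2] with ζ h1 h2
    rw [h2, wignerLp, h1, wigner_toLp]
  have hm : MemLp (fun ζ => cis (-(Real.pi * quad B ζ)) * 𝓕 (wigner f g) ζ) 2 :=
    (memLp_congr_ae h3).1 (Lp.memLp _)
  have h4 : quadChirp B (𝓕 (wignerLp (toL2 f) (toL2 g)) : L2 (ι ⊕ ι)) = hm.toLp _ :=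
    Lp.ext (h3.trans hm.coeFn_toLp.symm)
  rw [cohenOp_apply, wignerOp_tensorConj, h4]
  exact coe_fourierInv_toLp hk hm

/-- If ρ(a) = ρ(b) then ρ(a - b) is a scalar and commutes with every shift. For a ≠ b the commutator
with a suitable shift is -1. -/
theorem eq_of_tfShift_eq [Nontrivial (L2 ι)] {a b : Phase ι}
    (h : ∀ f : L2 ι, tfShift a f = tfShift b f) : a = b := by
  have h1 : ∀ f : L2 ι, tfShift (a - b) f = cis (Real.pi * symp b a) • f := fun f => by
    have := tfShift_neg_tfShift b f
    rw [← h, tfShift_tfShift, symp_neg_left] at this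
    rw [neg_add_eq_sub] at this
    nth_rw 2 [← this]
    rw [smul_smul, ← cis_add]; simp
  by_contra hab
  set c := a - b
  have hc : c ≠ 0 := sub_ne_zero.2 hab
  obtain ⟨f, hf⟩ := exists_ne (0 : L2 ι)
  -- Scaled so that the symplectic form of c and w is 1/2; the commutator of ρ(c) and ρ(w) is then
  -- e^{iπ} = -1.
  set w := (1 / (2 * ‖c‖ ^ 2)) • rotJ c with hw
  have hs : symp c w = 1 / 2 := by
    rw [hw, symp_smul_right, symp_eq_inner, real_inner_self_eq_norm_sq, norm_rotJ]
    field_simp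
  have h2 := tfShift_tfShift c w f
  have h3 := tfShift_tfShift w c f
  rw [h1] at h2
  rw [h1, tfShift_smul, h2, symp_swap w c, hs, add_comm c] at h3
  have h4 := smul_left_injective ℂ (m := tfShift (w + c) f) (by
    rw [← norm_ne_zero_iff, norm_tfShift]; exact norm_ne_zero_iff.2 hf) h3
  have h5 : cis (Real.pi * (1 / 2)) = cis (Real.pi * -(1 / 2)) * cis Real.pi := by
    rw [← cis_add]; ring_nf
  have h6 : cis Real.pi = 1 :=
    mul_left_cancel₀ (cis_ne_zero _) (h5.symm.trans (h4.trans (mul_one _).symm))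
  rw [cis, Complex.exp_pi_mul_I] at h6
  norm_num at h6

theorem isSymm_conj {B : Matrix ι ι ℝ} (hB : B.IsSymm) (ψ : Matrix ι ι ℝ) :
    (ψ * B * ψᵀ).IsSymm := by
  rw [IsSymm, transpose_mul, transpose_mul, transpose_transpose, hB, mul_assoc]

variable [DecidableEq ι]

/-- Convolution with Σ_𝒜 ∘ χ is a Fourier multiplier. The volume-preserving substitution ζ ↦ χᵀζ
moves χ from the kernel into its quadratic form, which becomes ψBψᵀ with ψ = χ⁻¹. -/
theorem cohenClass_distComp (𝒜 : Matrix ((ι ⊕ ι) ⊕ (ι ⊕ ι)) ((ι ⊕ ι) ⊕ (ι ⊕ ι)) ℝ)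
    {χ ψ : Matrix (ι ⊕ ι) (ι ⊕ ι) ℝ} (hχ : |χ.det| = 1) (hψ : χ * ψ = 1) (f g : E ι → ℂ)
    (z : Phase ι) :
    cohenClass (distComp (cohenKernel 𝒜) χ) f g z =
      𝓕⁻ (fun ζ => cis (-(Real.pi * quad (ψ * cohenMatrix 𝒜 * ψᵀ) ζ)) * 𝓕 (wigner f g) ζ) z := by
  have hinv : χ⁻¹ = ψ := Matrix.inv_eq_right_inv hψ
  have hψ' : ψ * χ = 1 := mul_eq_one_comm.1 hψ
  have h1 : ∀ ζ, 𝓕⁻ (fun w => wigner f g (z - act ψ w)) ζ =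
      cis (2 * Real.pi * inner ℝ (act χᵀ ζ) z) * 𝓕 (wigner f g) (act χᵀ ζ) := fun ζ => by
    rw [Real.fourierInv_eq', Real.fourier_eq', ← integral_const_mul, ← integral_act hχ,
      ← integral_sub_left_eq_self _ volume z]
    refine integral_congr_ae (Filter.Eventually.of_forall fun u => ?_)
    simp only [cexp_ofReal_mul_I, smul_eq_mul, ← act_mul, hψ', act_one, sub_sub_cancel,
      ← mul_assoc, ← cis_add]
    congr 2
    rw [real_inner_comm z, inner_act χ, inner_sub_left]; ring
  have hχT : |χᵀ.det| = 1 := by rwa [det_transpose]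
  rw [cohenClass, distComp, cohenKernel, hχ, hinv, Real.fourierInv_eq',
    ← integral_act hχT (fun ζ : Phase ι => Complex.exp (↑(2 * Real.pi * inner ℝ ζ z) * Complex.I) •
      (cis (-(Real.pi * quad (ψ * cohenMatrix 𝒜 * ψᵀ) ζ)) * 𝓕 (wigner f g) ζ))]
  simp only [inv_one, Complex.ofReal_one, one_mul]
  refine integral_congr_ae (Filter.Eventually.of_forall fun ζ => ?_)
  simp only [h1, smul_eq_mul]
  have hq : quad (ψ * cohenMatrix 𝒜 * ψᵀ) (act χᵀ ζ) = quad (cohenMatrix 𝒜) ζ := by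
    have e : ψᵀ * χᵀ = 1 := by rw [← transpose_mul, hψ, transpose_one]
    rw [quad_eq_inner, quad_eq_inner, inner_act, transpose_transpose, ← act_mul, ← act_mul,
      mul_assoc ψ, ← mul_assoc χ, hψ, one_mul, mul_assoc, e, mul_one]
  rw [hq, cexp_ofReal_mul_I]
  have : Complex.exp (-((Real.pi * quad (cohenMatrix 𝒜) ζ : ℝ) : ℂ) * Complex.I) =
      cis (-(Real.pi * quad (cohenMatrix 𝒜) ζ)) := by rw [cis]; push_cast; rfl
  rw [this]; ring

theorem isTransported_covariantOf {𝒜 : Matrix ((ι ⊕ ι) ⊕ (ι ⊕ ι)) ((ι ⊕ ι) ⊕ (ι ⊕ ι)) ℝ}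
    (h : IsCovariant 𝒜) {χ ψ : Matrix (ι ⊕ ι) (ι ⊕ ι) ℝ} (hχ : |χ.det| = 1) (hψ : χ * ψ = 1) :
    IsTransported 𝒜 χ (covariantOf (ψ * cohenMatrix 𝒜 * ψᵀ)) := by
  have hB := isSymm_conj h.isSymm ψ
  have hc := covariantOf_isCovariant hB
  obtain ⟨c, hc1, hT⟩ := hc.exists_metaplectic_eq
  refine ⟨hc, c, hc1, fun f g => ?_⟩
  rw [cohenMatrix_covariantOf hB] at hT
  change ⇑(metaWigner _ (toL2 f) (toL2 g)) =ᵐ[volume] _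
  rw [metaWigner, hT]
  filter_upwards [Lp.coeFn_smul c (cohenOp (ψ * cohenMatrix 𝒜 * ψᵀ) (tensorConj (toL2 f) (toL2 g))),
    coe_cohenOp_tensorConj (ψ * cohenMatrix 𝒜 * ψᵀ) f g] with z h1 h2
  rw [h1, Pi.smul_apply, h2, smul_eq_mul, cohenClass_distComp 𝒜 hχ hψ]

/-- Both metaplectic operators agree, up to a scalar, on the total family of shifted Gaussian
tensors, hence everywhere. Their intertwining relations then give ρ(𝒜₁y) = ρ(𝒜₂y) for all y. -/
theorem IsTransported.unique {𝒜 𝒜₁ 𝒜₂ : Matrix ((ι ⊕ ι) ⊕ (ι ⊕ ι)) ((ι ⊕ ι) ⊕ (ι ⊕ ι)) ℝ}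
    {χ : Matrix (ι ⊕ ι) (ι ⊕ ι) ℝ} (h1 : IsTransported 𝒜 χ 𝒜₁) (h2 : IsTransported 𝒜 χ 𝒜₂) :
    𝒜₁ = 𝒜₂ := by
  obtain ⟨hc1, c1, hn1, e1⟩ := h1
  obtain ⟨hc2, c2, hn2, e2⟩ := h2
  have hc10 : c1 ≠ 0 := by rintro rfl; simp at hn1
  have hc20 : c2 ≠ 0 := by rintro rfl; simp at hn2
  have e : ∀ f g : 𝓢(E ι, ℂ), c2 • metaplectic 𝒜₁ (tensorConj (toL2 f) (toL2 g)) =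
      c1 • metaplectic 𝒜₂ (tensorConj (toL2 f) (toL2 g)) := fun f g => by
    refine Lp.ext ?_
    filter_upwards [e1 f g, e2 f g,
      Lp.coeFn_smul c2 (metaplectic 𝒜₁ (tensorConj (toL2 f) (toL2 g))),
      Lp.coeFn_smul c1 (metaplectic 𝒜₂ (tensorConj (toL2 f) (toL2 g)))] with z h1 h2 h3 h4
    rw [h3, h4, Pi.smul_apply, Pi.smul_apply]
    change (metaplectic 𝒜₁ (tensorConj (toL2 f) (toL2 g)) : Phase ι → ℂ) z = _ at h1
    change (metaplectic 𝒜₂ (tensorConj (toL2 f) (toL2 g)) : Phase ι → ℂ) z = _ at h2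
    rw [h1, h2, smul_eq_mul, smul_eq_mul]; ring
  have hT := eq_of_eq_on_total (span_tfShift_tensorConj (windowLp_ne_zero (ι := ι)) windowLp_ne_zero)
    (c2 • ((metaplectic 𝒜₁).toContinuousLinearEquiv : L2 (ι ⊕ ι) →L[ℂ] L2 (ι ⊕ ι)))
    (c1 • ((metaplectic 𝒜₂).toContinuousLinearEquiv : L2 (ι ⊕ ι) →L[ℂ] L2 (ι ⊕ ι))) fun y => by
      have hy := e (shiftSchwartz (factorFst y) (window ι)) (shiftSchwartz (factorSnd y) (window ι))
      rw [← tfShift_toL2, ← tfShift_toL2] at hy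
      exact hy
  have hT' : ∀ F, metaplectic 𝒜₁ F = (c2⁻¹ * c1) • metaplectic 𝒜₂ F := fun F => by
    have : c2 • metaplectic 𝒜₁ F = c1 • metaplectic 𝒜₂ F := DFunLike.congr_fun hT F
    rw [mul_smul, ← this, smul_smul, inv_mul_cancel₀ hc20, one_smul]
  have : Nontrivial (L2 (ι ⊕ ι)) :=
    ⟨⟨_, _, tensorConj_ne_zero (windowLp_ne_zero (ι := ι)) windowLp_ne_zero⟩⟩
  refine act_ext fun y => eq_of_tfShift_eq fun F => ?_
  obtain ⟨G, rfl⟩ := (metaplectic 𝒜₁).surjective F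
  rw [← hc1.isMetaplectic y G, hT', hc2.isMetaplectic y G, hT' G, tfShift_smul]

end Transport

section SymbolDecay

/-! ### Fourier decay of symbols times a Schwartz function -/

variable {V : Type*} [NormedAddCommGroup V] [InnerProductSpace ℝ V]

/-- The derivatives of `s` up to order `N` are at most `M (1 + |u|)^k`. -/
def DerivBound (N k : ℕ) (M : ℝ) (s : V → ℂ) : Prop :=
  ContDiff ℝ ∞ s ∧ ∀ j ≤ N, ∀ u, ‖iteratedFDeriv ℝ j s u‖ ≤ M * (1 + ‖u‖) ^ k

theorem DerivBound.add {N k : ℕ} {M M' : ℝ} {s s' : V → ℂ} (h : DerivBound N k M s)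
    (h' : DerivBound N k M' s') : DerivBound N k (M + M') (fun u => s u + s' u) := by
  refine ⟨h.1.add h'.1, fun j hj u => ?_⟩
  have h1 := h.2 j hj u
  have h2 := h'.2 j hj u
  have e := iteratedFDeriv_add_apply (i := j) (x := u)
    ((h.1.of_le (by exact_mod_cast le_top)).contDiffAt)
    ((h'.1.of_le (by exact_mod_cast le_top)).contDiffAt)
  change ‖iteratedFDeriv ℝ j (s + s') u‖ ≤ _
  rw [e]
  refine (norm_add_le _ _).trans ?_
  rw [add_mul]; exact add_le_add h1 h2

theorem DerivBound.mono {N k k' : ℕ} {M M' : ℝ} {s : V → ℂ} (h : DerivBound N k M s)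
    (hk : k ≤ k') (hM : M ≤ M') (hM' : 0 ≤ M') : DerivBound N k' M' s := by
  refine ⟨h.1, fun j hj u => (h.2 j hj u).trans ?_⟩
  gcongr
  linarith [norm_nonneg u]

theorem exists_derivBound_ofReal {q : V → ℝ} (hq : q.HasTemperateGrowth) (N : ℕ) :
    ∃ k M, 0 ≤ M ∧ DerivBound N k M (fun u => (q u : ℂ)) := by
  have h : (fun u => (q u : ℂ)).HasTemperateGrowth := Complex.ofRealCLM.hasTemperateGrowth.comp hq
  obtain ⟨k, C, hC, h1⟩ := h.norm_iteratedFDeriv_le_uniform N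
  exact ⟨k, C, hC, h.1, h1⟩

variable [FiniteDimensional ℝ V] [MeasurableSpace V] [BorelSpace V]

/-- N integrations by parts; the polynomial growth of s is absorbed by G. The essential point is
that C does not depend on s and the bound is linear in M, which makes the later estimates uniform
over phase space. -/
theorem exists_fourier_mul_decay (G : 𝓢(V, ℂ)) (N k : ℕ) : ∃ C, 0 ≤ C ∧
    ∀ (s : V → ℂ) (M : ℝ), 0 ≤ M → DerivBound N k M s →
      ∀ ζ, (1 + ‖ζ‖) ^ N * ‖𝓕 (fun u => s u * G u) ζ‖ ≤ C * M := by
  obtain ⟨K, hK⟩ := exists_integrable_one_add_norm_inv_pow V (volume : Measure V)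
  have hK := hK K le_rfl
  set S : ℝ := 2 ^ (k + K) * (Finset.Iic (k + K, N)).sup
    (fun m => SchwartzMap.seminorm ℝ m.1 m.2) G with hS
  have hG : ∀ j ≤ N, ∀ u, (1 + ‖u‖) ^ (k + K) * ‖iteratedFDeriv ℝ j G u‖ ≤ S := fun j hj u =>
    SchwartzMap.one_add_le_sup_seminorm_apply (m := (k + K, N)) le_rfl hj G u
  have hS0 : 0 ≤ S := le_trans (by positivity) (hG 0 (Nat.zero_le _) 0)
  set I := ∫ u : V, ((1 + ‖u‖) ^ K)⁻¹ with hI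
  have hI0 : 0 ≤ I := integral_nonneg fun u => by positivity
  have hbound : ∀ (s : V → ℂ) (M : ℝ), 0 ≤ M → DerivBound N k M s → ∀ n ≤ N, ∀ u,
      ‖iteratedFDeriv ℝ n (fun u => s u * G u) u‖ ≤ 2 ^ N * M * S * ((1 + ‖u‖) ^ K)⁻¹ := by
    intro s M hM hs n hn u
    refine (norm_iteratedFDeriv_mul_le (N := ∞) hs.1 (G.smooth ⊤) u
      (by exact_mod_cast le_top)).trans ?_
    have h2 : ∀ j ≤ N, (1 + ‖u‖) ^ k * ‖iteratedFDeriv ℝ j G u‖ ≤ S * ((1 + ‖u‖) ^ K)⁻¹ :=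
      fun j hj => by
        rw [← div_eq_mul_inv, le_div_iff₀ (by positivity)]
        have := hG j hj u
        rw [pow_add] at this; linarith
    calc _ ≤ ∑ i ∈ Finset.range (n + 1), (n.choose i : ℝ) * (M * (S * ((1 + ‖u‖) ^ K)⁻¹)) := by
          refine Finset.sum_le_sum fun i hi => ?_
          have hi' : i ≤ n := Nat.lt_succ_iff.1 (Finset.mem_range.1 hi)
          rw [mul_assoc]
          refine mul_le_mul_of_nonneg_left ?_ (Nat.cast_nonneg _)
          calc _ ≤ (M * (1 + ‖u‖) ^ k) * ‖iteratedFDeriv ℝ (n - i) G u‖ := by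
                gcongr; exact hs.2 i (hi'.trans hn) u
            _ = M * ((1 + ‖u‖) ^ k * ‖iteratedFDeriv ℝ (n - i) G u‖) := by ring
            _ ≤ _ := mul_le_mul_of_nonneg_left (h2 _ ((Nat.sub_le _ _).trans hn)) hM
      _ = 2 ^ n * (M * (S * ((1 + ‖u‖) ^ K)⁻¹)) := by
          rw [← Finset.sum_mul]; congr 1
          exact_mod_cast Nat.sum_range_choose n
      _ ≤ 2 ^ N * (M * (S * ((1 + ‖u‖) ^ K)⁻¹)) := by gcongr; norm_num
      _ = _ := by ring
  -- The outer 2^N and the final 2 come from (1 + |ζ|)^N ≤ 2^N(1 + |ζ|^N), the middle 2^N and the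
  -- count N + 1 ≤ N + 2 of derivatives from the Fourier estimate, and 2^N S I from the Leibniz
  -- rule.
  refine ⟨2 ^ N * ((N + 2) * 2 ^ N * (2 ^ N * S * I) * 2), by positivity, fun s M hM hs ζ => ?_⟩
  have hsm : ContDiff ℝ ((⊤ : ℕ∞) : WithTop ℕ∞) (fun u => s u * G u) := hs.1.mul (G.smooth ⊤)
  have hint : ∀ n ≤ N, Integrable (fun u => ‖iteratedFDeriv ℝ n (fun u => s u * G u) u‖) := by
    intro n hn
    refine (hK.const_mul (2 ^ N * M * S)).mono' ?_ (Filter.Eventually.of_forall fun u => ?_)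
    · exact ((hsm.continuous_iteratedFDeriv (by exact_mod_cast le_top)).norm).aestronglyMeasurable
    · rw [norm_norm]; exact hbound s M hM hs n hn u
  have hle : ∀ n ≤ N, ∫ u, ‖iteratedFDeriv ℝ n (fun u => s u * G u) u‖ ≤ 2 ^ N * M * S * I := by
    intro n hn
    rw [hI, ← integral_const_mul]
    exact integral_mono (hint n hn) (hK.const_mul _) (hbound s M hM hs n hn)
  have main : ∀ n ≤ N, ‖ζ‖ ^ n * ‖𝓕 (fun u => s u * G u) ζ‖ ≤
      2 ^ N * ((N + 1) * (2 ^ N * M * S * I)) := by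
    intro n hn
    have := Real.pow_mul_norm_iteratedFDeriv_fourier_le (K := 0) (N := N)
      (f := fun u => s u * G u) (hsm.of_le (by exact_mod_cast le_top)) (k := 0) (n := n)
      (fun k n hk hn => by
        have hk0 : k = 0 := by simpa using hk
        subst hk0
        simpa using hint n (by exact_mod_cast hn)) (by simp) (by exact_mod_cast hn) ζ
    simp only [norm_iteratedFDeriv_zero, pow_zero, one_mul, CharP.cast_eq_zero, mul_zero, zero_add,
      Finset.range_one, Finset.sum_product, Finset.sum_singleton] at this
    refine this.trans (mul_le_mul (pow_le_pow_right₀ (by norm_num) hn) ?_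
      (Finset.sum_nonneg fun _ _ => by positivity) (by positivity))
    · calc _ ≤ ∑ i ∈ Finset.range (n + 1), 2 ^ N * M * S * I :=
            Finset.sum_le_sum fun i hi => hle i
              ((Nat.lt_succ_iff.1 (Finset.mem_range.1 hi)).trans hn)
        _ = ((n : ℝ) + 1) * (2 ^ N * M * S * I) := by
            rw [Finset.sum_const, Finset.card_range, nsmul_eq_mul]; push_cast; ring
        _ ≤ _ := by gcongr
  have h0 := main 0 (Nat.zero_le _)
  have hN := main N le_rfl
  rw [pow_zero, one_mul] at h0
  have hp : (1 + ‖ζ‖) ^ N ≤ 2 ^ N * (1 + ‖ζ‖ ^ N) := by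
    rcases le_total ‖ζ‖ 1 with h | h
    · calc (1 + ‖ζ‖) ^ N ≤ 2 ^ N := by gcongr; linarith
        _ ≤ _ := le_mul_of_one_le_right (by positivity) (by linarith [pow_nonneg (norm_nonneg ζ) N])
    · calc (1 + ‖ζ‖) ^ N ≤ (2 * ‖ζ‖) ^ N := by gcongr; linarith
        _ ≤ _ := by rw [mul_pow]; gcongr; linarith
  calc _ ≤ 2 ^ N * (1 + ‖ζ‖ ^ N) * ‖𝓕 (fun u => s u * G u) ζ‖ := by gcongr
    _ = 2 ^ N * (‖𝓕 (fun u => s u * G u) ζ‖ + ‖ζ‖ ^ N * ‖𝓕 (fun u => s u * G u) ζ‖) := by ring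
    _ ≤ 2 ^ N * (2 ^ N * ((N + 1) * (2 ^ N * M * S * I)) +
        2 ^ N * ((N + 1) * (2 ^ N * M * S * I))) := by gcongr
    _ ≤ 2 ^ N * (2 ^ N * ((N + 2) * (2 ^ N * M * S * I)) +
        2 ^ N * ((N + 2) * (2 ^ N * M * S * I))) := by gcongr <;> norm_num
    _ = _ := by ring

variable {ι : Type} [Fintype ι]

/-- The symbols `a(u + δ/2) + σ(u + m)`, `a` the quadratic form of `Q / 2`, are bounded
by `(1 + |δ|)²`, uniformly in `m`. -/
theorem exists_derivBound_symbol (Q : Matrix ι ι ℝ) {σ : E ι → ℂ} (hσ : ContDiff ℝ ∞ σ)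
    (hσ' : ∀ k : ℕ, ∃ C : ℝ, ∀ z, ‖iteratedFDeriv ℝ k σ z‖ ≤ C) (N : ℕ) :
    ∃ k C, 0 ≤ C ∧ ∀ δ m : E ι, DerivBound N k (C * (1 + ‖δ‖) ^ 2)
      (fun u => ((1 / 2 * quad Q (u + (1 / 2 : ℝ) • δ) : ℝ) : ℂ) + σ (u + m)) := by
  obtain ⟨k₁, C₁, hC₁, h1⟩ := exists_derivBound_ofReal
    (q := fun u => 1 / 2 * quad Q u) ((Function.HasTemperateGrowth.const _).mul
      (quad_hasTemperateGrowth Q)) N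
  obtain ⟨k₂, C₂, hC₂, h2⟩ := (Function.HasTemperateGrowth.id (E := E ι)).norm_iteratedFDeriv_le_uniform N
  choose c hc using hσ'
  set R := Q + Qᵀ
  -- The expansion in δ shows quadratic growth at worst: the three terms are bounded, linear and
  -- quadratic in δ, each with fixed polynomial growth in u.
  have hquad : ∀ u δ : E ι, 1 / 2 * quad Q (u + (1 / 2 : ℝ) • δ) =
      1 / 2 * quad Q u + 1 / 4 * inner ℝ (act R δ) u + 1 / 8 * quad Q δ := fun u δ => by
    simp only [quad_eq_inner, act_add_right, act_smul_right, inner_add_left, inner_add_right,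
      real_inner_smul_left, real_inner_smul_right, R, act_add_left]
    rw [inner_act Qᵀ, transpose_transpose, real_inner_comm u (act Q δ)]; ring
  have hlin : ∀ δ : E ι, DerivBound N k₂ (1 / 4 * (‖actL R‖ * ‖δ‖) * C₂)
      (fun u => ((1 / 4 * inner ℝ (act R δ) u : ℝ) : ℂ)) := fun δ => by
    set L : E ι →L[ℝ] ℂ := Complex.ofRealCLM.comp ((1 / 4 : ℝ) • innerSL ℝ (act R δ)) with hL
    have hLe : (fun u => ((1 / 4 * inner ℝ (act R δ) u : ℝ) : ℂ)) = L ∘ id := by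
      ext u; simp [hL]
    have hLn : ‖L‖ ≤ 1 / 4 * (‖actL R‖ * ‖δ‖) := by
      refine (ContinuousLinearMap.opNorm_comp_le _ _).trans ?_
      rw [Complex.ofRealCLM_norm, one_mul, norm_smul, innerSL_apply_norm]
      norm_num
      exact (actL R).le_opNorm δ
    refine ⟨by rw [hLe]; exact L.contDiff.comp contDiff_id, fun j hj u => ?_⟩
    rw [hLe]
    refine (L.norm_iteratedFDeriv_comp_left (N := ∞) contDiff_id.contDiffAt
      (by exact_mod_cast le_top)).trans ?_
    rw [mul_assoc]
    gcongr
    exact h2 j hj u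
  have hconst : ∀ δ : E ι, DerivBound N 0 (1 / 8 * (‖actL Q‖ * ‖δ‖ ^ 2))
      (fun _ : E ι => ((1 / 8 * quad Q δ : ℝ) : ℂ)) := fun δ => by
    refine ⟨contDiff_const, fun j hj u => ?_⟩
    rcases j with _ | j
    · rw [norm_iteratedFDeriv_zero, Complex.norm_real, norm_mul, quad_eq_inner, pow_zero, mul_one]
      norm_num
      calc |inner ℝ δ (act Q δ)| ≤ ‖δ‖ * ‖act Q δ‖ := abs_real_inner_le_norm _ _
        _ ≤ ‖δ‖ * (‖actL Q‖ * ‖δ‖) := by gcongr; exact (actL Q).le_opNorm δ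
        _ = _ := by ring
    · rw [iteratedFDeriv_const_of_ne (by simp)]; simp; positivity
  have hsig : ∀ m : E ι, DerivBound N 0 (∑ j ∈ Finset.range (N + 1), |c j|)
      (fun u => σ (u + m)) := fun m => by
    refine ⟨hσ.comp (contDiff_id.add contDiff_const), fun j hj u => ?_⟩
    rw [iteratedFDeriv_comp_add_right, pow_zero, mul_one]
    refine (hc j _).trans ((le_abs_self _).trans ?_)
    exact Finset.single_le_sum (f := fun j => |c j|) (fun _ _ => abs_nonneg _)
      (Finset.mem_range.2 (Nat.lt_succ_of_le hj))
  set S := ∑ j ∈ Finset.range (N + 1), |c j|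
  have hS : 0 ≤ S := Finset.sum_nonneg fun _ _ => abs_nonneg _
  refine ⟨max k₁ k₂, C₁ + 1 / 4 * ‖actL R‖ * C₂ + 1 / 8 * ‖actL Q‖ + S, by positivity,
    fun δ m => ?_⟩
  have hd : 1 ≤ (1 + ‖δ‖) ^ 2 := one_le_pow₀ (by linarith [norm_nonneg δ])
  have hd1 : ‖δ‖ ≤ (1 + ‖δ‖) ^ 2 := by nlinarith [norm_nonneg δ]
  have hd2 : ‖δ‖ ^ 2 ≤ (1 + ‖δ‖) ^ 2 := by nlinarith [norm_nonneg δ]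
  have := (((h1.mono (le_max_left k₁ k₂) (le_mul_of_one_le_right hC₁ hd) (by positivity)).add
    ((hlin δ).mono (le_max_right k₁ k₂) (M' := 1 / 4 * ‖actL R‖ * C₂ * (1 + ‖δ‖) ^ 2) (by
      calc _ = 1 / 4 * ‖actL R‖ * C₂ * ‖δ‖ := by ring
        _ ≤ _ := by gcongr) (by positivity))).add
    ((hconst δ).mono (Nat.zero_le _) (M' := 1 / 8 * ‖actL Q‖ * (1 + ‖δ‖) ^ 2) (by
      rw [mul_assoc]; gcongr) (by positivity))).add
    ((hsig m).mono (Nat.zero_le _) (le_mul_of_one_le_right hS hd) (by positivity))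
  convert! this using 1
  · ring
  · ext u; rw [hquad]; push_cast; ring

end SymbolDecay

section Coherent

variable {ι : Type} [Fintype ι]

/-! ### Coherent states -/

/-- The coherent state centred at `z`. -/
def coherent (z : Phase ι) : L2 ι := tfShift z (windowLp ι)

theorem wigner_conj (f g : E ι → ℂ) (z : Phase ι) : conj (wigner f g z) = wigner g f z := by
  rw [wigner, wigner, ← integral_conj, ← integral_neg_eq_self]
  refine integral_congr_ae (Filter.Eventually.of_forall fun t => ?_)
  simp only [map_mul, ← Complex.exp_conj, Complex.conj_conj, map_neg, Complex.conj_I,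
    Complex.conj_ofReal, smul_neg, sub_neg_eq_add, ← sub_eq_add_neg, inner_neg_left]
  rw [mul_comm (conj _)]
  congr 2
  push_cast; ring

/-- The Wigner distribution of the Gaussian is a Gaussian. -/
theorem exists_wigner_window (ι : Type) [Fintype ι] :
    ∃ G : 𝓢(Phase ι, ℂ), wigner (window ι) (window ι) = G := by
  set c : ℂ := (Real.pi / ((Real.pi / 2 : ℝ) : ℂ)) ^ (Module.finrank ℝ (E ι) / 2 : ℂ)
  refine ⟨c • gaussian (Phase ι) (b := 2 * Real.pi) (by positivity), funext fun z => ?_⟩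
  have hb : (0 : ℝ) < ((Real.pi / 2 : ℝ) : ℂ).re := by rw [Complex.ofReal_re]; positivity
  have h := fourier_gaussian_innerProductSpace hb (sndPart z)
  rw [Real.fourier_eq'] at h
  have e : ∀ t : E ι, window ι (fstPart z + (1 / 2 : ℝ) • t) *
      conj (window ι (fstPart z - (1 / 2 : ℝ) • t)) *
      Complex.exp (-(2 * Real.pi * inner ℝ t (sndPart z) : ℝ) * Complex.I) =
      ((Real.exp (-(2 * Real.pi) * ‖fstPart z‖ ^ 2) : ℝ) : ℂ) *
        (Complex.exp (↑(-2 * Real.pi * inner ℝ t (sndPart z)) * Complex.I) •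
          Complex.exp (-((Real.pi / 2 : ℝ) : ℂ) * ‖t‖ ^ 2)) := fun t => by
    have hp := parallelogram_law_with_norm ℝ (fstPart z) ((1 / 2 : ℝ) • t)
    rw [norm_smul] at hp
    norm_num at hp
    rw [window_apply, window_apply, Complex.conj_ofReal, ← Complex.ofReal_mul, ← Real.exp_add,
      smul_eq_mul, mul_left_comm, mul_comm]
    have e1 : -Real.pi * ‖fstPart z + (1 / 2 : ℝ) • t‖ ^ 2 +
        -Real.pi * ‖fstPart z - (1 / 2 : ℝ) • t‖ ^ 2 =
        -(2 * Real.pi) * ‖fstPart z‖ ^ 2 + -(Real.pi / 2) * ‖t‖ ^ 2 := by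
      linear_combination (-Real.pi) * hp
    rw [e1, Real.exp_add, Complex.ofReal_mul]
    congr 1
    · push_cast; ring_nf
    · push_cast; rfl
  rw [wigner]
  simp_rw [e]
  rw [integral_const_mul, h, _root_.smul_apply, gaussian_apply, norm_sq_phase, mul_add,
    Real.exp_add, smul_eq_mul, Complex.ofReal_mul, mul_left_comm]
  congr 2
  rw [Complex.ofReal_exp]
  congr 1
  push_cast
  field_simp

/-- The Wigner distribution of the Gaussian, as a Schwartz function. -/
def wignerWindow (ι : Type) [Fintype ι] : 𝓢(Phase ι, ℂ) := (exists_wigner_window ι).choose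

theorem wigner_window : wigner (window ι) (window ι) = wignerWindow ι :=
  (exists_wigner_window ι).choose_spec

theorem conj_wignerWindow (u : Phase ι) : conj (wignerWindow ι u) = wignerWindow ι u := by
  rw [← wigner_window, wigner_conj]

theorem windowLp_eq_toL2 : windowLp ι = toL2 (window ι) := rfl

/-- The form matches that of the Weyl matrix elements with symbol 1, so that differentiating in z
can be compared with applying the Weyl operator. -/
theorem inner_coherent (v z : Phase ι) : inner ℂ (coherent v) (coherent z) =
    cis (-(Real.pi * symp v z)) * 𝓕 (wignerWindow ι : Phase ι → ℂ) (rotJ (v - z)) := by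
  rw [← wigner_window, fourier_wigner, rotJ_rotJ, neg_neg, ← windowLp_eq_toL2, ambig, coherent,
    coherent, ← inner_tfShift_tfShift (-z) (tfShift v _), tfShift_neg_tfShift, tfShift_tfShift,
    inner_smul_left, conj_cis, symp_neg_left, symp_swap z v, neg_add_eq_sub, neg_neg]

/-- The cross-Wigner distribution of two coherent states is a modulated Gaussian at their midpoint.
The matrix element is therefore a Fourier transform of the symbol localised there, at frequency J(v
- z). -/
theorem inner_coherent_weyl {s : Phase ι → ℂ} {z : Phase ι} {h : L2 ι}
    (hh : IsWeylOp s (shiftSchwartz z (window ι)) h) (v : Phase ι) :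
    inner ℂ (coherent v) h = cis (-(Real.pi * symp v z)) *
      𝓕 (fun u => s (u + (1 / 2 : ℝ) • (v + z)) * wignerWindow ι u) (rotJ (v - z)) := by
  have h1 := hh (shiftSchwartz v (window ι))
  rw [toLp_shiftSchwartz] at h1
  change inner ℂ (coherent v) h = _ at h1
  rw [h1, Real.fourier_eq', ← integral_const_mul, ← integral_add_right_eq_self _
    ((1 / 2 : ℝ) • (v + z))]
  refine integral_congr_ae (Filter.Eventually.of_forall fun u => ?_)
  have e := wigner_tfShift v z (windowLp ι) (windowLp ι) (u + (1 / 2 : ℝ) • (v + z))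
  rw [windowLp_eq_toL2, tfShift_toL2, tfShift_toL2, wigner_toLp, wigner_toLp, wigner_window,
    add_sub_cancel_right] at e
  simp only [e, map_mul, conj_cis, conj_wignerWindow, cexp_ofReal_mul_I, smul_eq_mul]
  have e2 : cis (-(Real.pi * (2 * symp (v - z) (u + (1 / 2 : ℝ) • (v + z)) - symp v z))) =
      cis (-(Real.pi * symp v z)) * cis (-2 * Real.pi * inner ℝ u (rotJ (v - z))) := by
    rw [← cis_add, real_inner_comm, ← symp_eq_inner]
    congr 1
    simp only [symp_add_right, symp_smul_right, symp_sub_left, symp_self, symp_swap z v]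
    ring
  rw [e2]; ring

/-! ### Differentiability of the coherent states -/

/-- The exponent of the coherent state. -/
def coherentExp (z : Phase ι) (t : E ι) : ℂ :=
  ((2 * Real.pi * inner ℝ (fstPart z) t : ℝ) : ℂ) +
    ((2 * Real.pi * inner ℝ (sndPart z) t : ℝ) : ℂ) * Complex.I

theorem tfShiftFun_window (z : Phase ι) (t : E ι) : tfShiftFun z (window ι) t =
    window ι t * Complex.exp (coherentExp z t - (((Real.pi * ‖fstPart z‖ ^ 2 : ℝ) : ℂ) +
      ((Real.pi * inner ℝ (fstPart z) (sndPart z) : ℝ) : ℂ) * Complex.I)) := by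
  rw [tfShiftFun_eq, window_apply, window_apply, Complex.ofReal_exp, Complex.ofReal_exp, cis,
    ← Complex.exp_add, ← Complex.exp_add, norm_sub_sq_real, coherentExp,
    real_inner_comm (fstPart z) t]
  congr 1
  push_cast; ring

theorem coherentExp_hasTemperateGrowth (z : Phase ι) :
    (coherentExp z).HasTemperateGrowth := by
  have h : ∀ x : E ι, (fun t : E ι => ((2 * Real.pi * inner ℝ x t : ℝ) : ℂ)).HasTemperateGrowth :=
    fun x => Complex.ofRealCLM.hasTemperateGrowth.comp
      ((Function.HasTemperateGrowth.const _).mul (Function.hasTemperateGrowth_inner_right _))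
  exact (h _).add ((h _).mul (.const _))

/-- The derivative of the coherent states at the origin, as a function. -/
def coherentDerivFun (z : Phase ι) : L2 ι :=
  toL2 (SchwartzMap.smulLeftCLM ℂ (coherentExp z) (window ι))

theorem coe_coherentDerivFun (z : Phase ι) :
    (coherentDerivFun z : E ι → ℂ) =ᵐ[volume] fun t => coherentExp z t * window ι t := by
  filter_upwards [coe_toL2 (SchwartzMap.smulLeftCLM ℂ (coherentExp z) (window ι))] with t ht
  rw [coherentDerivFun, ht, SchwartzMap.smulLeftCLM_apply_apply (coherentExp_hasTemperateGrowth z),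
    smul_eq_mul]

/-- The derivative of the coherent states at the origin. -/
def coherentDeriv (ι : Type) [Fintype ι] : Phase ι →L[ℝ] L2 ι :=
  LinearMap.toContinuousLinearMap
    { toFun := coherentDerivFun
      map_add' := fun z w => by
        refine Lp.ext ?_
        filter_upwards [coe_coherentDerivFun (z + w), coe_coherentDerivFun z,
          coe_coherentDerivFun w, Lp.coeFn_add (coherentDerivFun z) (coherentDerivFun w)]
          with t h1 h2 h3 h4
        rw [h1, h4, Pi.add_apply, h2, h3]
        simp only [coherentExp, fstPart_add, sndPart_add, inner_add_left]; push_cast; ring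
      map_smul' := fun r z => by
        refine Lp.ext ?_
        filter_upwards [coe_coherentDerivFun (r • z), coe_coherentDerivFun z,
          Lp.coeFn_smul r (coherentDerivFun z)] with t h1 h2 h3
        rw [h1, RingHom.id_apply, h3, Pi.smul_apply, h2, Complex.real_smul]
        simp only [coherentExp, fstPart_smul, sndPart_smul, real_inner_smul_left]
        push_cast; ring }

theorem coherentDeriv_apply (z : Phase ι) : coherentDeriv ι z = coherentDerivFun z := rfl

theorem norm_coherentExp_le (z : Phase ι) (t : E ι) :
    ‖coherentExp z t‖ ≤ 4 * Real.pi * ‖z‖ * ‖t‖ := by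
  have h : ∀ x : E ι, ‖x‖ ≤ ‖z‖ → ‖((2 * Real.pi * inner ℝ x t : ℝ) : ℂ)‖ ≤
      2 * Real.pi * (‖z‖ * ‖t‖) := fun x hx => by
    rw [Complex.norm_real, norm_mul, Real.norm_of_nonneg (by positivity)]
    gcongr
    exact (norm_inner_le_norm x t).trans (by gcongr)
  refine (norm_add_le _ _).trans ?_
  rw [norm_mul, Complex.norm_I, mul_one]
  linarith [h _ (norm_fstPart_le z), h _ (norm_sndPart_le z)]

theorem norm_coherent_remainder_le (z : Phase ι) (hz : ‖z‖ ≤ 1) (t : E ι) :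
    ‖Complex.exp (coherentExp z t - (((Real.pi * ‖fstPart z‖ ^ 2 : ℝ) : ℂ) +
      ((Real.pi * inner ℝ (fstPart z) (sndPart z) : ℝ) : ℂ) * Complex.I)) - 1 - coherentExp z t‖ ≤
      (16 * Real.pi ^ 2 + 2 * Real.pi) * ‖z‖ ^ 2 *
        ((1 + ‖t‖) ^ 2 * Real.exp (4 * Real.pi * (1 + ‖t‖))) := by
  set ℓ := coherentExp z t with hℓ
  set r : ℂ := ((Real.pi * ‖fstPart z‖ ^ 2 : ℝ) : ℂ) +
      ((Real.pi * inner ℝ (fstPart z) (sndPart z) : ℝ) : ℂ) * Complex.I with hr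
  have h1 : ‖ℓ‖ ≤ 4 * Real.pi * ‖z‖ * ‖t‖ := norm_coherentExp_le z t
  have h2 : ‖r‖ ≤ 2 * Real.pi * ‖z‖ ^ 2 := by
    refine (norm_add_le _ _).trans ?_
    rw [norm_mul, Complex.norm_I, mul_one, Complex.norm_real, Complex.norm_real, norm_mul,
      norm_mul, Real.norm_of_nonneg Real.pi_pos.le, Real.norm_of_nonneg (by positivity)]
    have e1 : ‖fstPart z‖ ^ 2 ≤ ‖z‖ ^ 2 := by gcongr; exact norm_fstPart_le z
    have e2 : ‖(inner ℝ (fstPart z) (sndPart z) : ℝ)‖ ≤ ‖z‖ * ‖z‖ :=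
      (norm_inner_le_norm _ _).trans (by gcongr; exacts [norm_fstPart_le z, norm_sndPart_le z])
    nlinarith [Real.pi_pos]
  have hw : ‖ℓ - r‖ ≤ 4 * Real.pi * ‖z‖ * (1 + ‖t‖) := by
    refine (norm_sub_le _ _).trans ?_
    have : ‖z‖ ^ 2 ≤ ‖z‖ := by nlinarith [norm_nonneg z]
    nlinarith [Real.pi_pos, norm_nonneg z]
  have hw' : ‖ℓ - r‖ ≤ 4 * Real.pi * (1 + ‖t‖) := hw.trans (by
    have : 4 * Real.pi * ‖z‖ ≤ 4 * Real.pi := mul_le_of_le_one_right (by positivity) hz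
    gcongr)
  have h3 := Complex.norm_exp_sub_sum_le_norm_mul_exp (ℓ - r) 2
  simp only [Finset.sum_range_succ, Finset.sum_range_zero, pow_zero, pow_one, Nat.factorial,
    zero_add, Nat.cast_one, div_one, mul_one] at h3
  have e : Complex.exp (ℓ - r) - 1 - ℓ = (Complex.exp (ℓ - r) - (1 + (ℓ - r))) - r := by ring
  rw [e]
  refine (norm_sub_le _ _).trans ?_
  have h4 : ‖ℓ - r‖ ^ 2 * Real.exp ‖ℓ - r‖ ≤
      (4 * Real.pi * ‖z‖ * (1 + ‖t‖)) ^ 2 * Real.exp (4 * Real.pi * (1 + ‖t‖)) := by gcongr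
  have h5 : 1 ≤ (1 + ‖t‖) ^ 2 * Real.exp (4 * Real.pi * (1 + ‖t‖)) := by
    have a1 : 1 ≤ (1 + ‖t‖) ^ 2 := one_le_pow₀ (by linarith [norm_nonneg t])
    have a2 : 1 ≤ Real.exp (4 * Real.pi * (1 + ‖t‖)) := Real.one_le_exp (by positivity)
    nlinarith
  have h6 := mul_le_mul_of_nonneg_left h5 (show 0 ≤ 2 * Real.pi * ‖z‖ ^ 2 by positivity)
  nlinarith

/-- Half of the Gaussian exponent pays for the polynomial and exponential factors. The constant
comes from completing the square in (4π + 1)r - (π/2)r². -/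
theorem sq_mul_exp_mul_window_le (t : E ι) :
    (1 + ‖t‖) ^ 2 * Real.exp (4 * Real.pi * (1 + ‖t‖)) * ‖window ι t‖ ≤
      2 * Real.exp ((4 * Real.pi + 1) + (4 * Real.pi + 1) ^ 2 / (2 * Real.pi)) *
        Real.exp (-(Real.pi / 2) * ‖t‖ ^ 2) := by
  have h1 : (1 + ‖t‖) ^ 2 ≤ 2 * Real.exp (1 + ‖t‖) := by
    have := Real.pow_div_factorial_le_exp (1 + ‖t‖) (by positivity) 2
    norm_num [Nat.factorial] at this; linarith
  rw [window_apply, Complex.norm_real, Real.norm_of_nonneg (Real.exp_pos _).le]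
  calc _ ≤ 2 * Real.exp (1 + ‖t‖) * Real.exp (4 * Real.pi * (1 + ‖t‖)) *
        Real.exp (-Real.pi * ‖t‖ ^ 2) := by gcongr
    _ = 2 * Real.exp ((1 + ‖t‖) + 4 * Real.pi * (1 + ‖t‖) + -Real.pi * ‖t‖ ^ 2) := by
        rw [Real.exp_add (1 + ‖t‖ + _), Real.exp_add (1 + ‖t‖)]; ring
    _ ≤ 2 * Real.exp (((4 * Real.pi + 1) + (4 * Real.pi + 1) ^ 2 / (2 * Real.pi)) +
        -(Real.pi / 2) * ‖t‖ ^ 2) := by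
        refine mul_le_mul_of_nonneg_left (Real.exp_le_exp.2 ?_) zero_le_two
        have hp := Real.pi_pos
        have e : (4 * Real.pi + 1) ^ 2 / (2 * Real.pi) - (4 * Real.pi + 1) * ‖t‖ +
            (Real.pi / 2) * ‖t‖ ^ 2 = (Real.pi / 2) * (‖t‖ - (4 * Real.pi + 1) / Real.pi) ^ 2 := by
          field_simp; ring
        have : 0 ≤ (Real.pi / 2) * (‖t‖ - (4 * Real.pi + 1) / Real.pi) ^ 2 := by positivity
        linarith
    _ = _ := by rw [Real.exp_add]; ring

/-- The second-order Taylor remainder is at most a constant times |z|² e^{-π|t|²/2} pointwise, hence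
O(|z|²) in L². -/
theorem hasFDerivAt_coherent_zero :
    HasFDerivAt (coherent : Phase ι → L2 ι) (coherentDeriv ι) 0 := by
  set Ψ : L2 ι := toL2 (gaussian (E ι) (b := Real.pi / 2) (by positivity))
  set C := (16 * Real.pi ^ 2 + 2 * Real.pi) *
    (2 * Real.exp ((4 * Real.pi + 1) + (4 * Real.pi + 1) ^ 2 / (2 * Real.pi))) with hC
  have hbound : ∀ z : Phase ι, ‖z‖ ≤ 1 →
      ‖coherent z - windowLp ι - coherentDeriv ι z‖ ≤ C * ‖Ψ‖ * ‖z‖ ^ 2 := by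
    intro z hz
    have : ‖coherent z - windowLp ι - coherentDeriv ι z‖ ≤ (C * ‖z‖ ^ 2) * ‖Ψ‖ := by
      refine Lp.norm_le_mul_norm_of_ae_le_mul ?_
      filter_upwards [Lp.coeFn_sub (coherent z - windowLp ι) (coherentDeriv ι z),
        Lp.coeFn_sub (coherent z) (windowLp ι), coe_tfShift z (windowLp ι),
        tfShiftFun_congr z (coe_toL2 (window ι)), coe_toL2 (window ι), coe_coherentDerivFun z,
        coe_toL2 (gaussian (E ι) (b := Real.pi / 2) (by positivity))]
        with t h1 h2 h3 h4 h5 h6 h7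
      rw [h1, Pi.sub_apply, h2, Pi.sub_apply, h7, coherentDeriv_apply, h6, coherent, h3,
        windowLp_eq_toL2, h4, h5, tfShiftFun_window, gaussian_apply, Complex.norm_real,
        Real.norm_of_nonneg (Real.exp_pos _).le]
      have e : ∀ a b c : ℂ, a * b - a - c * a = (b - 1 - c) * a := fun a b c => by ring
      rw [e, norm_mul]
      calc _ ≤ (16 * Real.pi ^ 2 + 2 * Real.pi) * ‖z‖ ^ 2 *
            ((1 + ‖t‖) ^ 2 * Real.exp (4 * Real.pi * (1 + ‖t‖))) * ‖window ι t‖ := by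
            gcongr; exact norm_coherent_remainder_le z hz t
        _ = (16 * Real.pi ^ 2 + 2 * Real.pi) * ‖z‖ ^ 2 *
            ((1 + ‖t‖) ^ 2 * Real.exp (4 * Real.pi * (1 + ‖t‖)) * ‖window ι t‖) := by ring
        _ ≤ (16 * Real.pi ^ 2 + 2 * Real.pi) * ‖z‖ ^ 2 * _ :=
            mul_le_mul_of_nonneg_left (sq_mul_exp_mul_window_le t) (by positivity)
        _ = _ := by rw [hC]; ring
    linarith
  have hO : (fun z : Phase ι => coherent z - windowLp ι - coherentDeriv ι z) =O[nhds 0]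
      fun z => ‖z - 0‖ ^ 2 := by
    refine Asymptotics.IsBigO.of_bound (C * ‖Ψ‖) ?_
    filter_upwards [Metric.closedBall_mem_nhds (0 : Phase ι) one_pos] with z hz
    rw [mem_closedBall_zero_iff] at hz
    rw [sub_zero, norm_pow, norm_norm]
    exact hbound z hz
  have h := hO.hasFDerivAt (𝕜 := ℝ) one_lt_two
  have h2 := (h.add (coherentDeriv ι).hasFDerivAt).add_const (windowLp ι)
  rw [zero_add] at h2
  refine h2.congr_of_eventuallyEq (Filter.Eventually.of_forall fun z => ?_)
  simp

theorem symp_differentiable (z : Phase ι) : Differentiable ℝ (symp z) := by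
  have : symp z = fun w => inner ℝ (rotJ z) w := funext (symp_eq_inner z)
  rw [this]; exact (innerSL ℝ (rotJ z)).differentiable

theorem hasDerivAt_cis (s : ℝ) : HasDerivAt cis (Complex.I * cis s) s := by
  have := ((hasDerivAt_id s).ofReal_comp.mul_const Complex.I).cexp
  unfold cis; simpa [mul_comm] using this

/-- The Weyl relation writes nearby states as ρ(z) applied to states near the origin, times a smooth
phase. -/
theorem differentiableAt_coherent (z : Phase ι) :
    DifferentiableAt ℝ (coherent : Phase ι → L2 ι) z := by
  have e : (coherent : Phase ι → L2 ι) = fun w =>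
      cis (-(Real.pi * symp z w)) • tfShiftₗᵢ z (coherent (w - z)) := by
    ext1 w
    rw [tfShiftₗᵢ_apply, coherent, coherent, tfShift_tfShift, smul_smul, ← cis_add,
      symp_sub_right, symp_self]
    simp
  rw [e]
  have h0 : DifferentiableAt ℝ (coherent : Phase ι → L2 ι) (z - z) := by
    rw [sub_self]; exact hasFDerivAt_coherent_zero.differentiableAt
  have h1 : DifferentiableAt ℝ (fun w : Phase ι => coherent (w - z)) z :=
    DifferentiableAt.comp z (g := coherent) (f := fun w => w - z) h0 (by fun_prop)
  have h2 : Differentiable ℝ fun f : L2 ι => tfShiftₗᵢ z f :=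
    (((tfShiftₗᵢ z).toContinuousLinearEquiv : L2 ι →L[ℂ] L2 ι).restrictScalars ℝ).differentiable
  have h3 : DifferentiableAt ℝ (fun w => cis (-(Real.pi * symp z w))) z :=
    (hasDerivAt_cis _).differentiableAt.comp z
      (((symp_differentiable z z).const_mul Real.pi).neg)
  exact h3.smul (h2.differentiableAt.comp z h1)

end Coherent

section Gronwall

/-! ### A Gronwall lemma for matrices with off-diagonal decay -/

variable {V : Type*} [NormedAddCommGroup V]

/-- Truncating the weight at R keeps it moderate with a constant that does not depend on R. This
permits a supremum argument before decay is known. -/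
theorem min_one_add_norm_pow_le (k : ℕ) (R : ℝ) (hR : 0 ≤ R) (v w y : V) :
    min ((1 + ‖v - w‖) ^ k) R ≤ (1 + ‖y - w‖) ^ k * min ((1 + ‖v - y‖) ^ k) R := by
  have h1 : 1 ≤ (1 + ‖y - w‖) ^ k := one_le_pow₀ (by linarith [norm_nonneg (y - w)])
  rw [mul_min_of_nonneg _ _ (by positivity)]
  refine min_le_min ?_ (le_mul_of_one_le_left hR h1)
  rw [← mul_pow]
  gcongr
  have : ‖v - w‖ ≤ ‖v - y‖ + ‖y - w‖ := norm_sub_le_norm_sub_add_norm_sub v y w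
  nlinarith [norm_nonneg (v - y), norm_nonneg (y - w),
    mul_nonneg (norm_nonneg (v - y)) (norm_nonneg (y - w))]

variable [MeasurableSpace V] [BorelSpace V]

/-- Take S, the supremum of e^{-2Kt} p(w)|g(t, w)| with p the truncated weight and K the weighted
mass of κ. Then p|g'| ≤ K S e^{2Kt}, whose time integral is at most (S/2)e^{2Kt}; hence S ≤ C₀ +
S/2. A priori finiteness of S needs only the crude bound A, which does not enter the conclusion. -/
theorem offdiagonal_gronwall {μ : Measure V} [μ.IsAddHaarMeasure] {g g' : ℝ → V → ℂ} {κ : V → ℝ}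
    {T A C₀ : ℝ} {k : ℕ} {v : V} (hκ0 : ∀ u, 0 ≤ κ u)
    (hκ : Integrable (fun u => (1 + ‖u‖) ^ k * κ u) μ) (hT : 0 ≤ T)
    (hg : ∀ t w, HasDerivAt (fun t => g t w) (g' t w) t)
    (hA : ∀ t ∈ Icc 0 T, ∀ w, ‖g t w‖ ≤ A)
    (h0 : ∀ w, (1 + ‖v - w‖) ^ k * ‖g 0 w‖ ≤ C₀)
    (hK : ∀ t ∈ Icc 0 T, ∀ w, ‖g' t w‖ ≤ ∫ y, ‖g t y‖ * κ (y - w) ∂μ) (w : V) :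
    (1 + ‖v - w‖) ^ k * ‖g T w‖ ≤
      2 * C₀ * Real.exp (2 * (∫ u, (1 + ‖u‖) ^ k * κ u ∂μ) * T) := by
  set K := ∫ u, (1 + ‖u‖) ^ k * κ u ∂μ with hKdef
  have hK0 : 0 ≤ K := integral_nonneg fun u => mul_nonneg (by positivity) (hκ0 u)
  -- The truncation level is the weight at the target point w, so nothing is lost there.
  set R := (1 + ‖v - w‖) ^ k with hR
  have hR1 : 0 < R := by positivity
  set p : V → ℝ := fun w => min ((1 + ‖v - w‖) ^ k) R with hp
  have hp0 : ∀ w, 0 < p w := fun w => lt_min (by positivity) hR1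
  set X : Set ℝ := (fun q : ℝ × V => Real.exp (-(2 * K * q.1)) * (p q.2 * ‖g q.1 q.2‖)) ''
    (Icc 0 T ×ˢ univ) with hX
  have hbdd : BddAbove X := by
    refine ⟨R * A, ?_⟩
    rintro _ ⟨⟨t, w⟩, ⟨ht, -⟩, rfl⟩
    have h1 : Real.exp (-(2 * K * t)) ≤ 1 := by
      rw [Real.exp_le_one_iff]; have := ht.1; have : 0 ≤ K * t := by positivity
      linarith
    have h2 : p w * ‖g t w‖ ≤ R * A := by
      gcongr
      · exact min_le_right _ _
      · exact hA t ht w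
    calc _ ≤ 1 * (p w * ‖g t w‖) :=
          mul_le_mul_of_nonneg_right h1 (mul_nonneg (hp0 w).le (norm_nonneg _))
      _ ≤ _ := by rwa [one_mul]
  have hne : X.Nonempty := ⟨_, ⟨(0, w), ⟨⟨le_rfl, hT⟩, mem_univ _⟩, rfl⟩⟩
  set S := sSup X with hS
  have hSle : ∀ t ∈ Icc 0 T, ∀ w, p w * ‖g t w‖ ≤ S * Real.exp (2 * K * t) := by
    intro t ht w
    have : Real.exp (-(2 * K * t)) * (p w * ‖g t w‖) ≤ S :=
      le_csSup hbdd ⟨(t, w), ⟨ht, mem_univ _⟩, rfl⟩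
    rw [Real.exp_neg] at this
    rwa [inv_mul_le_iff₀ (Real.exp_pos _), mul_comm (Real.exp _)] at this
  have hS0 : 0 ≤ S := by
    have := hSle 0 ⟨le_rfl, hT⟩ w
    rw [mul_zero, Real.exp_zero, mul_one] at this
    exact le_trans (mul_nonneg (hp0 w).le (norm_nonneg _)) this
  have hder : ∀ t ∈ Icc 0 T, ∀ w, p w * ‖g' t w‖ ≤ S * Real.exp (2 * K * t) * K := by
    intro t ht w
    have hi : Integrable (fun y => (1 + ‖y - w‖) ^ k * κ (y - w)) μ := hκ.comp_sub_right w
    calc p w * ‖g' t w‖ ≤ p w * ∫ y, ‖g t y‖ * κ (y - w) ∂μ :=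
          mul_le_mul_of_nonneg_left (hK t ht w) (hp0 w).le
      _ = ∫ y, p w * (‖g t y‖ * κ (y - w)) ∂μ := (integral_const_mul _ _).symm
      _ ≤ ∫ y, (S * Real.exp (2 * K * t)) * ((1 + ‖y - w‖) ^ k * κ (y - w)) ∂μ := by
          refine integral_mono_of_nonneg (Filter.Eventually.of_forall fun y => ?_)
            (hi.const_mul _) (Filter.Eventually.of_forall fun y => ?_)
          · exact mul_nonneg (hp0 w).le (mul_nonneg (norm_nonneg _) (hκ0 _))
          · have h1 := min_one_add_norm_pow_le k R hR1.le v w y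
            calc p w * (‖g t y‖ * κ (y - w))
                ≤ ((1 + ‖y - w‖) ^ k * p y) * (‖g t y‖ * κ (y - w)) :=
                  mul_le_mul_of_nonneg_right h1 (mul_nonneg (norm_nonneg _) (hκ0 _))
              _ = (p y * ‖g t y‖) * ((1 + ‖y - w‖) ^ k * κ (y - w)) := by ring
              _ ≤ _ := mul_le_mul_of_nonneg_right (hSle t ht y)
                  (mul_nonneg (by positivity) (hκ0 _))
      _ = _ := by
          rw [integral_const_mul, integral_sub_right_eq_self (fun y => (1 + ‖y‖) ^ k * κ y) w]
  have hC0 : 0 ≤ C₀ := le_trans (by positivity) (h0 w)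
  have hmain : ∀ t ∈ Icc 0 T, ∀ w, p w * ‖g t w‖ ≤ C₀ + S / 2 * Real.exp (2 * K * t) := by
    intro t ht w
    have hB : ∀ x, HasDerivAt (fun t => (C₀ + S / 2 * Real.exp (2 * K * t)) / p w)
        (S * Real.exp (2 * K * x) * K / p w) x := fun x => by
      have := ((((hasDerivAt_id x).const_mul (2 * K)).exp.const_mul (S / 2)).const_add C₀).div_const
        (p w)
      convert! this using 1
      simp; ring
    have := image_norm_le_of_norm_deriv_right_le_deriv_boundary (a := 0) (b := T)
      (f := fun t => g t w) (f' := fun t => g' t w)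
      (fun x _ => (hg x w).continuousAt.continuousWithinAt)
      (fun x _ => (hg x w).hasDerivWithinAt)
      (B := fun t => (C₀ + S / 2 * Real.exp (2 * K * t)) / p w) (by
        rw [le_div_iff₀ (hp0 w), mul_comm]
        refine le_trans (mul_le_mul_of_nonneg_right (min_le_left _ _) (norm_nonneg _))
          ((h0 w).trans ?_)
        have : 0 ≤ S / 2 * Real.exp (2 * K * 0) := by positivity
        linarith) hB
      (fun x hx => by
        rw [le_div_iff₀ (hp0 w), mul_comm]
        exact hder x ⟨hx.1, hx.2.le⟩ w) ht
    rwa [le_div_iff₀ (hp0 w), mul_comm] at this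
  have hSfin : S ≤ C₀ + S / 2 := by
    refine csSup_le hne ?_
    rintro _ ⟨⟨t, w⟩, ⟨ht, -⟩, rfl⟩
    have h1 := hmain t ht w
    have h2 : Real.exp (-(2 * K * t)) ≤ 1 := by
      rw [Real.exp_le_one_iff]; have := ht.1; have : 0 ≤ K * t := by positivity
      linarith
    calc _ ≤ Real.exp (-(2 * K * t)) * (C₀ + S / 2 * Real.exp (2 * K * t)) :=
          mul_le_mul_of_nonneg_left h1 (Real.exp_pos _).le
      _ = Real.exp (-(2 * K * t)) * C₀ + S / 2 * (Real.exp (-(2 * K * t)) *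
          Real.exp (2 * K * t)) := by ring
      _ ≤ 1 * C₀ + S / 2 * 1 := by
          rw [← Real.exp_add, neg_add_cancel, Real.exp_zero]; gcongr
      _ = _ := by ring
  have hfin := hSle T ⟨hT, le_rfl⟩ w
  have hpw : p w = R := min_self _
  rw [hpw] at hfin
  refine hfin.trans ?_
  gcongr
  linarith

end Gronwall

section Generator

variable {ι : Type} [Fintype ι]

/-! ### The generator acting on coherent states -/

theorem rotJ_add (z w : Phase ι) : rotJ (z + w) = rotJ z + rotJ w := by
  refine phase_ext ?_ ?_ <;> simp [add_comm]

theorem rotJ_smul (r : ℝ) (z : Phase ι) : rotJ (r • z) = r • rotJ z := by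
  refine phase_ext ?_ ?_ <;> simp

/-- `rotJ` as a continuous linear map. -/
def rotJL (ι : Type) [Fintype ι] : Phase ι →L[ℝ] Phase ι :=
  LinearMap.toContinuousLinearMap ⟨⟨rotJ, rotJ_add⟩, rotJ_smul⟩

theorem DerivBound.integrable_mul {k : ℕ} {M : ℝ} {s : Phase ι → ℂ} (h : DerivBound 0 k M s)
    (G : 𝓢(Phase ι, ℂ)) : Integrable fun u => s u * G u := by
  refine integrable_of_decay (h.1.continuous.mul G.continuous).aestronglyMeasurable fun N => ?_
  obtain ⟨C, hC, hG⟩ := SchwartzMap.exists_one_add_norm_pow_mul_le G (N + k)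
  have hM : 0 ≤ M := by
    have := (norm_nonneg _).trans (h.2 0 le_rfl 0)
    simpa using this
  refine ⟨M * C, fun x => ?_⟩
  have h1 := h.2 0 le_rfl x
  rw [norm_iteratedFDeriv_zero] at h1
  calc _ ≤ (1 + ‖x‖) ^ N * ((M * (1 + ‖x‖) ^ k) * ‖G x‖) := by rw [norm_mul]; gcongr
    _ = M * ((1 + ‖x‖) ^ (N + k) * ‖G x‖) := by rw [pow_add]; ring
    _ ≤ _ := by gcongr; exact hG x

theorem fourier_add_apply {f g : Phase ι → ℂ} (hf : Integrable f) (hg : Integrable g)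
    (ζ : Phase ι) : 𝓕 (fun u => f u + g u) ζ = 𝓕 f ζ + 𝓕 g ζ :=
  congrFun (VectorFourier.fourierIntegral_add (e := Real.fourierChar) (μ := volume)
    (L := innerₗ (Phase ι)) Real.continuous_fourierChar continuous_inner hf hg) ζ

theorem fourier_const_mul_apply (c : ℂ) (f : Phase ι → ℂ) (ζ : Phase ι) :
    𝓕 (fun u => c * f u) ζ = c * 𝓕 f ζ :=
  congrFun (VectorFourier.fourierIntegral_const_smul Real.fourierChar volume
    (innerₗ (Phase ι)) f c) ζ

theorem hasDerivAt_fourier_schwartz (G : 𝓢(Phase ι, ℂ)) {c : ℝ → Phase ι} {c' : Phase ι} {t : ℝ}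
    (hc : HasDerivAt c c' t) : HasDerivAt (fun t => 𝓕 (G : Phase ι → ℂ) (c t))
      (𝓕 (fun u => -(2 * Real.pi * Complex.I) * (inner ℝ u c' : ℝ) * G u) (c t)) t := by
  have h1 : Integrable fun v => ‖v‖ * ‖G v‖ := by simpa using G.integrable_pow_mul volume 1
  have h := (Real.hasFDerivAt_fourier G.integrable h1 (c t)).comp_hasDerivAt t hc
  have hi : Integrable (VectorFourier.fourierSMulRight (innerSL ℝ) (G : Phase ι → ℂ)) := by
    refine (h1.const_mul (2 * Real.pi * ‖innerSL (E := Phase ι) ℝ‖)).mono' ?_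
      (Filter.Eventually.of_forall fun v => ?_)
    · have hG := G.continuous
      have : Continuous fun v : Phase ι =>
          (ContinuousLinearMap.smulRightL ℝ (Phase ι) ℂ (innerSL ℝ v)) (G v) :=
        ((ContinuousLinearMap.smulRightL ℝ (Phase ι) ℂ).continuous.comp
          (innerSL ℝ).continuous).clm_apply hG
      exact (this.const_smul (-(2 * Real.pi * Complex.I))).aestronglyMeasurable
    · refine (VectorFourier.norm_fourierSMulRight_le _ _ _).trans (le_of_eq ?_); ring
  convert! h using 1
  rw [Real.fourier_continuousLinearMap_apply hi]
  have e : (fun u => -(2 * Real.pi * Complex.I) * (inner ℝ u c' : ℝ) * G u) =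
      fun u => VectorFourier.fourierSMulRight (innerSL ℝ) (G : Phase ι → ℂ) u c' := by
    ext u
    rw [VectorFourier.fourierSMulRight_apply, innerSL_apply_apply, Complex.real_smul, smul_eq_mul]
    ring
  rw [e]

/-- Moving the centre with velocity c' acts like i times the Weyl operator with affine symbol x ↦
⟨p, x - c/2⟩, where c' is 1/(2π) times the Hamiltonian direction of p. Evaluated at u + (v + c)/2
this symbol is ⟨p, u⟩ + ⟨p, v⟩/2. -/
theorem hasDerivAt_inner_coherent (v : Phase ι) {c : ℝ → Phase ι} {c' p : Phase ι} {t : ℝ}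
    (hc : HasDerivAt c c' t) (hp : ∀ u, 2 * Real.pi * symp c' u = inner ℝ p u) :
    HasDerivAt (fun t => inner ℂ (coherent v) (coherent (c t))) (cis (-(Real.pi * symp v (c t))) *
      (Complex.I * 𝓕 (fun u => ((inner ℝ p u + 1 / 2 * inner ℝ p v : ℝ) : ℂ) * wignerWindow ι u)
        (rotJ (v - c t)))) t := by
  have h1 : HasDerivAt (fun t => symp v (c t)) (symp v c') t := by
    have := ((innerSL ℝ (rotJ v)).hasFDerivAt (x := c t)).comp_hasDerivAt t hc
    simpa [Function.comp_def, ← symp_eq_inner] using this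
  have h2 : HasDerivAt (fun t => cis (-(Real.pi * symp v (c t)))) _ t :=
    (hasDerivAt_cis _).scomp t (h1.const_mul Real.pi).neg
  have h3 : HasDerivAt (fun t => rotJ (v - c t)) (rotJ (-c')) t := by
    have := ((rotJL ι).hasFDerivAt (x := v - c t)).comp_hasDerivAt t (hc.const_sub v)
    exact this
  have h4 := h2.mul (hasDerivAt_fourier_schwartz (wignerWindow ι) h3)
  have e : (fun t => inner ℂ (coherent v) (coherent (c t))) = fun t =>
      cis (-(Real.pi * symp v (c t))) * 𝓕 (wignerWindow ι : Phase ι → ℂ) (rotJ (v - c t)) :=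
    funext fun t => inner_coherent v (c t)
  rw [e]
  convert! h4 using 1
  have hq : ∀ q : Phase ι → ℝ, q.HasTemperateGrowth →
      Integrable fun u => (q u : ℂ) * wignerWindow ι u := fun q hq => by
    obtain ⟨k, M, -, h⟩ := exists_derivBound_ofReal hq 0
    exact h.integrable_mul _
  have i1 := hq (fun u => inner ℝ p u) (Function.hasTemperateGrowth_inner_right p)
  have i2 := hq (fun _ => 1 / 2 * inner ℝ p v) (.const _)
  have e1 : (fun u => ((inner ℝ p u + 1 / 2 * inner ℝ p v : ℝ) : ℂ) * wignerWindow ι u) =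
      fun u => (inner ℝ p u : ℂ) * wignerWindow ι u +
        ((1 / 2 * inner ℝ p v : ℝ) : ℂ) * wignerWindow ι u := by
    ext u; push_cast; ring
  have e2 : (fun u => -(2 * Real.pi * Complex.I) * (inner ℝ u (rotJ (-c')) : ℝ) *
      wignerWindow ι u) = fun u => Complex.I * ((inner ℝ p u : ℂ) * wignerWindow ι u) := by
    ext u
    rw [rotJ_neg, inner_neg_right, real_inner_comm, ← symp_eq_inner, ← hp u]
    push_cast; ring
  rw [e1, e2, fourier_add_apply i1 i2, fourier_const_mul_apply, fourier_const_mul_apply,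
    Complex.real_smul]
  have e3 : symp v c' = -(1 / (2 * Real.pi)) * inner ℝ p v := by
    rw [← hp, symp_swap v]; field_simp
  rw [e3]
  have : -(Real.pi * (-(1 / (2 * Real.pi)) * inner ℝ p v)) = 1 / 2 * inner ℝ p v := by
    field_simp
  rw [this]
  ring

variable [DecidableEq ι]

theorem hasDerivAt_act_flow (Q : Matrix (ι ⊕ ι) (ι ⊕ ι) ℝ) (w : Phase ι) (t : ℝ) :
    HasDerivAt (fun t => act (flow Q t) w)
      (-(1 / (2 * Real.pi)) • rotJ (act Q (act (flow Q t) w))) t := by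
  let _ : SeminormedRing (Matrix (ι ⊕ ι) (ι ⊕ ι) ℝ) := Matrix.linftyOpSemiNormedRing
  let _ : NormedRing (Matrix (ι ⊕ ι) (ι ⊕ ι) ℝ) := Matrix.linftyOpNormedRing
  let _ : NormedAlgebra ℝ (Matrix (ι ⊕ ι) (ι ⊕ ι) ℝ) := Matrix.linftyOpNormedAlgebra
  set X := (-(1 / (2 * Real.pi))) • (matJ ι * Q) with hX
  have e : ∀ t, flow Q t = NormedSpace.exp (t • X) := fun t => by
    rw [flow, hX, smul_smul, matJ]; congr 2; ring
  have h := hasDerivAt_exp_smul_const' (𝕂 := ℝ) X t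
  set L : Matrix (ι ⊕ ι) (ι ⊕ ι) ℝ →L[ℝ] Phase ι := LinearMap.toContinuousLinearMap
    ⟨⟨fun M => act M w, fun M N => act_add_left M N w⟩, fun r M => act_smul_left r M w⟩
  have h2 := (L.hasFDerivAt (x := NormedSpace.exp (t • X))).comp_hasDerivAt t h
  have h3 : HasDerivAt (fun t => act (NormedSpace.exp (t • X)) w)
    (act (X * NormedSpace.exp (t • X)) w) t := h2
  simp only [e]
  convert! h3 using 1
  rw [act_mul, hX, act_smul_left, act_mul, act_matJ]

theorem continuous_act_flow (Q : Matrix (ι ⊕ ι) (ι ⊕ ι) ℝ) (w : Phase ι) :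
    Continuous fun t => act (flow Q t) w :=
  continuous_iff_continuousAt.2 fun t => (hasDerivAt_act_flow Q w t).continuousAt

/-- The defect of the classical flow from being generated by the Weyl operator is a matrix with
off-diagonal decay. -/
theorem exists_generator_decay {Q : Matrix (ι ⊕ ι) (ι ⊕ ι) ℝ} (hQ : Q.IsSymm) {σ : Phase ι → ℂ}
    (hσ : IsSymbol σ) (N : ℕ) : ∃ B, 0 ≤ B ∧ ∀ (z : Phase ι) (D h : L2 ι),
      HasDerivAt (fun t => coherent (act (flow Q t) z)) D 0 →
      IsWeylOp (fun z => ((1 / 2 * quad Q z : ℝ) : ℂ) + σ z) (shiftSchwartz z (window ι)) h →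
      ∀ v, (1 + ‖v - z‖) ^ N * ‖inner ℂ (coherent v) (D - Complex.I • h)‖ ≤ B := by
  -- The two extra orders absorb the factor (1 + |δ|)² in the symbol bounds.
  obtain ⟨k, C, hC, hsym⟩ := exists_derivBound_symbol Q hσ.1 hσ.2 (N + 2)
  obtain ⟨B, hB, hdec⟩ := exists_fourier_mul_decay (wignerWindow ι) (N + 2) k
  refine ⟨B * C, by positivity, fun z D h hD hh v => ?_⟩
  set δ := v - z with hδ
  set m := (1 / 2 : ℝ) • (v + z) with hm
  set T : Phase ι → ℂ := fun u => ((1 / 2 * quad Q (u + (1 / 2 : ℝ) • δ) : ℝ) : ℂ) + σ (u + m)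
    with hT
  set A : Phase ι → ℂ := fun u => ((inner ℝ (act Q z) u + 1 / 2 * inner ℝ (act Q z) v : ℝ) : ℂ)
    with hA
  have hTb := hsym δ m
  have iT : Integrable fun u => T u * wignerWindow ι u :=
    DerivBound.integrable_mul ⟨hTb.1, fun j hj => hTb.2 j (hj.trans (Nat.zero_le _))⟩ _
  have iA : Integrable fun u => A u * wignerWindow ι u := by
    obtain ⟨k, M, -, h⟩ := exists_derivBound_ofReal
      (q := fun u => inner ℝ (act Q z) u + 1 / 2 * inner ℝ (act Q z) v)
      ((Function.hasTemperateGrowth_inner_right _).add (.const _)) 0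
    exact h.integrable_mul _
  have h0 : act (flow Q 0) z = z := by rw [flow_zero, act_one]
  have hD1 : HasDerivAt (fun t => inner ℂ (coherent v) (coherent (act (flow Q t) z)))
      (inner ℂ (coherent v) D) 0 := by
    have := (((innerSL ℂ (coherent v)).restrictScalars ℝ).hasFDerivAt
      (x := coherent (act (flow Q 0) z))).comp_hasDerivAt 0 hD
    exact this
  have hD2 := hasDerivAt_inner_coherent v (hasDerivAt_act_flow Q z 0) (p := act Q z) (fun u => by
    rw [h0, symp_smul_left, symp_eq_inner, rotJ_rotJ, inner_neg_left]; field_simp)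
  rw [h0] at hD2
  have e1 := hD1.unique hD2
  have e2 := inner_coherent_weyl hh v
  -- The Taylor identity a(x) = ⟨Qz, x - z/2⟩ + a(x - z) at x = u + (v + z)/2. Its affine part A is
  -- cancelled by the motion of the centre; the rest T depends on the base point only through δ and
  -- the bounded σ.
  have e3 : (fun u => (((1 / 2 * quad Q (u + (1 / 2 : ℝ) • (v + z)) : ℝ) : ℂ) +
      σ (u + (1 / 2 : ℝ) • (v + z))) * wignerWindow ι u) =
      fun u => A u * wignerWindow ι u + T u * wignerWindow ι u := by
    ext u
    rw [← add_mul]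
    congr 1
    rw [hA, hT, ← add_assoc, ← Complex.ofReal_add]
    congr 2
    have hs : ∀ a b : Phase ι, inner ℝ a (act Q b) = inner ℝ (act Q a) b := fun a b => by
      rw [inner_act, hQ]
    have em : u + (1 / 2 : ℝ) • (v + z) = (u + (1 / 2 : ℝ) • δ) + z := by rw [hδ]; module
    have ev : v = z + δ := by rw [hδ]; module
    rw [em, ev]
    simp only [quad_eq_inner, act_add_right, act_smul_right, inner_add_left, inner_add_right,
      real_inner_smul_left, real_inner_smul_right, hs]
    have sw : ∀ a b : Phase ι, inner ℝ (act Q a) b = inner ℝ (act Q b) a := fun a b => by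
      rw [← hs, real_inner_comm]
    rw [sw u z, sw δ z]
    ring
  have e4 : inner ℂ (coherent v) (D - Complex.I • h) = cis (-(Real.pi * symp v z)) *
      (-Complex.I * 𝓕 (fun u => T u * wignerWindow ι u) (rotJ δ)) := by
    rw [inner_sub_right, inner_smul_right, e1, e2, e3, fourier_add_apply iA iT]
    ring
  rw [e4, norm_mul, norm_cis, one_mul, norm_mul, norm_neg, Complex.norm_I, one_mul]
  have h5 := hdec T _ (by positivity) hTb (rotJ δ)
  rw [norm_rotJ, pow_add] at h5
  have hpos : 0 < (1 + ‖δ‖) ^ 2 := by positivity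
  refine le_of_mul_le_mul_right ?_ hpos
  linarith

end Generator

section Evolution

variable {ι : Type} [Fintype ι]

/-! ### Gabor matrix of the propagator -/

/-- The Gabor matrix of `T` decays rapidly off the graph of `M`. -/
def GaborDecay (T : L2 ι →L[ℂ] L2 ι) (M : Matrix (ι ⊕ ι) (ι ⊕ ι) ℝ) : Prop :=
  ∀ N : ℕ, ∃ C, 0 ≤ C ∧ ∀ v z : Phase ι,
    (1 + ‖v - act M z‖) ^ N * ‖inner ℂ (coherent v) (T (coherent z))‖ ≤ C

theorem norm_coherent (z : Phase ι) : ‖coherent z‖ = ‖windowLp ι‖ := norm_tfShift _ _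

theorem continuous_coherent : Continuous (coherent : Phase ι → L2 ι) :=
  continuous_iff_continuousAt.2 fun z => (differentiableAt_coherent z).continuousAt

theorem inner_coherent_decay (N : ℕ) : ∃ C, 0 ≤ C ∧ ∀ v w : Phase ι,
    (1 + ‖v - w‖) ^ N * ‖inner ℂ (coherent v) (coherent w)‖ ≤ C := by
  obtain ⟨C, hC, h⟩ := ambig_toLp_decay (window ι) (window ι) N
  refine ⟨C, hC, fun v w => ?_⟩
  rw [inner_coherent, norm_mul, norm_cis, one_mul, ← wigner_window, fourier_wigner, rotJ_rotJ,
    neg_neg]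
  exact h (v - w)

theorem isPropagator_neg {s : Phase ι → ℂ} {U : ℝ → L2 ι →L[ℂ] L2 ι} (hU : IsPropagator s U) :
    IsPropagator (fun z => -s z) (fun t => U (-t)) where
  zero := by rw [neg_zero, hU.zero]
  add t₁ t₂ := by rw [neg_add, hU.add]
  continuous f := (hU.continuous f).comp continuous_neg
  generator f := by
    obtain ⟨h, hh, hd⟩ := hU.generator f
    refine ⟨-h, fun g => ?_, ?_⟩
    · rw [inner_neg_right, hh g, ← integral_neg]
      simp only [neg_mul]
    · rw [← neg_zero] at hd
      have := hd.scomp (0 : ℝ) (hasDerivAt_neg (0 : ℝ))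
      rw [smul_neg, ← neg_one_smul ℝ (Complex.I • h)]
      exact this

/-- The group need not be unitary, as the symbol may be complex. Local boundedness comes from strong
continuity and the uniform boundedness principle. -/
theorem IsPropagator.exists_norm_le {s : Phase ι → ℂ} {U : ℝ → L2 ι →L[ℂ] L2 ι}
    (hU : IsPropagator s U) (T : ℝ) : ∃ C, ∀ t ∈ Icc (-T) T, ‖U t‖ ≤ C := by
  obtain ⟨C, hC⟩ := banach_steinhaus (g := fun t : Icc (-T) T => U t) fun f => by
    obtain ⟨C, hC⟩ := isCompact_Icc.exists_bound_of_continuousOn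
      (hU.continuous f).continuousOn (s := Icc (-T) T)
    exact ⟨C, fun t => hC t t.2⟩
  exact ⟨C, fun t ht => hC ⟨t, ht⟩⟩

/-- Product rule at the origin for a strongly continuous group acting on a differentiable curve. -/
theorem IsPropagator.hasDerivAt_neg_apply {s : Phase ι → ℂ} {U : ℝ → L2 ι →L[ℂ] L2 ι}
    (hU : IsPropagator s U) {c : ℝ → L2 ι} {D h : L2 ι} (hc : HasDerivAt c D 0)
    (hh : HasDerivAt (fun t => U t (c 0)) h 0) :
    HasDerivAt (fun t => U (-t) (c t)) (D - h) 0 := by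
  obtain ⟨C, hC⟩ := hU.exists_norm_le 1
  have h1 : HasDerivAt (fun t => U (-t) (c 0)) (-h) 0 := by
    have hh' : HasDerivAt (fun t => U t (c 0)) h (-0) := by rwa [neg_zero]
    have := hh'.scomp (0 : ℝ) (hasDerivAt_neg (0 : ℝ))
    rw [← neg_one_smul ℝ h]
    exact this
  have h2 : HasDerivAt (fun t => U (-t) (c t - c 0)) D 0 := by
    rw [hasDerivAt_iff_tendsto_slope_zero] at hc ⊢
    have hc' : Filter.Tendsto (fun t : ℝ => t⁻¹ • (c t - c 0) - D) (nhdsWithin 0 {0}ᶜ) (nhds 0) := by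
      have := hc.sub_const D
      simpa using this
    have hz : Filter.Tendsto (fun t : ℝ => U (-t) (t⁻¹ • (c t - c 0) - D)) (nhdsWithin 0 {0}ᶜ)
        (nhds 0) := by
      rw [tendsto_zero_iff_norm_tendsto_zero] at hc' ⊢
      have hb := hc'.const_mul C
      rw [mul_zero] at hb
      refine squeeze_zero' (Filter.Eventually.of_forall fun t => norm_nonneg _) ?_ hb
      filter_upwards [mem_nhdsWithin_of_mem_nhds (Icc_mem_nhds (show (-1 : ℝ) < 0 by norm_num)
        (show (0 : ℝ) < 1 by norm_num))] with t ht
      refine ((U (-t)).le_opNorm _).trans ?_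
      gcongr
      exact hC (-t) ⟨by linarith [ht.2], by linarith [ht.1]⟩
    have hD : Filter.Tendsto (fun t : ℝ => U (-t) D) (nhdsWithin 0 {0}ᶜ) (nhds D) := by
      have := ((hU.continuous D).comp continuous_neg).tendsto 0
      simp only [Function.comp_apply, neg_zero, hU.zero, ContinuousLinearMap.id_apply] at this
      exact this.mono_left nhdsWithin_le_nhds
    have := hz.add hD
    rw [zero_add] at this
    refine this.congr fun t => ?_
    simp only [zero_add, sub_self, map_zero, sub_zero, map_sub, sub_add_cancel]
    rw [ContinuousLinearMap.map_smul_of_tower, map_sub]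
  have h3 := h2.add h1
  rw [← sub_eq_add_neg] at h3
  refine h3.congr_of_eventuallyEq (Filter.Eventually.of_forall fun t => ?_)
  simp

variable [DecidableEq ι]

theorem exists_norm_act_flow_le (Q : Matrix (ι ⊕ ι) (ι ⊕ ι) ℝ) (T : ℝ) :
    ∃ m, 1 ≤ m ∧ ∀ t ∈ Icc (-T) T, ∀ z : Phase ι, ‖act (flow Q t) z‖ ≤ m * ‖z‖ := by
  obtain ⟨C, hC⟩ := banach_steinhaus (g := fun t : Icc (-T) T => actL (flow Q t)) fun f => by
    obtain ⟨C, hC⟩ := isCompact_Icc.exists_bound_of_continuousOn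
      (continuous_act_flow Q f).continuousOn (s := Icc (-T) T)
    exact ⟨C, fun t => hC t t.2⟩
  refine ⟨max C 1, le_max_right _ _, fun t ht z => ?_⟩
  refine ((actL (flow Q t)).le_opNorm z).trans ?_
  gcongr
  exact (hC ⟨t, ht⟩).trans (le_max_left _ _)

/-- The time derivative of ⟨ρ(v)φ, U(-t)ρ(χ_t w)φ⟩ is a matrix element of U(-t) against the defect
of the generator, and the resolution of the identity expresses it through the same quantity at other
points w. At t = 0 it is the rapidly decaying overlap of coherent states, so the Gronwall lemma
closes the estimate. -/
theorem IsPropagator.gaborDecay_neg {Q : Matrix (ι ⊕ ι) (ι ⊕ ι) ℝ} (hQ : Q.IsSymm)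
    {σ : Phase ι → ℂ} (hσ : IsSymbol σ) {U : ℝ → L2 ι →L[ℂ] L2 ι}
    (hU : IsPropagator (fun z => ((1 / 2 * quad Q z : ℝ) : ℂ) + σ z) U) {T : ℝ} (hT : 0 ≤ T) :
    GaborDecay (U (-T)) (flow Q (-T)) := by
  have hdiff : ∀ z : Phase ι, DifferentiableAt ℝ (fun t => coherent (act (flow Q t) z)) 0 :=
    fun z => DifferentiableAt.comp (0 : ℝ) (g := coherent) (f := fun t => act (flow Q t) z)
      (differentiableAt_coherent _) (hasDerivAt_act_flow Q z 0).differentiableAt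
  choose H hH hH' using fun z : Phase ι => hU.generator (shiftSchwartz z (window ι))
  set D : Phase ι → L2 ι := fun z => deriv (fun t => coherent (act (flow Q t) z)) 0 with hD
  set κ : Phase ι → L2 ι := fun z => D z - Complex.I • H z with hκ
  have hder0 : ∀ z, HasDerivAt (fun t => U (-t) (coherent (act (flow Q t) z))) (κ z) 0 := fun z => by
    refine hU.hasDerivAt_neg_apply (hdiff z).hasDerivAt ?_
    have := hH' z
    rw [toLp_shiftSchwartz] at this
    rw [flow_zero, act_one]
    exact this
  -- The group laws of U and of the flow reduce the derivative at time t to the one at time 0, at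
  -- the point χ_t z.
  have hder : ∀ t z, HasDerivAt (fun t => U (-t) (coherent (act (flow Q t) z)))
      (U (-t) (κ (act (flow Q t) z))) t := fun t z => by
    have h1 := hder0 (act (flow Q t) z)
    rw [← sub_self t] at h1
    have h2 := HasDerivAt.scomp (h := fun r => r - t) t h1 ((hasDerivAt_id t).sub_const t)
    rw [one_smul] at h2
    have h3 := ((U (-t)).restrictScalars ℝ).hasFDerivAt.comp_hasDerivAt t h2
    refine HasDerivAt.congr_of_eventuallyEq (f := fun r => U (-t) (U (-(r - t))
      (coherent (act (flow Q (r - t)) (act (flow Q t) z))))) h3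
      (Filter.Eventually.of_forall fun r => ?_)
    change U (-r) (coherent (act (flow Q r) z)) =
      U (-t) (U (-(r - t)) (coherent (act (flow Q (r - t)) (act (flow Q t) z))))
    rw [← act_mul, ← flow_add, sub_add_cancel, ← ContinuousLinearMap.comp_apply, ← hU.add]
    congr 2; ring
  obtain ⟨CU, hCU⟩ := hU.exists_norm_le T
  obtain ⟨m, hm1, hm⟩ := exists_norm_act_flow_le Q T
  obtain ⟨K, hK⟩ := exists_integrable_one_add_norm_inv_pow (Phase ι) volume
  intro k
  obtain ⟨B, hB, hdec⟩ := exists_generator_decay hQ hσ (k + K)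
  obtain ⟨C₀, hC₀, h0⟩ := inner_coherent_decay (ι := ι) k
  have hφ : 0 < ‖windowLp ι‖ := norm_pos_iff.2 windowLp_ne_zero
  set c := (‖windowLp ι‖ ^ 2)⁻¹ * (m ^ (k + K) * B) with hc
  have hc0 : 0 ≤ c := by positivity
  set q : Phase ι → ℝ := fun u => c * ((1 + ‖u‖) ^ (k + K))⁻¹ with hq
  have hq0 : ∀ u, 0 ≤ q u := fun u => by positivity
  have hqi : Integrable q := (hK (k + K) (Nat.le_add_left _ _)).const_mul c
  have hqk : Integrable fun u => (1 + ‖u‖) ^ k * q u := by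
    refine ((hK K le_rfl).const_mul c).congr (Filter.Eventually.of_forall fun u => ?_)
    simp only [hq]
    rw [pow_add, mul_inv]
    field_simp
  refine ⟨2 * C₀ * Real.exp (2 * (∫ u : Phase ι, (1 + ‖u‖) ^ k * q u) * T), by positivity,
    fun v z => ?_⟩
  set g : ℝ → Phase ι → ℂ := fun t w => inner ℂ (coherent v) (U (-t) (coherent (act (flow Q t) w)))
    with hg
  have hA : ∀ t ∈ Icc 0 T, ∀ w, ‖g t w‖ ≤ ‖windowLp ι‖ * (CU * ‖windowLp ι‖) := by
    intro t ht w
    refine (norm_inner_le_norm _ _).trans ?_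
    rw [norm_coherent]
    gcongr
    refine ((U (-t)).le_opNorm _).trans ?_
    rw [norm_coherent]
    gcongr
    exact hCU (-t) ⟨by linarith [ht.2], by linarith [ht.1]⟩
  have hgc : ∀ t, Continuous (g t) := fun t => by
    have h1 := (U (-t)).continuous.comp (continuous_coherent.comp (continuous_act (flow Q t)))
    exact continuous_const.inner h1
  have key := offdiagonal_gronwall (μ := volume) (g := g)
    (g' := fun t w => inner ℂ (coherent v) (U (-t) (κ (act (flow Q t) w)))) (κ := q) (T := T)
    (C₀ := C₀) (k := k) (v := v) hq0 hqk hT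
    (fun t w => ((innerSL ℂ (coherent v)).restrictScalars ℝ).hasFDerivAt.comp_hasDerivAt t
      (hder t w)) hA
    (fun w => by
      simp only [hg, neg_zero, hU.zero, flow_zero, act_one, ContinuousLinearMap.id_apply]
      exact h0 v w)
    (fun t ht w => by
      set f := ContinuousLinearMap.adjoint (U (-t)) (coherent v) with hf
      have e1 : inner ℂ (coherent v) (U (-t) (κ (act (flow Q t) w))) =
          ((‖windowLp ι‖ ^ 2 : ℝ) : ℂ)⁻¹ * ∫ y, conj (ambig f (windowLp ι) y) *
            ambig (κ (act (flow Q t) w)) (windowLp ι) y := by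
        rw [← inner_eq_integral_ambig, hf, ContinuousLinearMap.adjoint_inner_left, ← mul_assoc,
          inv_mul_cancel₀ (by exact_mod_cast (pow_pos hφ 2).ne'), one_mul]
      -- Substituting y ↦ χ_t y, which preserves volume, makes the first factor equal to |g(t, y)|
      -- and the kernel a function of χ_t(y - w).
      rw [e1, ← integral_act (abs_det_flow hQ t), norm_mul, norm_inv, Complex.norm_real,
        Real.norm_of_nonneg (by positivity)]
      have hi : Integrable fun y => ‖g t y‖ * q (y - w) := by
        refine ((hqi.comp_sub_right w).const_mul (‖windowLp ι‖ * (CU * ‖windowLp ι‖))).mono'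
          (((hgc t).norm.aestronglyMeasurable).mul (hqi.comp_sub_right w).1)
          (Filter.Eventually.of_forall fun y => ?_)
        rw [norm_mul, norm_norm, Real.norm_of_nonneg (hq0 _)]
        exact mul_le_mul_of_nonneg_right (hA t ht y) (hq0 _)
      rw [inv_mul_le_iff₀ (by positivity), ← integral_const_mul]
      refine (norm_integral_le_integral_norm _).trans (integral_mono_of_nonneg
        (Filter.Eventually.of_forall fun y => norm_nonneg _) (hi.const_mul _)
        (Filter.Eventually.of_forall fun y => ?_))
      have e2 : ‖ambig f (windowLp ι) (act (flow Q t) y)‖ = ‖g t y‖ := by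
        rw [ambig, hf, ContinuousLinearMap.adjoint_inner_right, ← norm_inner_symm]; rfl
      have e3 : ‖ambig (κ (act (flow Q t) w)) (windowLp ι) (act (flow Q t) y)‖ ≤
          m ^ (k + K) * B * ((1 + ‖y - w‖) ^ (k + K))⁻¹ := by
        rw [← div_eq_mul_inv, le_div_iff₀ (by positivity)]
        have h1 := hdec (act (flow Q t) w) (D (act (flow Q t) w)) (H (act (flow Q t) w))
          (hdiff _).hasDerivAt (hH _) (act (flow Q t) y)
        rw [← act_sub_right] at h1
        -- The inverse flow is bounded by m uniformly on the time interval, so decay in χ_t(y - w)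
        -- is decay in y - w.
        have h2 : 1 + ‖y - w‖ ≤ m * (1 + ‖act (flow Q t) (y - w)‖) := by
          have := hm (-t) ⟨by linarith [ht.2], by linarith [ht.1]⟩ (act (flow Q t) (y - w))
          rw [← act_mul, flow_neg_mul_flow, act_one] at this
          linarith
        calc _ ≤ ‖ambig (κ (act (flow Q t) w)) (windowLp ι) (act (flow Q t) y)‖ *
              (m * (1 + ‖act (flow Q t) (y - w)‖)) ^ (k + K) := by gcongr
          _ = m ^ (k + K) * ((1 + ‖act (flow Q t) (y - w)‖) ^ (k + K) *
              ‖ambig (κ (act (flow Q t) w)) (windowLp ι) (act (flow Q t) y)‖) := by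
              rw [mul_pow]; ring
          _ ≤ _ := mul_le_mul_of_nonneg_left h1 (by positivity)
      simp only [norm_mul, RCLike.norm_conj, e2]
      calc _ ≤ ‖g t y‖ * (m ^ (k + K) * B * ((1 + ‖y - w‖) ^ (k + K))⁻¹) := by gcongr
        _ = _ := by
          simp only [hq, hc]
          field_simp)
    -- At w = χ_{-T}z the moving centre arrives at z at time T.
    (act (flow Q (-T)) z)
  simp only [hg, ← act_mul, flow_mul_flow_neg, act_one] at key
  exact key

/-- Positive times reduce to the previous case for the reversed group, which belongs to -Q and -σ.
-/
theorem IsPropagator.gaborDecay {Q : Matrix (ι ⊕ ι) (ι ⊕ ι) ℝ} (hQ : Q.IsSymm)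
    {σ : Phase ι → ℂ} (hσ : IsSymbol σ) {U : ℝ → L2 ι →L[ℂ] L2 ι}
    (hU : IsPropagator (fun z => ((1 / 2 * quad Q z : ℝ) : ℂ) + σ z) U) (t : ℝ) :
    GaborDecay (U t) (flow Q t) := by
  rcases le_total t 0 with ht | ht
  · have := hU.gaborDecay_neg hQ hσ (T := -t) (by linarith)
    rwa [neg_neg] at this
  · have h1 : IsPropagator (fun z => ((1 / 2 * quad (-Q) z : ℝ) : ℂ) + (-σ) z)
        (fun t => U (-t)) := by
      have := isPropagator_neg hU
      convert! this using 2 with z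
      rw [quad_eq_inner, quad_eq_inner, act_neg_left, inner_neg_right, Pi.neg_apply]
      push_cast; ring
    have hσ' : IsSymbol (-σ) := by
      refine ⟨hσ.1.neg, fun k => ?_⟩
      obtain ⟨C, hC⟩ := hσ.2 k
      refine ⟨C, fun z => ?_⟩
      rw [iteratedFDeriv_neg_apply, norm_neg]; exact hC z
    have := h1.gaborDecay_neg (Q := -Q) (by rw [IsSymm, transpose_neg, hQ]) hσ' ht
    rwa [neg_neg, flow_neg_matrix, neg_neg] at this

end Evolution

section Weights

/-! ### Moderate weights and the ambiguity function -/

variable {V : Type*} [NormedAddCommGroup V]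

/-- Continuous weights `m ≥ 1` with `m(x) ≤ L (1 + |x - y|)^n m(y)`. -/
structure IsModerate (n : ℕ) (L : ℝ) (m : V → ℝ) : Prop where
  continuous : Continuous m
  one_le : ∀ x, 1 ≤ m x
  le_mul : ∀ x y, m x ≤ L * (1 + ‖x - y‖) ^ n * m y

theorem IsModerate.pos {n : ℕ} {L : ℝ} {m : V → ℝ} (h : IsModerate n L m) : 0 < L := by
  have h1 := h.le_mul 0 0
  have h2 := h.one_le 0
  simp only [sub_self, norm_zero, add_zero, one_pow, mul_one] at h1
  nlinarith

variable {ι : Type} [Fintype ι]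

theorem lintegral_mul_translate {a b : E ι → ℝ≥0∞} (ha : Measurable a) (hb : Measurable b) :
    ∫⁻ x : E ι, ∫⁻ t : E ι, a t * b (t - x) = (∫⁻ t, a t) * ∫⁻ s, b s := by
  rw [lintegral_lintegral_swap]
  · have h : ∀ t : E ι, ∫⁻ x : E ι, a t * b (t - x) = a t * ∫⁻ s, b s := fun t => by
      have hm : Measurable fun x : E ι => b (t - x) := hb.comp (by fun_prop)
      rw [lintegral_const_mul _ hm, lintegral_sub_left_eq_self b t]
    simp_rw [h]
    rw [lintegral_mul_const _ ha]
  · have h1 : Measurable fun p : E ι × E ι => a p.2 := ha.comp measurable_snd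
    have h2 : Measurable fun p : E ι × E ι => b (p.2 - p.1) := hb.comp (by fun_prop)
    exact (h1.mul h2).aemeasurable

theorem measurable_ofReal_pow {m : V → ℝ} [MeasurableSpace V] [BorelSpace V] (hm : Continuous m) :
    Measurable fun x => ENNReal.ofReal (m x) ^ 2 :=
  (ENNReal.measurable_ofReal.comp hm.measurable).pow_const 2

/-- After Plancherel in frequency the integral is that of a correlation of |F|² with |Φ|².
Moderateness transfers the weight to F at the cost of a polynomial weight on Φ. -/
theorem lintegral_weight_ambig_lt_top {n : ℕ} {L : ℝ} {m : E ι → ℝ} (hm : IsModerate n L m)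
    {F Φ : L2 ι} (hΦ : ∫⁻ s : E ι, ENNReal.ofReal (L * (1 + ‖s‖) ^ n) ^ 2 * ‖Φ s‖ₑ ^ 2 < ⊤)
    (hF : ∫⁻ t : E ι, ENNReal.ofReal (m t) ^ 2 * ‖F t‖ₑ ^ 2 < ⊤) :
    ∫⁻ w : Phase ι, ENNReal.ofReal (m (fstPart w)) ^ 2 * ‖ambig F Φ w‖ₑ ^ 2 < ⊤ := by
  have hL := hm.pos
  have mF := (Lp.stronglyMeasurable F).measurable
  have mΦ := (Lp.stronglyMeasurable Φ).measurable
  rw [lintegral_weight_ambig_sq F Φ (measurable_ofReal_pow hm.continuous)]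
  have hc : Continuous fun s : E ι => L * (1 + ‖s‖) ^ n := by fun_prop
  refine lt_of_le_of_lt ?_ ((lintegral_mul_translate ((measurable_ofReal_pow hm.continuous).mul
    (mF.enorm.pow_const 2)) ((measurable_ofReal_pow hc).mul (mΦ.enorm.pow_const 2))).trans_lt
      (ENNReal.mul_lt_top hF hΦ))
  refine lintegral_mono fun x => ?_
  rw [← lintegral_const_mul]
  swap
  · have h1 : Measurable fun t : E ι => ‖Φ (t - x)‖ₑ := (mΦ.comp (by fun_prop)).enorm
    exact (mF.enorm.pow_const 2).mul (h1.pow_const 2)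
  refine lintegral_mono fun t => ?_
  have h1 : ENNReal.ofReal (m x) ^ 2 ≤
      ENNReal.ofReal (L * (1 + ‖t - x‖) ^ n) ^ 2 * ENNReal.ofReal (m t) ^ 2 := by
    rw [← mul_pow, ← ENNReal.ofReal_mul (by positivity)]
    gcongr
    rw [← norm_sub_rev]
    exact hm.le_mul x t
  calc _ ≤ (ENNReal.ofReal (L * (1 + ‖t - x‖) ^ n) ^ 2 * ENNReal.ofReal (m t) ^ 2) *
        (‖F t‖ₑ ^ 2 * ‖Φ (t - x)‖ₑ ^ 2) := by gcongr
    _ = _ := by simp only [Pi.mul_apply]; ring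

/-- Moderateness in the other direction bounds the weight at x below by that at t, divided by a
polynomial weight on Φ. The remaining Φ-integral is nonzero and can be cancelled. -/
theorem lintegral_weight_lt_top_of_ambig {n : ℕ} {L : ℝ} {m : E ι → ℝ} (hm : IsModerate n L m)
    {F Φ : L2 ι} (hΦ : Φ ≠ 0)
    (h : ∫⁻ w : Phase ι, ENNReal.ofReal (m (fstPart w)) ^ 2 * ‖ambig F Φ w‖ₑ ^ 2 < ⊤) :
    ∫⁻ t : E ι, ENNReal.ofReal (m t) ^ 2 * ‖F t‖ₑ ^ 2 < ⊤ := by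
  have hL := hm.pos
  have mF := (Lp.stronglyMeasurable F).measurable
  have mΦ := (Lp.stronglyMeasurable Φ).measurable
  rw [lintegral_weight_ambig_sq F Φ (measurable_ofReal_pow hm.continuous)] at h
  have hc : Continuous fun s : E ι => L * (1 + ‖s‖) ^ n := by fun_prop
  have hb : Measurable fun s : E ι => (ENNReal.ofReal (L * (1 + ‖s‖) ^ n) ^ 2)⁻¹ * ‖Φ s‖ₑ ^ 2 :=
    (measurable_ofReal_pow hc).inv.mul (mΦ.enorm.pow_const 2)
  have hpos : ∀ s : E ι, ENNReal.ofReal (L * (1 + ‖s‖) ^ n) ≠ 0 := fun s => by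
    rw [Ne, ENNReal.ofReal_eq_zero, not_le]; positivity
  have key := lintegral_mul_translate ((measurable_ofReal_pow hm.continuous).mul
    (mF.enorm.pow_const 2)) hb
  have hfin : (∫⁻ t : E ι, ENNReal.ofReal (m t) ^ 2 * ‖F t‖ₑ ^ 2) *
      ∫⁻ s : E ι, (ENNReal.ofReal (L * (1 + ‖s‖) ^ n) ^ 2)⁻¹ * ‖Φ s‖ₑ ^ 2 < ⊤ := by
    refine lt_of_le_of_lt ?_ h
    refine (ge_of_eq key).trans (lintegral_mono fun x => ?_)
    rw [← lintegral_const_mul]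
    swap
    · have h1 : Measurable fun t : E ι => ‖Φ (t - x)‖ₑ := (mΦ.comp (by fun_prop)).enorm
      exact (mF.enorm.pow_const 2).mul (h1.pow_const 2)
    refine lintegral_mono fun t => ?_
    have h1 : ENNReal.ofReal (m t) ^ 2 * (ENNReal.ofReal (L * (1 + ‖t - x‖) ^ n) ^ 2)⁻¹ ≤
        ENNReal.ofReal (m x) ^ 2 := by
      rw [← div_eq_mul_inv]
      refine ENNReal.div_le_of_le_mul ?_
      rw [← mul_pow, ← ENNReal.ofReal_mul (by have := hm.one_le x; linarith)]
      gcongr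
      rw [mul_comm]
      exact hm.le_mul t x
    calc _ = (ENNReal.ofReal (m t) ^ 2 * (ENNReal.ofReal (L * (1 + ‖t - x‖) ^ n) ^ 2)⁻¹) *
          (‖F t‖ₑ ^ 2 * ‖Φ (t - x)‖ₑ ^ 2) := by simp only [Pi.mul_apply]; ring
      _ ≤ _ := by gcongr
  have hne : ∫⁻ s : E ι, (ENNReal.ofReal (L * (1 + ‖s‖) ^ n) ^ 2)⁻¹ * ‖Φ s‖ₑ ^ 2 ≠ 0 := by
    intro h0
    rw [lintegral_eq_zero_iff hb] at h0
    refine hΦ (Lp.ext ?_)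
    filter_upwards [h0, Lp.coeFn_zero ℂ 2 (volume : Measure (E ι))] with s hs hz
    rw [hz]
    rcases mul_eq_zero.1 hs with h2 | h2
    · rw [ENNReal.inv_eq_zero] at h2
      exact absurd h2 (by simp)
    · simpa using h2
  exact ENNReal.lt_top_of_mul_ne_top_left hfin.ne hne

end Weights

section Schur

/-! ### Schur's test -/

theorem lintegral_mul_sq_le {X : Type*} [MeasurableSpace X] {μ : Measure X} {k h : X → ℝ≥0∞}
    (hk : Measurable k) (hh : Measurable h) :
    (∫⁻ x, k x * h x ∂μ) ^ 2 ≤ (∫⁻ x, k x ∂μ) * ∫⁻ x, k x * h x ^ 2 ∂μ := by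
  have h2 : (0 : ℝ) ≤ 1 / 2 := by norm_num
  have key := ENNReal.lintegral_mul_le_Lp_mul_Lq μ Real.HolderConjugate.two_two
    (f := fun x => k x ^ (1 / 2 : ℝ)) (g := fun x => k x ^ (1 / 2 : ℝ) * h x)
    (hk.pow_const _).aemeasurable ((hk.pow_const _).mul hh).aemeasurable
  have e0 : ∀ a : ℝ≥0∞, a ^ (1 / 2 : ℝ) * a ^ (1 / 2 : ℝ) = a := fun a => by
    rw [← ENNReal.rpow_add_of_nonneg _ _ h2 h2]; norm_num
  have e1 : ∀ a : ℝ≥0∞, (a ^ (1 / 2 : ℝ)) ^ 2 = a := fun a => by rw [sq, e0]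
  simp only [Pi.mul_apply, ← mul_assoc, e0, ENNReal.rpow_two, mul_pow, e1] at key
  calc _ ≤ ((∫⁻ x, k x ∂μ) ^ (1 / 2 : ℝ) * (∫⁻ x, k x * h x ^ 2 ∂μ) ^ (1 / 2 : ℝ)) ^ 2 := by
        gcongr
    _ = _ := by rw [mul_pow, e1, e1]

theorem schur_test {X Y : Type*} [MeasurableSpace X] [MeasurableSpace Y] {μ : Measure X}
    {ν : Measure Y} [SFinite μ] [SFinite ν] {k : X → Y → ℝ≥0∞}
    (hk : Measurable fun p : X × Y => k p.1 p.2) {h : Y → ℝ≥0∞} (hh : Measurable h) {A B : ℝ≥0∞}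
    (hA : ∀ x, ∫⁻ y, k x y ∂ν ≤ A) (hB : ∀ y, ∫⁻ x, k x y ∂μ ≤ B) :
    ∫⁻ x, (∫⁻ y, k x y * h y ∂ν) ^ 2 ∂μ ≤ A * (B * ∫⁻ y, h y ^ 2 ∂ν) := by
  have hk1 : ∀ x, Measurable (k x) := fun x => hk.comp measurable_prodMk_left
  have hk2 : ∀ y, Measurable fun x => k x y := fun y => hk.comp measurable_prodMk_right
  have hm : Measurable fun p : X × Y => k p.1 p.2 * h p.2 ^ 2 :=
    hk.mul ((hh.comp measurable_snd).pow_const 2)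
  calc _ ≤ ∫⁻ x, A * ∫⁻ y, k x y * h y ^ 2 ∂ν ∂μ := lintegral_mono fun x =>
        (lintegral_mul_sq_le (hk1 x) hh).trans (by gcongr; exact hA x)
    _ = A * ∫⁻ y, ∫⁻ x, k x y * h y ^ 2 ∂μ ∂ν := by
        rw [lintegral_const_mul _ hm.lintegral_prod_right', lintegral_lintegral_swap hm.aemeasurable]
    _ ≤ A * ∫⁻ y, B * h y ^ 2 ∂ν := by
        gcongr with y
        rw [lintegral_mul_const _ (hk2 y)]
        gcongr
        exact hB y
    _ = _ := by rw [lintegral_const_mul _ (hh.pow_const 2)]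

end Schur

section Doubling

/-! ### The distributions `𝓕⁻¹(e^{-π i ζ·Bζ}) * W(u, u)` in terms of coherent states -/

variable {ι : Type} [Fintype ι]

/-- The base point of the time-frequency shift of `𝓕⁻¹(e^{-π i ζ·Bζ}) * W(f, g)` that is caused by
shifts of `f` and `g`. -/
def midpointMap (B : Matrix (ι ⊕ ι) (ι ⊕ ι) ℝ) (p : Phase ι × Phase ι) : Phase ι :=
  (1 / 2 : ℝ) • (p.1 + p.2) + act B (rotJ (p.1 - p.2))

theorem continuous_midpointMap (B : Matrix (ι ⊕ ι) (ι ⊕ ι) ℝ) : Continuous (midpointMap B) := by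
  have h1 := continuous_act B
  have h2 : Continuous (rotJ (ι := ι)) := (rotJL ι).continuous
  unfold midpointMap
  fun_prop

theorem midpointMap_sub (B : Matrix (ι ⊕ ι) (ι ⊕ ι) ℝ) (p q : Phase ι × Phase ι) :
    midpointMap B (p - q) = midpointMap B p - midpointMap B q := by
  have h : rotJ (p.1 - q.1 - (p.2 - q.2)) = rotJ (p.1 - p.2) - rotJ (q.1 - q.2) := by
    rw [sub_sub_sub_comm]
    exact (rotJL ι).map_sub (p.1 - p.2) (q.1 - q.2)
  simp only [midpointMap, Prod.fst_sub, Prod.snd_sub, h, act_sub_right]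
  module

theorem measurePreserving_factors : MeasurePreserving
    (fun y : Phase (ι ⊕ ι) => (factorFst y, factorSnd y)) volume
    ((volume : Measure (Phase ι)).prod volume) := by
  let e : Phase (ι ⊕ ι) →ₗᵢ[ℝ] Phase (ι ⊕ ι) :=
    { toFun := fun y => mkPhase (factorFst y) (factorSnd y)
      map_add' := fun y z => by
        refine phase_ext (phase_ext ?_ ?_) (phase_ext ?_ ?_) <;>
        simp only [factorFst, factorSnd, fstPart_mkPhase, sndPart_mkPhase, fstPart_add,
          sndPart_add] <;> abel
      map_smul' := fun r z => by
        refine phase_ext (phase_ext ?_ ?_) (phase_ext ?_ ?_) <;>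
        simp only [factorFst, factorSnd, fstPart_mkPhase, sndPart_mkPhase, fstPart_smul,
          sndPart_smul, RingHom.id_apply, smul_neg]
      norm_map' := fun y => by
        have : ‖mkPhase (factorFst y) (factorSnd y)‖ ^ 2 = ‖y‖ ^ 2 := by
          simp only [norm_sq_phase, factorFst, factorSnd, fstPart_mkPhase, sndPart_mkPhase,
            norm_neg]
          ring
        exact (sq_eq_sq₀ (norm_nonneg _) (norm_nonneg _)).1 this }
  have h := (measurePreserving_parts (ι := ι ⊕ ι)).comp
    (e.toLinearIsometryEquiv rfl).measurePreserving
  have he : (fun y : Phase (ι ⊕ ι) => (factorFst y, factorSnd y)) =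
      (fun w : Phase (ι ⊕ ι) => (fstPart w, sndPart w)) ∘ (e.toLinearIsometryEquiv rfl) := by
    funext y
    change _ = (fstPart (mkPhase (factorFst y) (factorSnd y)),
      sndPart (mkPhase (factorFst y) (factorSnd y)))
    simp only [fstPart_mkPhase, sndPart_mkPhase]
  rw [he]
  exact h

/-- In the unimodular coordinates w = 𝒜y, with 𝒜 the covariant matrix of B, the metaplectic operator
drops out of the inner product. What remains factors over the two components of the tensor products.
-/
theorem lintegral_weight_ambig_cohenOp [DecidableEq ι] {B : Matrix (ι ⊕ ι) (ι ⊕ ι) ℝ}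
    (hB : B.IsSymm) (u φ : L2 ι) {m : Phase ι → ℝ≥0∞} (hm : Measurable m) :
    ∫⁻ w : Phase (ι ⊕ ι), m (fstPart w) *
        ‖ambig (cohenOp B (tensorConj u u)) (cohenOp B (tensorConj φ φ)) w‖ₑ ^ 2 =
      ∫⁻ p : Phase ι × Phase ι, m (midpointMap B p) *
        (‖ambig u φ p.1‖ₑ * ‖ambig u φ p.2‖ₑ) ^ 2 := by
  have hc := covariantOf_isCovariant hB
  have hdet : |(covariantOf B).det| = 1 := by
    rw [SymplecticGroup.det_eq_one hc.1, abs_one]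
  have m1 : Measurable fun w : Phase (ι ⊕ ι) => m (fstPart w) *
      ‖ambig (cohenOp B (tensorConj u u)) (cohenOp B (tensorConj φ φ)) w‖ₑ ^ 2 :=
    (hm.comp continuous_fstPart.measurable).mul ((measurable_enorm_ambig _ _).pow_const 2)
  have m2 : Measurable fun p : Phase ι × Phase ι => m (midpointMap B p) *
      (‖ambig u φ p.1‖ₑ * ‖ambig u φ p.2‖ₑ) ^ 2 :=
    (hm.comp (continuous_midpointMap B).measurable).mul
      ((((measurable_enorm_ambig u φ).comp measurable_fst).mul
        ((measurable_enorm_ambig u φ).comp measurable_snd)).pow_const 2)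
  rw [← (measurePreserving_act hdet).lintegral_comp m1, Measure.volume_eq_prod,
    ← measurePreserving_factors.lintegral_comp m2]
  refine lintegral_congr fun y => ?_
  have e1 : act (covariantOf B) y = mkPhase (fstPart (wignerShift y) +
      act B (sndPart (wignerShift y))) (sndPart (wignerShift y)) := by
    rw [hc.act_eq, cohenMatrix_covariantOf hB]
  have e2 : fstPart (act (covariantOf B) y) = midpointMap B (factorFst y, factorSnd y) := by
    rw [e1, fstPart_mkPhase, midpointMap, wignerShift, fstPart_mkPhase, sndPart_mkPhase]
  have e3 : ambig (cohenOp B (tensorConj u u)) (cohenOp B (tensorConj φ φ))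
      (act (covariantOf B) y) =
      ambig u φ (factorFst y) * conj (ambig u φ (factorSnd y)) := by
    rw [ambig, e1, ← cohenOp_tfShift hB, LinearIsometryEquiv.inner_map_map, tfShift_tensorConj,
      inner_tensorConj, ambig, ambig, inner_conj_symm]
  rw [e2, e3, enorm_mul, enorm_conj]

theorem exists_schwartz_cohenOp_window [DecidableEq ι] (B : Matrix (ι ⊕ ι) (ι ⊕ ι) ℝ) :
    ∃ G : 𝓢(Phase ι, ℂ),
      (cohenOp B (tensorConj (windowLp ι) (windowLp ι)) : Phase ι → ℂ) =ᵐ[volume] G := by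
  have hq : (fun ζ : Phase ι => cis (-(Real.pi * quad B ζ))).HasTemperateGrowth := by
    simp only [← neg_mul]
    exact cis_comp_hasTemperateGrowth
      ((Function.HasTemperateGrowth.const (-Real.pi)).mul (quad_hasTemperateGrowth B))
  refine ⟨𝓕⁻ (SchwartzMap.smulLeftCLM ℂ (fun ζ : Phase ι => cis (-(Real.pi * quad B ζ)))
    (𝓕 (wignerWindow ι))), ?_⟩
  have h := coe_cohenOp_tensorConj B (window ι) (window ι)
  rw [wigner_window] at h
  rw [windowLp_eq_toL2]
  refine h.trans (Filter.Eventually.of_forall fun z => ?_)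
  rw [SchwartzMap.fourierInv_coe]
  refine congrFun (congrArg _ (funext fun ζ => ?_)) z
  rw [SchwartzMap.smulLeftCLM_apply_apply hq, SchwartzMap.fourier_coe, smul_eq_mul]

theorem lintegral_weight_schwartz_lt_top (G : 𝓢(E ι, ℂ)) (n : ℕ) {L : ℝ} (hL : 0 ≤ L) :
    ∫⁻ s : E ι, ENNReal.ofReal (L * (1 + ‖s‖) ^ n) ^ 2 * ‖G s‖ₑ ^ 2 < ⊤ := by
  obtain ⟨M, hM⟩ := exists_integrable_one_add_norm_inv_pow (E ι) volume
  obtain ⟨C, hC0, hC⟩ := SchwartzMap.exists_one_add_norm_pow_mul_le G (n + M)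
  have hi := (hM (M + M) (by omega)).const_mul ((L * C) ^ 2)
  refine lt_of_le_of_lt (lintegral_mono fun s => ?_) hi.lintegral_lt_top
  rw [← mul_pow, ← ofReal_norm, ← ENNReal.ofReal_mul (by positivity),
    ← ENNReal.ofReal_pow (by positivity)]
  refine ENNReal.ofReal_le_ofReal ?_
  have h1 : (1 + ‖s‖) ^ n * ‖G s‖ ≤ C * ((1 + ‖s‖) ^ M)⁻¹ := by
    rw [← div_eq_mul_inv, le_div_iff₀ (by positivity)]
    calc _ = (1 + ‖s‖) ^ (n + M) * ‖G s‖ := by rw [pow_add]; ring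
      _ ≤ C := hC s
  calc (L * (1 + ‖s‖) ^ n * ‖G s‖) ^ 2 = (L * ((1 + ‖s‖) ^ n * ‖G s‖)) ^ 2 := by ring
    _ ≤ (L * (C * ((1 + ‖s‖) ^ M)⁻¹)) ^ 2 := by gcongr
    _ = _ := by rw [pow_add, mul_inv]; ring

end Doubling

section Transfer

/-! ### Transfer of weighted norms by operators with off-diagonal decay -/

variable {ι : Type} [Fintype ι]

theorem measurable_ofReal_inv_pow (C : ℝ) (N : ℕ) :
    Measurable fun x : Phase ι => ENNReal.ofReal (C * ((1 + ‖x‖) ^ N)⁻¹) := by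
  fun_prop

theorem GaborDecay.enorm_ambig_le {T : L2 ι →L[ℂ] L2 ι} {χ : Matrix (ι ⊕ ι) (ι ⊕ ι) ℝ}
    (hT : GaborDecay T χ) (N : ℕ) : ∃ C : ℝ, 0 ≤ C ∧ ∀ (u : L2 ι) (v : Phase ι),
      ENNReal.ofReal (‖windowLp ι‖ ^ 2) * ‖ambig (T u) (windowLp ι) v‖ₑ ≤
        ∫⁻ z : Phase ι, ENNReal.ofReal (C * ((1 + ‖v - act χ z‖) ^ N)⁻¹) *
          ‖ambig u (windowLp ι) z‖ₑ := by
  obtain ⟨C, hC0, hC⟩ := hT N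
  refine ⟨C, hC0, fun u v => ?_⟩
  have h1 : ambig (T u) (windowLp ι) v = inner ℂ (T.adjoint (coherent v)) u := by
    rw [ContinuousLinearMap.adjoint_inner_left]; rfl
  have h2 := inner_eq_integral_ambig (T.adjoint (coherent v)) u (windowLp ι)
  have h3 : ENNReal.ofReal (‖windowLp ι‖ ^ 2) * ‖ambig (T u) (windowLp ι) v‖ₑ =
      ‖∫ z, conj (ambig (T.adjoint (coherent v)) (windowLp ι) z) * ambig u (windowLp ι) z‖ₑ := by
    rw [← h2, enorm_mul, h1]
    congr 1
    rw [← ofReal_norm, Complex.norm_real, Real.norm_of_nonneg (by positivity)]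
  rw [h3]
  refine (enorm_integral_le_lintegral_enorm _).trans (lintegral_mono fun z => ?_)
  rw [enorm_mul]
  gcongr
  have h4 : conj (ambig (T.adjoint (coherent v)) (windowLp ι) z) =
      inner ℂ (coherent v) (T (coherent z)) := by
    rw [ambig, inner_conj_symm, ContinuousLinearMap.adjoint_inner_left]; rfl
  rw [h4, ← ofReal_norm]
  refine ENNReal.ofReal_le_ofReal ?_
  rw [← div_eq_mul_inv, le_div_iff₀ (by positivity), mul_comm]
  exact hC v z

theorem GaborDecay.lintegral_lt_top [DecidableEq ι] {T : L2 ι →L[ℂ] L2 ι} {χ : Matrix (ι ⊕ ι) (ι ⊕ ι) ℝ}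
    (hT : GaborDecay T χ) (hχ : |χ.det| = 1) {m m' : Phase ι × Phase ι → ℝ} {n : ℕ} {L : ℝ}
    (hL : 0 ≤ L) (hm : Continuous m')
    (hmm : ∀ p z, m p ≤ L * ((1 + ‖p.1 - act χ z.1‖) ^ n * (1 + ‖p.2 - act χ z.2‖) ^ n) * m' z)
    (u : L2 ι) (h : ∫⁻ z : Phase ι × Phase ι, ENNReal.ofReal (m' z) ^ 2 *
      (‖ambig u (windowLp ι) z.1‖ₑ * ‖ambig u (windowLp ι) z.2‖ₑ) ^ 2 < ⊤) :
    ∫⁻ p : Phase ι × Phase ι, ENNReal.ofReal (m p) ^ 2 *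
      (‖ambig (T u) (windowLp ι) p.1‖ₑ * ‖ambig (T u) (windowLp ι) p.2‖ₑ) ^ 2 < ⊤ := by
  obtain ⟨M, hM⟩ := exists_integrable_one_add_norm_inv_pow (Phase ι) volume
  obtain ⟨C, hC0, hC⟩ := hT.enorm_ambig_le (n + M)
  set a := ENNReal.ofReal (‖windowLp ι‖ ^ 2) with ha
  have ha0 : a ≠ 0 := by
    rw [ha, Ne, ENNReal.ofReal_eq_zero, not_le]
    have := norm_pos_iff.2 (windowLp_ne_zero (ι := ι)); positivity
  set κ : Phase ι → ℝ≥0∞ := fun x => ENNReal.ofReal (C * ((1 + ‖x‖) ^ M)⁻¹) with hκ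
  have mκ : Measurable κ := measurable_ofReal_inv_pow C M
  have hκfin : ∫⁻ x, κ x < ⊤ := ((hM M le_rfl).const_mul C).lintegral_lt_top
  set V := fun z => ‖ambig u (windowLp ι) z‖ₑ with hV
  have mV : Measurable V := measurable_enorm_ambig _ _
  have mχ : Measurable (act χ) := (continuous_act χ).measurable
  have mk : ∀ v : Phase ι, Measurable fun z => κ (v - act χ z) := fun v =>
    mκ.comp (measurable_const.sub mχ)
  have i1 : ∀ v : Phase ι, ∫⁻ z, κ (v - act χ z) = ∫⁻ x, κ x := fun v => by
    rw [(measurePreserving_act hχ).lintegral_comp (f := fun z => κ (v - z))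
      (mκ.comp (measurable_const.sub measurable_id)), lintegral_sub_left_eq_self κ v]
  have i2 : ∀ z : Phase ι, ∫⁻ v, κ (v - act χ z) = ∫⁻ x, κ x := fun z =>
    lintegral_sub_right_eq_self κ _
  let K : Phase ι × Phase ι → Phase ι × Phase ι → ℝ≥0∞ := fun p z =>
    κ (p.1 - act χ z.1) * κ (p.2 - act χ z.2)
  let H : Phase ι × Phase ι → ℝ≥0∞ := fun z => ENNReal.ofReal (m' z) * (V z.1 * V z.2)
  have mK : Measurable fun q : (Phase ι × Phase ι) × (Phase ι × Phase ι) => K q.1 q.2 := by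
    refine (mκ.comp ?_).mul (mκ.comp ?_)
    · exact (measurable_fst.comp measurable_fst).sub
        (mχ.comp (measurable_fst.comp measurable_snd))
    · exact (measurable_snd.comp measurable_fst).sub
        (mχ.comp (measurable_snd.comp measurable_snd))
  have mH : Measurable H := (ENNReal.measurable_ofReal.comp hm.measurable).mul
    ((mV.comp measurable_fst).mul (mV.comp measurable_snd))
  have kA : ∀ p, ∫⁻ z, K p z ∂(volume.prod volume) ≤ (∫⁻ x, κ x) * ∫⁻ x, κ x := fun p => by
    rw [lintegral_prod_mul (mk p.1).aemeasurable (mk p.2).aemeasurable, i1, i1]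
  have kB : ∀ z, ∫⁻ p, K p z ∂(volume.prod volume) ≤ (∫⁻ x, κ x) * ∫⁻ x, κ x := fun z => by
    rw [lintegral_prod_mul (f := fun v => κ (v - act χ z.1)) (g := fun v => κ (v - act χ z.2))
      (mκ.comp (measurable_id.sub_const _)).aemeasurable
      (mκ.comp (measurable_id.sub_const _)).aemeasurable, i2, i2]
  have hS := schur_test mK mH kA kB
  have key : ∀ p : Phase ι × Phase ι, a ^ 2 * (ENNReal.ofReal (m p) *
      (‖ambig (T u) (windowLp ι) p.1‖ₑ * ‖ambig (T u) (windowLp ι) p.2‖ₑ)) ≤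
      ENNReal.ofReal L * ∫⁻ z, K p z * H z ∂(volume.prod volume) := fun p => by
    set k : Phase ι → ℝ≥0∞ := fun x => ENNReal.ofReal (C * ((1 + ‖x‖) ^ (n + M))⁻¹) with hk
    have mk' : ∀ v : Phase ι, Measurable fun z => k (v - act χ z) := fun v =>
      (measurable_ofReal_inv_pow C (n + M)).comp (measurable_const.sub mχ)
    have kk : ∀ x, ENNReal.ofReal ((1 + ‖x‖) ^ n) * k x = κ x := fun x => by
      rw [hk, hκ, ← ENNReal.ofReal_mul (by positivity)]
      congr 1
      rw [pow_add]; field_simp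
    calc _ = ENNReal.ofReal (m p) * ((a * ‖ambig (T u) (windowLp ι) p.1‖ₑ) *
          (a * ‖ambig (T u) (windowLp ι) p.2‖ₑ)) := by ring
      _ ≤ ENNReal.ofReal (m p) * ((∫⁻ z, k (p.1 - act χ z) * V z) *
          ∫⁻ z, k (p.2 - act χ z) * V z) := by
        gcongr
        · exact hC u p.1
        · exact hC u p.2
      _ = ∫⁻ z, ENNReal.ofReal (m p) * ((k (p.1 - act χ z.1) * V z.1) *
          (k (p.2 - act χ z.2) * V z.2)) ∂(volume.prod volume) := by
        rw [lintegral_const_mul' _ _ ENNReal.ofReal_ne_top, lintegral_prod_mul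
          (f := fun z => k (p.1 - act χ z) * V z) (g := fun z => k (p.2 - act χ z) * V z)
          ((mk' p.1).mul mV).aemeasurable ((mk' p.2).mul mV).aemeasurable]
      _ ≤ ∫⁻ z, ENNReal.ofReal L * (K p z * H z) ∂(volume.prod volume) := by
        refine lintegral_mono fun z => ?_
        have h1 : ENNReal.ofReal (m p) ≤ ENNReal.ofReal L *
            (ENNReal.ofReal ((1 + ‖p.1 - act χ z.1‖) ^ n) *
              ENNReal.ofReal ((1 + ‖p.2 - act χ z.2‖) ^ n)) * ENNReal.ofReal (m' z) := by
          rw [← ENNReal.ofReal_mul (by positivity), ← ENNReal.ofReal_mul hL,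
            ← ENNReal.ofReal_mul (by positivity)]
          exact ENNReal.ofReal_le_ofReal (hmm p z)
        calc _ ≤ (ENNReal.ofReal L * (ENNReal.ofReal ((1 + ‖p.1 - act χ z.1‖) ^ n) *
              ENNReal.ofReal ((1 + ‖p.2 - act χ z.2‖) ^ n)) * ENNReal.ofReal (m' z)) *
              ((k (p.1 - act χ z.1) * V z.1) * (k (p.2 - act χ z.2) * V z.2)) := by gcongr
          _ = ENNReal.ofReal L * (((ENNReal.ofReal ((1 + ‖p.1 - act χ z.1‖) ^ n) *
              k (p.1 - act χ z.1)) * (ENNReal.ofReal ((1 + ‖p.2 - act χ z.2‖) ^ n) *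
              k (p.2 - act χ z.2))) * (ENNReal.ofReal (m' z) * (V z.1 * V z.2))) := by ring
          _ = _ := by rw [kk, kk]
      _ = _ := lintegral_const_mul' _ _ ENNReal.ofReal_ne_top
  have hH : ∫⁻ z, H z ^ 2 ∂(volume.prod volume) < ⊤ := by
    refine lt_of_eq_of_lt (lintegral_congr fun z => ?_) h
    rw [mul_pow]
  have hfin : a ^ 4 * ∫⁻ p : Phase ι × Phase ι, ENNReal.ofReal (m p) ^ 2 *
      (‖ambig (T u) (windowLp ι) p.1‖ₑ * ‖ambig (T u) (windowLp ι) p.2‖ₑ) ^ 2 < ⊤ := by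
    rw [← lintegral_const_mul' _ _ (by simp [ha])]
    calc _ ≤ ∫⁻ p, ENNReal.ofReal L ^ 2 * (∫⁻ z, K p z * H z ∂(volume.prod volume)) ^ 2
            ∂(volume.prod volume) := lintegral_mono fun p => by
          rw [← mul_pow (ENNReal.ofReal L)]
          calc _ = (a ^ 2 * (ENNReal.ofReal (m p) * (‖ambig (T u) (windowLp ι) p.1‖ₑ *
              ‖ambig (T u) (windowLp ι) p.2‖ₑ))) ^ 2 := by ring
            _ ≤ _ := pow_le_pow_left' (key p) 2
      _ = ENNReal.ofReal L ^ 2 * ∫⁻ p, (∫⁻ z, K p z * H z ∂(volume.prod volume)) ^ 2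
            ∂(volume.prod volume) := lintegral_const_mul' _ _ (by simp)
      _ < ⊤ := ENNReal.mul_lt_top (by simp) (hS.trans_lt (ENNReal.mul_lt_top
          (ENNReal.mul_lt_top hκfin hκfin) (ENNReal.mul_lt_top
            (ENNReal.mul_lt_top hκfin hκfin) hH)))
  exact ENNReal.lt_top_of_mul_ne_top_right hfin.ne (pow_ne_zero _ ha0)

end Transfer

section ConicDecay

open scoped Pointwise

/-! ### Decay in cones -/

variable {V : Type*} [NormedAddCommGroup V]

/-- The distance to a set is 1-Lipschitz. With S the complement of a cone this weight grows like a
power of |x| inside the cone and is 1 outside. -/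
theorem isModerate_infDist (S : Set V) (N : ℕ) :
    IsModerate N 1 fun x => (1 + Metric.infDist x S) ^ N where
  continuous := by
    have := Metric.continuous_infDist_pt S
    fun_prop
  one_le x := one_le_pow₀ (by linarith [Metric.infDist_nonneg (x := x) (s := S)])
  le_mul x y := by
    rw [one_mul, ← mul_pow]
    have h := Metric.infDist_le_infDist_add_dist (s := S) (x := x) (y := y)
    have h0 := Metric.infDist_nonneg (x := x) (s := S)
    have h1 := Metric.infDist_nonneg (x := y) (s := S)
    rw [dist_eq_norm] at h
    refine pow_le_pow_left₀ (by positivity) ?_ _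
    nlinarith [mul_nonneg (norm_nonneg (x - y)) h1]

section Measure

variable [MeasurableSpace V] {μ : Measure V}

/-- A norm weighted by a function that grows in a cone bounds the decay in this cone. -/
theorem lintegral_cone_lt_top {Γ : Set V} (hΓ : MeasurableSet Γ) {δ : V → ℝ} {ε : ℝ} (hε : 0 < ε)
    (hδ : ∀ x ∈ Γ, ε * ‖x‖ ≤ δ x) {F : V → ℂ} (N : ℕ)
    (h : ∫⁻ x, ENNReal.ofReal ((1 + δ x) ^ N) ^ 2 * ‖F x‖ₑ ^ 2 ∂μ < ⊤) :
    ∫⁻ x in Γ, ENNReal.ofReal ((1 + ‖x‖ ^ 2) ^ N * ‖F x‖ ^ 2) ∂μ < ⊤ := by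
  refine lt_of_le_of_lt (setLIntegral_mono' hΓ (g := fun x => ENNReal.ofReal (((1 + ε⁻¹) ^ N) ^ 2) *
    (ENNReal.ofReal ((1 + δ x) ^ N) ^ 2 * ‖F x‖ₑ ^ 2)) fun x hx => ?_) ?_
  · have h1 := hδ x hx
    have h2 : 0 ≤ δ x := le_trans (by positivity) h1
    rw [← ofReal_norm, ← ENNReal.ofReal_pow (by positivity),
      ← ENNReal.ofReal_pow (norm_nonneg _), ← ENNReal.ofReal_mul (by positivity),
      ← ENNReal.ofReal_mul (by positivity), ← mul_assoc]
    refine ENNReal.ofReal_le_ofReal (mul_le_mul_of_nonneg_right ?_ (by positivity))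
    rw [← pow_mul, ← pow_mul, mul_comm N, pow_mul, pow_mul, ← mul_pow, ← mul_pow]
    refine pow_le_pow_left₀ (by positivity) ?_ _
    have h3 : ‖x‖ ≤ ε⁻¹ * δ x := by rwa [← div_eq_inv_mul, le_div_iff₀ hε, mul_comm]
    have h4 : 0 < ε⁻¹ := inv_pos.2 hε
    have h5 : 1 + ‖x‖ ≤ (1 + ε⁻¹) * (1 + δ x) := by nlinarith
    have h6 := pow_le_pow_left₀ (by positivity) h5 2
    nlinarith [norm_nonneg x]
  · rw [lintegral_const_mul' _ _ ENNReal.ofReal_ne_top]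
    exact ENNReal.mul_lt_top ENNReal.ofReal_lt_top (lt_of_le_of_lt (setLIntegral_le_lintegral _ _) h)

/-- Decay in a cone bounds the norm weighted by the distance to the complement. -/
theorem lintegral_infDist_lt_top {Γ : Set V} (hΓ : MeasurableSet Γ) (h0 : (0 : V) ∉ Γ)
    {F : V → ℂ} (hF : ∫⁻ x, ‖F x‖ₑ ^ 2 ∂μ < ⊤) (N : ℕ)
    (h : ∫⁻ x in Γ, ENNReal.ofReal ((1 + ‖x‖ ^ 2) ^ N * ‖F x‖ ^ 2) ∂μ < ⊤) :
    ∫⁻ x, ENNReal.ofReal ((1 + Metric.infDist x Γᶜ) ^ N) ^ 2 * ‖F x‖ₑ ^ 2 ∂μ < ⊤ := by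
  have e : ∀ x (r : ℝ), 0 ≤ r → ENNReal.ofReal r ^ 2 * ‖F x‖ₑ ^ 2 =
      ENNReal.ofReal (r ^ 2 * ‖F x‖ ^ 2) := fun x r hr => by
    rw [← ofReal_norm, ← ENNReal.ofReal_pow hr, ← ENNReal.ofReal_pow (norm_nonneg _),
      ← ENNReal.ofReal_mul (by positivity)]
  rw [← lintegral_add_compl _ hΓ]
  refine ENNReal.add_lt_top.2 ⟨?_, ?_⟩
  · refine lt_of_le_of_lt (lintegral_mono (g := fun x => ENNReal.ofReal (2 ^ N) *
      ENNReal.ofReal ((1 + ‖x‖ ^ 2) ^ N * ‖F x‖ ^ 2)) fun x => ?_) ?_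
    · have hd : Metric.infDist x Γᶜ ≤ ‖x‖ := by
        have := Metric.infDist_le_dist_of_mem (x := x) (show (0 : V) ∈ Γᶜ from h0)
        rwa [dist_zero_right] at this
      have hd0 := Metric.infDist_nonneg (x := x) (s := Γᶜ)
      dsimp only
      rw [e _ _ (by positivity), ← ENNReal.ofReal_mul (by positivity), ← mul_assoc, ← mul_pow 2]
      refine ENNReal.ofReal_le_ofReal (mul_le_mul_of_nonneg_right ?_ (by positivity))
      rw [← pow_mul, mul_comm N, pow_mul]
      refine pow_le_pow_left₀ (by positivity) ?_ _
      nlinarith [sq_nonneg (1 - ‖x‖)]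
    · rw [lintegral_const_mul' _ _ ENNReal.ofReal_ne_top]
      exact ENNReal.mul_lt_top ENNReal.ofReal_lt_top h
  · refine lt_of_le_of_lt (setLIntegral_mono' hΓ.compl (g := fun x => ‖F x‖ₑ ^ 2) fun x hx => ?_)
      (lt_of_le_of_lt (setLIntegral_le_lintegral _ _) hF)
    rw [Metric.infDist_zero_of_mem hx]; simp

end Measure

variable [NormedSpace ℝ V]

theorem infDist_smul_of_conic {S : Set V} (hS : ∀ z, ∀ r : ℝ, 0 < r → (r • z ∈ S ↔ z ∈ S)) {r : ℝ}
    (hr : 0 < r) (x : V) : Metric.infDist (r • x) S = r * Metric.infDist x S := by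
  have h : r • S = S := by
    ext z
    rw [mem_smul_set_iff_inv_smul_mem₀ hr.ne', hS z _ (inv_pos.2 hr)]
  have := infDist_smul₀ hr.ne' S x
  rwa [h, Real.norm_of_nonneg hr.le] at this

theorem IsModerate.comp_clm {n : ℕ} {L : ℝ} {m : V → ℝ} (hm : IsModerate n L m) (A : V →L[ℝ] V) :
    IsModerate n (L * (1 + ‖A‖) ^ n) fun x => m (A x) where
  continuous := hm.continuous.comp A.continuous
  one_le x := hm.one_le _
  le_mul x y := by
    have hL := hm.pos
    refine (hm.le_mul (A x) (A y)).trans ?_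
    refine mul_le_mul_of_nonneg_right ?_ (zero_le_one.trans (hm.one_le _))
    rw [mul_assoc, ← mul_pow, ← map_sub]
    refine mul_le_mul_of_nonneg_left (pow_le_pow_left₀ (by positivity) ?_ _) hL.le
    nlinarith [A.le_opNorm (x - y), norm_nonneg A, norm_nonneg (x - y)]

end ConicDecay

section WaveFrontSets

/-! ### Propagation of wave front sets -/

variable {ι : Type} [Fintype ι]

theorem nonDecaySet_congr {F G : Phase ι → ℂ} (h : ∀ᵐ z, ‖F z‖ = ‖G z‖) :
    nonDecaySet F = nonDecaySet G := by
  have : ∀ (Γ : Set (Phase ι)) (N : ℕ),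
      ∫⁻ z in Γ, ENNReal.ofReal ((1 + ‖z‖ ^ 2) ^ N * ‖F z‖ ^ 2) =
        ∫⁻ z in Γ, ENNReal.ofReal ((1 + ‖z‖ ^ 2) ^ N * ‖G z‖ ^ 2) := fun Γ N => by
    refine lintegral_congr_ae (ae_restrict_of_ae ?_)
    filter_upwards [h] with z hz
    rw [hz]
  simp only [nonDecaySet, this]

theorem lintegral_enorm_sq_lt_top (F : L2 ι) : ∫⁻ x, ‖F x‖ₑ ^ 2 < ⊤ := by
  rw [lintegral_enorm_sq_eq_norm]; exact ENNReal.ofReal_lt_top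

/-- The representative `𝓕⁻¹(e^{-π i ζ·Bζ}) * W(u, u)` of a covariant Wigner distribution. -/
def cohenWigner (B : Matrix (ι ⊕ ι) (ι ⊕ ι) ℝ) (u : L2 ι) : L2 (ι ⊕ ι) :=
  cohenOp B (tensorConj u u)

theorem wignerWaveFront_eq (u : L2 ι) : wignerWaveFront u = nonDecaySet (cohenWigner 0 u) := by
  refine nonDecaySet_congr ?_
  rw [cohenWigner, cohenOp_zero, wignerOp_tensorConj]
  filter_upwards [coe_wignerLp u u] with z hz
  rw [hz]

theorem norm_midpointMap_le (B : Matrix (ι ⊕ ι) (ι ⊕ ι) ℝ) (p : Phase ι × Phase ι) :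
    ‖midpointMap B p‖ ≤ (1 + ‖actL B‖) * (‖p.1‖ + ‖p.2‖) := by
  have h1 := (actL B).le_opNorm (rotJ (p.1 - p.2))
  have h2 := norm_sub_le p.1 p.2
  have h3 : ‖(1 / 2 : ℝ) • (p.1 + p.2)‖ ≤ ‖p.1‖ + ‖p.2‖ := by
    rw [norm_smul, Real.norm_of_nonneg (by norm_num)]
    linarith [norm_add_le p.1 p.2, norm_nonneg p.1, norm_nonneg p.2]
  rw [norm_rotJ] at h1
  have h4 : ‖actL B‖ * ‖p.1 - p.2‖ ≤ ‖actL B‖ * (‖p.1‖ + ‖p.2‖) := by gcongr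
  calc _ ≤ ‖(1 / 2 : ℝ) • (p.1 + p.2)‖ + ‖actL B (rotJ (p.1 - p.2))‖ := norm_add_le _ _
    _ ≤ _ := by linarith

variable [DecidableEq ι]

theorem IsCovariant.metaWaveFront_eq {𝒜 : Matrix ((ι ⊕ ι) ⊕ (ι ⊕ ι)) ((ι ⊕ ι) ⊕ (ι ⊕ ι)) ℝ}
    (h : IsCovariant 𝒜) (u : L2 ι) :
    metaWaveFront 𝒜 u = nonDecaySet (cohenWigner (cohenMatrix 𝒜) u) := by
  obtain ⟨c, hc, hT⟩ := h.exists_metaplectic_eq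
  refine nonDecaySet_congr ?_
  rw [metaWigner, hT]
  filter_upwards [Lp.coeFn_smul c (cohenOp (cohenMatrix 𝒜) (tensorConj u u))] with z hz
  rw [hz, Pi.smul_apply, norm_smul, hc, one_mul]; rfl

/-- The distribution built from u is analysed with the window built from the Gaussian in the same
way. That window is a nonzero Schwartz function, so weighted norms can be tested on the ambiguity
function, which factorises. -/
theorem lintegral_cohenWigner_lt_top_iff {B : Matrix (ι ⊕ ι) (ι ⊕ ι) ℝ} (hB : B.IsSymm) {n : ℕ}
    {L : ℝ} {m : Phase ι → ℝ} (hm : IsModerate n L m) (u : L2 ι) :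
    ∫⁻ x, ENNReal.ofReal (m x) ^ 2 * ‖cohenWigner B u x‖ₑ ^ 2 < ⊤ ↔
      ∫⁻ p : Phase ι × Phase ι, ENNReal.ofReal (m (midpointMap B p)) ^ 2 *
        (‖ambig u (windowLp ι) p.1‖ₑ * ‖ambig u (windowLp ι) p.2‖ₑ) ^ 2 < ⊤ := by
  obtain ⟨G, hG⟩ := exists_schwartz_cohenOp_window B
  have hΦ : ∫⁻ s : Phase ι, ENNReal.ofReal (L * (1 + ‖s‖) ^ n) ^ 2 *
      ‖cohenOp B (tensorConj (windowLp ι) (windowLp ι)) s‖ₑ ^ 2 < ⊤ := by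
    refine lt_of_eq_of_lt (lintegral_congr_ae ?_)
      (lintegral_weight_schwartz_lt_top G n hm.pos.le)
    filter_upwards [hG] with s hs
    rw [hs]
  have hΦ0 : cohenOp B (tensorConj (windowLp ι) (windowLp ι)) ≠ 0 :=
    (LinearIsometryEquiv.map_eq_zero_iff _).not.2
      (tensorConj_ne_zero windowLp_ne_zero windowLp_ne_zero)
  rw [← lintegral_weight_ambig_cohenOp hB u (windowLp ι) (measurable_ofReal_pow hm.continuous)]
  exact ⟨lintegral_weight_ambig_lt_top hm hΦ, lintegral_weight_lt_top_of_ambig hm hΦ0⟩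

theorem GaborDecay.lintegral_cohenWigner_lt_top {T : L2 ι →L[ℂ] L2 ι}
    {χ ψ : Matrix (ι ⊕ ι) (ι ⊕ ι) ℝ} (hT : GaborDecay T χ) (hχ : |χ.det| = 1) (hψ : χ * ψ = 1)
    (hJ : χᵀ * matJ ι * χ = matJ ι) {B : Matrix (ι ⊕ ι) (ι ⊕ ι) ℝ} (hB : B.IsSymm) {n : ℕ} {L : ℝ}
    {m : Phase ι → ℝ} (hm : IsModerate n L m) (u : L2 ι)
    (h : ∫⁻ x, ENNReal.ofReal (m x) ^ 2 * ‖cohenWigner (ψ * B * ψᵀ) u x‖ₑ ^ 2 < ⊤) :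
    ∫⁻ x, ENNReal.ofReal (m (act ψ x)) ^ 2 * ‖cohenWigner B (T u) x‖ₑ ^ 2 < ⊤ := by
  rw [lintegral_cohenWigner_lt_top_iff (isSymm_conj hB ψ) hm] at h
  refine (lintegral_cohenWigner_lt_top_iff hB (hm.comp_clm (actL ψ)) (T u)).2 ?_
  have hL := hm.pos
  have hψJ : ψᵀ * matJ ι = matJ ι * χ := by
    have : ψᵀ * χᵀ = 1 := by rw [← transpose_mul, hψ, transpose_one]
    calc ψᵀ * matJ ι = ψᵀ * (χᵀ * matJ ι * χ) := by rw [hJ]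
      _ = _ := by rw [mul_assoc, ← mul_assoc, this, one_mul]
  have hψχ : ψ * χ = 1 := mul_eq_one_comm.1 hψ
  -- Here symplecticity enters: J χ = χ⁻ᵀ J turns ψ B J χ into ψ B ψᵀ J, which produces the
  -- transported Cohen matrix.
  have hmid : ∀ z : Phase ι × Phase ι, act ψ (midpointMap B (act χ z.1, act χ z.2)) =
      midpointMap (ψ * B * ψᵀ) z := fun z => by
    simp only [midpointMap, act_add_right, act_smul_right, ← act_mul, ← act_sub_right, hψχ,
      act_one, ← act_matJ]
    rw [mul_assoc (ψ * B), hψJ, mul_assoc]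
  set c := 1 + ‖actL ψ‖ * (1 + ‖actL B‖) with hc
  have hc1 : 1 ≤ c := by rw [hc]; linarith [show 0 ≤ ‖actL ψ‖ * (1 + ‖actL B‖) by positivity]
  refine hT.lintegral_lt_top hχ (n := n) (L := L * c ^ n) (by positivity)
    (hm.continuous.comp (continuous_midpointMap _)) (fun p z => ?_) u h
  refine (hm.le_mul _ (midpointMap (ψ * B * ψᵀ) z)).trans ?_
  refine mul_le_mul_of_nonneg_right ?_ (zero_le_one.trans (hm.one_le _))
  rw [mul_assoc L, ← mul_pow, ← mul_pow]
  refine mul_le_mul_of_nonneg_left (pow_le_pow_left₀ (by positivity) ?_ _) hL.le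
  have h1 : actL ψ (midpointMap B p) - midpointMap (ψ * B * ψᵀ) z =
      actL ψ (midpointMap B (p - (act χ z.1, act χ z.2))) := by
    rw [midpointMap_sub, map_sub, ← hmid]; rfl
  rw [h1]
  have h2 := (actL ψ).le_opNorm (midpointMap B (p - (act χ z.1, act χ z.2)))
  have h3 := mul_le_mul_of_nonneg_left
    (norm_midpointMap_le B (p - (act χ z.1, act χ z.2))) (norm_nonneg (actL ψ))
  have h4 := h2.trans h3
  rw [← mul_assoc] at h4
  simp only [Prod.fst_sub, Prod.snd_sub] at h4
  set a := ‖p.1 - act χ z.1‖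
  set b := ‖p.2 - act χ z.2‖
  have ha : 0 ≤ a := norm_nonneg _
  have hb : 0 ≤ b := norm_nonneg _
  nlinarith [mul_nonneg ha hb, mul_nonneg (zero_le_one.trans hc1) (mul_nonneg ha hb)]

/-- Operators whose Gabor matrix is concentrated on the graph of a symplectic map `χ` move wave
front sets at most along `χ`. -/
theorem GaborDecay.nonDecaySet_subset {T : L2 ι →L[ℂ] L2 ι}
    {χ ψ : Matrix (ι ⊕ ι) (ι ⊕ ι) ℝ} (hT : GaborDecay T χ) (hχ : |χ.det| = 1) (hψ : χ * ψ = 1)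
    (hJ : χᵀ * matJ ι * χ = matJ ι) {B : Matrix (ι ⊕ ι) (ι ⊕ ι) ℝ} (hB : B.IsSymm) (u : L2 ι) :
    nonDecaySet (cohenWigner B (T u)) ⊆ act χ '' nonDecaySet (cohenWigner (ψ * B * ψᵀ) u) := by
  rintro z ⟨hz0, hz⟩
  have hχψ : act χ (act ψ z) = z := by rw [← act_mul, hψ, act_one]
  refine ⟨act ψ z, ⟨fun h0 => hz0 ?_, ?_⟩, hχψ⟩
  · rw [← hχψ, h0]; exact (actL χ).map_zero
  rintro ⟨Γ, hΓo, hΓc, hzΓ, hΓ⟩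
  refine hz ?_
  have hψz : act ψ z ≠ 0 := fun h0 => hz0 (by rw [← hχψ, h0]; exact (actL χ).map_zero)
  -- Removing the origin makes the complement nonempty and bounds the distance to it by |x|.
  set Γ' : Set (Phase ι) := Γ \ {0} with hΓ'
  have hΓ'o : IsOpen Γ' := hΓo.sdiff isClosed_singleton
  have h0 : (0 : Phase ι) ∉ Γ' := fun h => h.2 rfl
  have hconic : ∀ x, ∀ r : ℝ, 0 < r → (r • x ∈ Γ'ᶜ ↔ x ∈ Γ'ᶜ) := by
    have h1 : ∀ x, ∀ r : ℝ, 0 < r → x ∈ Γ' → r • x ∈ Γ' := fun x r hr hx =>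
      ⟨hΓc x hx.1 r hr, fun h => hx.2 ((smul_eq_zero.1 h).resolve_left hr.ne')⟩
    refine fun x r hr => not_congr ⟨fun h => ?_, h1 x r hr⟩
    have := h1 _ _ (inv_pos.2 hr) h
    rwa [inv_smul_smul₀ hr.ne'] at this
  set δ : Phase ι → ℝ := fun x => Metric.infDist (act ψ x) Γ'ᶜ with hδ
  have hδc : Continuous δ := (Metric.continuous_infDist_pt _).comp (continuous_act ψ)
  have hδz : 0 < δ z :=
    (hΓ'o.isClosed_compl.notMem_iff_infDist_pos ⟨0, h0⟩).1 fun h => h ⟨hzΓ, hψz⟩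
  have hnz : 0 < ‖z‖ := norm_pos_iff.2 hz0
  -- Since δ is positively homogeneous of degree one, the set where ε|x| < δ(x) is an open cone, and
  -- half of the ratio at z places z inside it.
  set ε := δ z / (2 * ‖z‖) with hε
  have hε0 : 0 < ε := by positivity
  have hopen : IsOpen {x : Phase ι | ε * ‖x‖ < δ x} :=
    isOpen_lt (continuous_const.mul continuous_norm) hδc
  refine ⟨{x | ε * ‖x‖ < δ x}, hopen, fun x hx r hr => ?_, ?_, fun N => ?_⟩
  · rw [mem_ofPred_eq] at hx ⊢
    have : δ (r • x) = r * δ x := by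
      rw [hδ]; dsimp only
      rw [act_smul_right, infDist_smul_of_conic hconic hr]
    rw [this, norm_smul, Real.norm_of_nonneg hr.le]
    nlinarith
  · rw [mem_ofPred_eq, hε]
    have : δ z / (2 * ‖z‖) * ‖z‖ = δ z / 2 := by field_simp
    rw [this]; linarith
  · refine lintegral_cone_lt_top hopen.measurableSet hε0 (fun x hx => le_of_lt hx) N ?_
    refine hT.lintegral_cohenWigner_lt_top hχ hψ hJ hB (isModerate_infDist Γ'ᶜ N) u ?_
    refine lintegral_infDist_lt_top hΓ'o.measurableSet h0 (lintegral_enorm_sq_lt_top _) N ?_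
    exact lt_of_le_of_lt (lintegral_mono_set sdiff_subset) (hΓ N)

/-- The second inclusion is the first one for time -t, initial state U(t)u and the conjugated
matrix; conjugating back by the flow restores B. -/
theorem IsPropagator.nonDecaySet_eq {Q : Matrix (ι ⊕ ι) (ι ⊕ ι) ℝ} (hQ : Q.IsSymm)
    {σ : Phase ι → ℂ} (hσ : IsSymbol σ) {U : ℝ → L2 ι →L[ℂ] L2 ι}
    (hU : IsPropagator (fun z => ((1 / 2 * quad Q z : ℝ) : ℂ) + σ z) U) (t : ℝ)
    {B : Matrix (ι ⊕ ι) (ι ⊕ ι) ℝ} (hB : B.IsSymm) (u : L2 ι) :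
    nonDecaySet (cohenWigner B (U t u)) = act (flow Q t) ''
      nonDecaySet (cohenWigner (flow Q (-t) * B * (flow Q (-t))ᵀ) u) := by
  refine Subset.antisymm ((hU.gaborDecay hQ hσ t).nonDecaySet_subset (abs_det_flow hQ t)
    (flow_mul_flow_neg Q t) (transpose_flow_mul hQ t) hB u) ?_
  have h := (hU.gaborDecay hQ hσ (-t)).nonDecaySet_subset (abs_det_flow hQ (-t))
    (flow_neg_mul_flow Q t) (transpose_flow_mul hQ (-t)) (isSymm_conj hB (flow Q (-t))) (U t u)
  have e1 : U (-t) (U t u) = u := by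
    rw [← ContinuousLinearMap.comp_apply, ← hU.add, neg_add_cancel, hU.zero]; rfl
  have e2 : flow Q t * (flow Q (-t) * B * (flow Q (-t))ᵀ) * (flow Q t)ᵀ = B := by
    have h1 : (flow Q (-t))ᵀ * (flow Q t)ᵀ = 1 := by
      rw [← transpose_mul, flow_mul_flow_neg, transpose_one]
    rw [mul_assoc, mul_assoc, h1, mul_one, ← mul_assoc, flow_mul_flow_neg, one_mul]
  rw [e1, e2] at h
  rintro _ ⟨z, hz, rfl⟩
  obtain ⟨w, hw, rfl⟩ := h hz
  rwa [← act_mul, flow_mul_flow_neg, act_one]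

end WaveFrontSets

end WignerFlow

end

/-! ### Assembly of the theorem. -/

open WignerFlow
theorem theorem7p7 (d : ℕ)
    (Q : Matrix (Fin d ⊕ Fin d) (Fin d ⊕ Fin d) ℝ) (hQ : Q.IsSymm)
    (σ : Phase (Fin d) → ℂ) (hσ : IsSymbol σ)
    (U : ℝ → L2 (Fin d) →L[ℂ] L2 (Fin d))
    (hU : IsPropagator (fun z => ((1 / 2 * quad Q z : ℝ) : ℂ) + σ z) U)
    (t : ℝ) :
    (∀ 𝒜 : Matrix ((Fin d ⊕ Fin d) ⊕ (Fin d ⊕ Fin d)) ((Fin d ⊕ Fin d) ⊕ (Fin d ⊕ Fin d)) ℝ,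
      IsCovariant 𝒜 →
      ∃ 𝒜t, (IsTransported 𝒜 (flow Q t) 𝒜t ∧
          ∀ 𝒜', IsTransported 𝒜 (flow Q t) 𝒜' → 𝒜' = 𝒜t) ∧
        ∀ u₀ : L2 (Fin d),
          metaWaveFront 𝒜 (U t u₀) = act (flow Q t) '' metaWaveFront 𝒜t u₀) ∧
    (∀ u₀ : L2 (Fin d), wignerWaveFront (U t u₀) = act (flow Q t) '' wignerWaveFront u₀) := by
  refine ⟨fun 𝒜 h => ?_, fun u => ?_⟩
  · have hB := isSymm_conj h.isSymm (flow Q (-t))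
    have hT := isTransported_covariantOf h (abs_det_flow hQ t) (flow_mul_flow_neg Q t)
    refine ⟨_, ⟨hT, fun 𝒜' h' => h'.unique hT⟩, fun u => ?_⟩
    rw [h.metaWaveFront_eq, (covariantOf_isCovariant hB).metaWaveFront_eq,
      cohenMatrix_covariantOf hB, hU.nonDecaySet_eq hQ hσ t h.isSymm]
  · rw [wignerWaveFront_eq, wignerWaveFront_eq, hU.nonDecaySet_eq hQ hσ t isSymm_zero, mul_zero,
      zero_mul]
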